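/- Let $f:\mathbb R^2\to\mathbb R$ and $g:\mathbb R\to\mathbb R$ be $C^\infty$, with $g(t+T)=g(t)$ for a fixed $T>0$, and consider the impact oscillator $$\ddot x+f(x,\dot x)=g(t),\qquad x\ge c,$$ with clearance $c\in\mathbb R$ and restitution rule $\dot x\mapsto\rho_c(\dot x)$ at $x=c$. Here $(c,v)\mapsto\rho_c(v)$ is a $C^1$ function on $\mathbb R^2$ with $\rho_c(0)=0$, with $\rho_c(v)>0$ for $v<0$, and with $-1<\rho_{c_0}'(0)<0$ at the parameter value $c_0$ below. For $(\tau,v)\in\mathbb R^2$ let $x_c(\tau,v;t)$ be the position, at time $\tau+t$, of the solution of the differential equation with $x=c$, $\dot x=v$ at time $\tau$, and let $a_c(\tau)=\ddot x_c(\tau,0;0)=g(\tau)-f(c,0)$. Let $\Pi_0=\{v=0\}$ and $\Pi_0^+=\{v\ge0\}$ in the $(\tau,v)$-plane. The impact map $G_c$ is the partially defined map of $\Pi_0^+$ given as follows. If $v>0$, or if $v=0$ and $x_c(\tau,0;t)>c$ for all small $t>0$, then $$G_c(\tau,v)=(\tau+t_1,\ \rho_c(\dot x_c(\tau,v;t_1))),$$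 where $t_1$ is the first $t>0$ with $x_c(\tau,v;t)=c$ ($G_c$ is undefined if there is none). Otherwise, that is if $v=0$ and the solution does not leave the obstacle in this sense, $G_c(\tau,0)=(\tau,0)$. For $X\in\Pi_0$ the stable manifold $W^s(X)$ is the set of all $w\in\Pi_0^+$ for which all iterates $G_c^n(w)$ are defined and $G_c^n(w)\to X$ as $n\to\infty$. Let $(\tau_*,0)$ be a negative swan point for $c=c_0$, that is $$a_{c_0}(\tau_*)=a_{c_0}'(\tau_*)=0,\qquad a_{c_0}''(\tau_*)<0,$$ and suppose that $$a_{c_0}''(\tau_*)\cdot\frac{\partial a_c(\tau_*)}{\partial c}\Big|_{c=c_0}<0,$$ so that a pair of zeros of $a_c$ is created as $c$ increases through $c_0$. **Proposition 6.1.** For every sufficiently small $\eta>0$ there is $\delta>0$ such that for every $c\in(c_0,c_0+\delta)$ the following holds. The function $a_c$ has exactly two zeros $\tau_1<\tau_2$ in $(\tau_*-\eta,\tau_*+\eta)$, with $a_c'(\tau_1)>0>a_c'(\tau_2)$. There is $\tau_3\in(\tau_2,\tau_*+\eta)$ with $a_c(\tau_3)<0$ such that, with $X=(\tau_3,0)$,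 the stable manifold $W^s(X)$ passes through the tangency point $A=(\tau_1,0)$ and is tangent to $\Pi_0$ at $A$, in the following sense: 1. $W^s(X)$ contains an embedded $C^1$ arc that has $X$ as an end-point and $A$ as an interior point, and the tangent line to this arc at $A$ is $\Pi_0$; 2. for every $\kappa>0$, all points $(\tau,v)\in W^s(X)$ sufficiently close to $A$ satisfy $|v|\le\kappa|\tau-\tau_1|$. -/

import Mathlib

open Set Filter Topology
open scoped ContDiff

namespace ImpactOscillator

/-- Initial acceleration `a_c(τ) = ẍ_c(τ,0;0)` of the solution of `ẍ + f(x, ẋ) = g(t)` with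
`(x, ẋ) = (c, 0)` at time `τ`; by the differential equation it is `g τ - f c 0`
(see `IsFlight.hasDerivWithinAt_acc`). -/
def acc (f : ℝ → ℝ → ℝ) (g : ℝ → ℝ) (c τ : ℝ) : ℝ := g τ - f c 0

/-- `(x, y)` are position and velocity, on the interval `[0, T]` of elapsed time, of the
solution of `ẍ + f(x, ẋ) = g` with `x = c` and `ẋ = v` at time `τ`; in other words
`x t = x_c(τ, v; t)` and `y t = ẋ_c(τ, v; t)` for `0 ≤ t ≤ T`.
(The solution is not required to exist beyond elapsed time `T`.) -/
structure IsFlight (f : ℝ → ℝ → ℝ) (g : ℝ → ℝ) (c τ v T : ℝ) (x y : ℝ → ℝ) : Prop where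
  position_zero : x 0 = c
  velocity_zero : y 0 = v
  hasDeriv_position : ∀ t ∈ Icc 0 T, HasDerivWithinAt x (y t) (Icc 0 T) t
  hasDeriv_velocity : ∀ t ∈ Icc 0 T,
    HasDerivWithinAt y (g (τ + t) - f (x t) (y t)) (Icc 0 T) t

theorem IsFlight.hasDerivWithinAt_acc {f : ℝ → ℝ → ℝ} {g : ℝ → ℝ} {c τ T : ℝ}
    {x y : ℝ → ℝ} (h : IsFlight f g c τ 0 T x y) (hT : 0 ≤ T) :
    HasDerivWithinAt y (acc f g c τ) (Icc 0 T) 0 := by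
  have := h.hasDeriv_velocity 0 ⟨le_refl 0, hT⟩
  simpa [acc, h.position_zero, h.velocity_zero] using this

/-- The solution starting at `(x, ẋ) = (c, v)` at time `τ` satisfies `x > c` for all
sufficiently small positive elapsed times. -/
def LeavesObstacle (f : ℝ → ℝ → ℝ) (g : ℝ → ℝ) (c τ v : ℝ) : Prop :=
  ∃ T > 0, ∃ x y : ℝ → ℝ, IsFlight f g c τ v T x y ∧ ∀ t ∈ Ioc 0 T, c < x t

/-- The first-hit map `F_c`, as a single-valued relation on initial data `w = (τ, v)` in the
closed half-plane `v ≥ 0`: `FirstHit f g c w z` says that `F_c` is defined at `w` with value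
`z = (τ, v; t)`. Either `t > 0` is the first time after leaving the obstacle `x = c` at which the
solution meets it again, or `v = 0`, the solution does not leave the obstacle, the oscillator
rests there, and `t = 0`. -/
def FirstHit (f : ℝ → ℝ → ℝ) (g : ℝ → ℝ) (c : ℝ) (w : ℝ × ℝ) (z : ℝ × ℝ × ℝ) : Prop :=
  z.1 = w.1 ∧ z.2.1 = w.2 ∧
    ((0 < z.2.2 ∧ ∃ x y : ℝ → ℝ, IsFlight f g c w.1 w.2 z.2.2 x y ∧
        (∀ t ∈ Ioo 0 z.2.2, c < x t) ∧ x z.2.2 = c) ∨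
      (w.2 = 0 ∧ ¬ LeavesObstacle f g c w.1 w.2 ∧ z.2.2 = 0))

/-- The re-set map `φ_c (τ, v; t) = (τ + t, ẋ_c(τ, v; t))`, as a single-valued relation
(the solution may fail to exist up to elapsed time `t`). -/
def Reset (f : ℝ → ℝ → ℝ) (g : ℝ → ℝ) (c : ℝ) (z : ℝ × ℝ × ℝ) (u : ℝ × ℝ) : Prop :=
  u.1 = z.1 + z.2.2 ∧ ∃ x y : ℝ → ℝ, IsFlight f g c z.1 z.2.1 z.2.2 x y ∧ u.2 = y z.2.2

/-- The restitution map `R_c (τ, v) = (τ, ρ_c(v))`. -/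
def restitution (ρ : ℝ → ℝ → ℝ) (c : ℝ) (u : ℝ × ℝ) : ℝ × ℝ := (u.1, ρ c u.2)

/-- The partially defined impact map `G_c = R_c ∘ φ_c ∘ F_c` of the half-plane `v ≥ 0`, as a
single-valued relation: `G_c` is defined at `w` and `w' = G_c(w)`. -/
def ImpactStep (f : ℝ → ℝ → ℝ) (g : ℝ → ℝ) (ρ : ℝ → ℝ → ℝ) (c : ℝ) (w w' : ℝ × ℝ) : Prop :=
  ∃ z u, FirstHit f g c w z ∧ Reset f g c z u ∧ w' = restitution ρ c u

/-- The stable manifold `W^s(X)`, that is the set of all points `w` of the half-plane `v ≥ 0`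
all of whose iterates `G_c^n(w)` are defined, with `G_c^n(w) → X` as `n → ∞`. -/
def stableManifold (f : ℝ → ℝ → ℝ) (g : ℝ → ℝ) (ρ : ℝ → ℝ → ℝ) (c : ℝ) (X : ℝ × ℝ) :
    Set (ℝ × ℝ) :=
  {w | 0 ≤ w.2 ∧ ∃ orbit : ℕ → ℝ × ℝ, orbit 0 = w ∧
    (∀ n, ImpactStep f g ρ c (orbit n) (orbit (n + 1))) ∧ Tendsto orbit atTop (𝓝 X)}

/-- `(τ, 0)` is a negative swan point at the parameter value `c`. -/
structure IsNegativeSwanPoint (f : ℝ → ℝ → ℝ) (g : ℝ → ℝ) (c τ : ℝ) : Prop where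
  acc_eq_zero : acc f g c τ = 0
  deriv_acc_eq_zero : deriv (acc f g c) τ = 0
  iteratedDeriv_acc_neg : iteratedDeriv 2 (acc f g c) τ < 0

/-- The quantity `d(c, τ) = a_c''(τ) · ∂a/∂c (c, τ)` whose sign decides whether a pair of zeros of
`a_c` is created or annihilated as `c` increases through a swan value. -/
noncomputable def unfoldingSign (f : ℝ → ℝ → ℝ) (g : ℝ → ℝ) (c τ : ℝ) : ℝ :=
  iteratedDeriv 2 (acc f g c) τ * deriv (fun c' => acc f g c' τ) c

/-- `γ : [0,1] → ℝ²` is an injectively immersed (hence embedded) `C¹` arc. -/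
structure IsC1Arc (γ : ℝ → ℝ × ℝ) : Prop where
  contDiffOn : ContDiffOn ℝ 1 γ (Icc 0 1)
  immersed : ∀ s ∈ Icc (0 : ℝ) 1, derivWithin γ (Icc 0 1) s ≠ 0
  injOn : InjOn γ (Icc 0 1)

/-- The stable manifold of `X` passes through the point `A = (τ₁, 0)` and is tangent to the axis
`Π₀ = {v = 0}` there. It contains an embedded `C¹` arc with end-point `X` which has `A` as an
interior point and whose tangent line at `A` is `Π₀`; moreover all of the stable manifold, near
`A`, has no limiting direction at `A` other than that of `Π₀`. -/
def StableManifoldTangentAt (f : ℝ → ℝ → ℝ) (g : ℝ → ℝ) (ρ : ℝ → ℝ → ℝ) (c : ℝ)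
    (X : ℝ × ℝ) (τ₁ : ℝ) : Prop :=
  (∃ γ : ℝ → ℝ × ℝ, IsC1Arc γ ∧ (∀ s ∈ Icc (0 : ℝ) 1, γ s ∈ stableManifold f g ρ c X) ∧
    γ 0 = X ∧ ∃ s ∈ Ioo (0 : ℝ) 1, γ s = (τ₁, 0) ∧ (deriv γ s).2 = 0) ∧
  ∀ κ > 0, ∀ᶠ w in 𝓝 ((τ₁, 0) : ℝ × ℝ), w ∈ stableManifold f g ρ c X →
    |w.2| ≤ κ * |w.1 - τ₁|

end ImpactOscillator

/-! The proof is a blow-up at the swan point. Write `c = c₀ + (K/m) e²`, time `τs + e s`, position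
`c + K e⁴ X` and velocity `K e³ Y`, where `g'' = -2K` at `τs` and `∂f/∂c = -m` at `(c₀, 0)`. The
equation becomes `X'' = Φ (e, s, X, Y)` with `Φ (0, s, X, Y) = 1 - s²` (`exists_scaled_field`), and
the restitution rule becomes `w ↦ w * k (e, w)` with `k (0, w) = r = -ρ'(0)`
(`exists_scaled_factor`). The two new zeros of the acceleration lie near `s = -1` and `s = 1`. At `e
= 0` the flight leaving `s = -1` tangentially lands at `s = 3`, where the acceleration is negative,
and its later impacts accumulate at a point of rest. For small `e > 0` let `sA` be the zero near
`-1` and `σ` the limit of the impact times after the tangential flight from `sA`. The point `X` is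
`σ` in the original variables.

Flights are parametrised by starting time `s` and duration `t` instead of launch speed. They solve a
two-point boundary value problem, and rescaling time to `[0, 1]` makes it a uniform contraction
(`exists_flightFamily`). Launch and landing speeds are `t` times `C¹` functions, regular also at `t
= 0`, so the impact map becomes the regular map `(s, t) ↦ (s + t, nextDuration)` near rest. Its
points with `t = 0` are fixed, and durations contract there with rate close to `r < 1`. Hence the
limit of the impact times is a `C¹` function of `(s, t)` (`exists_limitPoint_fiberC1`). The scaled
restitution rule is not known to be differentiable in `e` at `0`, so regularity is fiberwise: `C¹`
in `(s, t)`, with value and derivative jointly continuous in `(e, s, t)`.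

The unperturbed problem is explicit. The quantity speed² over `s² - 1` does not grow during a flight
(`energy_le`), which makes durations summable. The order of landing times and durations persists
along orbits (`next_mono`), so the limit time grows with slope at least `1` in the duration. By
compactness the slope exceeds `1/2` for small `e`, so the level set {limit time = `σ`} is a `C¹`
graph `t = ψ s` over an interval from left of `sA` up to `σ` (`exists_leaf_band`,
`exists_leaf_function`). The arc is its image `v s = speed (e, s, ψ s)`.

Tangency comes from comparing the tangential flight with the flight from a nearby `s` landing at the
same time (`compare_with_tangential`). The launch speed of the latter is `(s - sA)²` up to ten per
cent, while the landing speeds, and hence the limits, differ by `O(|s - sA|³)`. Therefore `v s` lies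
between `4/5` and `6/5` of `(s - sA)²` (`exists_speed_estimate`). The lower bound also exceeds the
launch speeds of short hops, about `3/4 (s - sA)²` at most, so no earlier impact interferes
(`exists_speed_lt`, `exists_no_early`). A point near `A` above a cone about the axis launches a
flight whose duration is not `ψ s`, so its orbit has another limit. As the impact map is
single-valued, such a point is not in `W^s(X)`. -/

namespace ImpactOscillator

/-! ### Composition operators on spaces of continuous functions -/

section Omega

variable {K E G : Type*} [TopologicalSpace K] [CompactSpace K]
  [NormedAddCommGroup E] [NormedSpace ℝ E] [NormedAddCommGroup G] [NormedSpace ℝ G]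

/-- Pointwise application of a continuous family of continuous linear maps. -/
noncomputable def pointwiseApply : C(K, E →L[ℝ] G) →L[ℝ] C(K, E) →L[ℝ] C(K, G) :=
  LinearMap.mkContinuous₂ (E := C(K, E →L[ℝ] G)) (F := C(K, E)) (G := C(K, G))
    (LinearMap.mk₂ ℝ (fun (A : C(K, E →L[ℝ] G)) (h : C(K, E)) =>
        (⟨fun k => A k (h k), A.continuous.clm_apply h.continuous⟩ : C(K, G)))
      (fun _ _ _ => by ext; simp) (fun _ _ _ => by ext; simp)
      (fun _ _ _ => by ext; simp) (fun _ _ _ => by ext; simp)) 1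
    (fun A h => by
      rw [ContinuousMap.norm_le _ (by positivity)]
      intro k
      calc ‖A k (h k)‖ ≤ ‖A k‖ * ‖h k‖ := (A k).le_opNorm _
        _ ≤ ‖A‖ * ‖h‖ := by gcongr <;> exact ContinuousMap.norm_coe_le_norm _ _
        _ = 1 * ‖A‖ * ‖h‖ := by ring)

@[simp] theorem pointwiseApply_apply (A : C(K, E →L[ℝ] G)) (h : C(K, E)) (k : K) :
    pointwiseApply A h k = A k (h k) := rfl

/-- Composition with a `C¹` map is a `C¹` map of spaces of continuous functions. -/
theorem contDiff_one_postcomp {H : E → G} (hH : ContDiff ℝ 1 H) :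
    ContDiff ℝ 1 (fun f : C(K, E) => ContinuousMap.comp ⟨H, hH.continuous⟩ f) := by
  have hH' : Continuous (fderiv ℝ H) := hH.continuous_fderiv one_ne_zero
  let D : C(K, E) → C(K, E →L[ℝ] G) := fun f => ContinuousMap.comp ⟨fderiv ℝ H, hH'⟩ f
  have hD : Continuous D := ContinuousMap.continuous_postcomp _
  rw [contDiff_one_iff_hasFDerivAt]
  refine ⟨fun f => pointwiseApply (D f), (pointwiseApply (K := K)).continuous.comp hD, fun f => ?_⟩
  rw [hasFDerivAt_iff_isLittleO_nhds_zero, Asymptotics.isLittleO_iff]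
  intro ε hε
  obtain ⟨δ, hδ, hball⟩ := (Metric.continuousAt_iff (α := C(K, E)) (β := C(K, E →L[ℝ] G)) (f := D)).1
    (hD.continuousAt (x := f)) ε hε
  filter_upwards [Metric.ball_mem_nhds (0 : C(K, E)) hδ] with h hh
  rw [mem_ball_zero_iff] at hh
  rw [ContinuousMap.norm_le _ (by positivity)]
  intro k
  -- Continuity of `f ↦ fderiv ℝ H ∘ f` in the sup norm makes this estimate uniform in `k`. No
  -- compactness of segments in `E` is needed.
  have key : ∀ y ∈ segment ℝ (f k) (f k + h k), ‖fderiv ℝ H y - fderiv ℝ H (f k)‖ ≤ ε := by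
    intro y hy
    obtain ⟨θ, hθ, rfl⟩ := (segment_eq_image' ℝ (f k) (f k + h k)) ▸ hy
    have : dist (f + θ • h) f < δ := by
      rw [dist_eq_norm, add_sub_cancel_left, norm_smul, Real.norm_of_nonneg hθ.1]
      exact (mul_le_of_le_one_left (norm_nonneg _) hθ.2).trans_lt hh
    have h2 := hball this
    have h3 := (ContinuousMap.dist_apply_le_dist (f := D (f + θ • h)) (g := D f) k).trans h2.le
    rw [dist_eq_norm] at h3
    simpa [D] using h3
  have := (convex_segment (𝕜 := ℝ) (f k) (f k + h k)).norm_image_sub_le_of_norm_hasFDerivWithin_le'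
    (f := H) (f' := fderiv ℝ H) (φ := fderiv ℝ H (f k)) (C := ε)
    (fun y _ => ((hH.differentiable one_ne_zero) y).hasFDerivAt.hasFDerivWithinAt) key
    (left_mem_segment ℝ _ _) (right_mem_segment ℝ _ _)
  simp only [ContinuousMap.coe_sub, Pi.sub_apply, ContinuousMap.comp_apply, ContinuousMap.coe_add,
    Pi.add_apply, ContinuousMap.coe_mk, pointwiseApply_apply, D, add_sub_cancel_left] at this ⊢
  refine this.trans ?_
  gcongr
  exact ContinuousMap.norm_coe_le_norm _ _

end Omega

/-! ### Implicit functions and fixed points depending on parameters -/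

section FixedPoint

variable {P E : Type*} [NormedAddCommGroup P] [NormedSpace ℝ P] [CompleteSpace P]
  [NormedAddCommGroup E] [NormedSpace ℝ E] [CompleteSpace E]

/-- A continuous linear equation with invertible partial derivative: a function which is locally the
only solution of a `C¹` equation is `C¹`. -/
theorem contDiffAt_of_locally_unique_solution {F : P × E → E} {U : Set (P × E)} (hU : IsOpen U)
    {b : P → E} {p : P} (hp : (p, b p) ∈ U) (hF : ContDiffAt ℝ 1 F (p, b p))
    (hinv : (fderiv ℝ F (p, b p) ∘L .inr ℝ P E).IsInvertible)
    (huniq : ∀ᶠ q in 𝓝 p, ∀ y, (q, y) ∈ U → F (q, y) = F (p, b p) → b q = y) :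
    ContDiffAt ℝ 1 b p ∧ ∀ᶠ q in 𝓝 p, (q, b q) ∈ U ∧ F (q, b q) = F (p, b p) := by
  have h1 := hF.contDiffAt_implicitFunction one_ne_zero hinv
  have h0 := hF.implicitFunction_apply_self one_ne_zero hinv
  have h2 := hF.eventually_apply_implicitFunction one_ne_zero hinv
  set ψ := hF.implicitFunction one_ne_zero hinv
  simp only at h0 h1 h2
  have h3 : ∀ᶠ q in 𝓝 p, (q, ψ q) ∈ U := by
    have : ContinuousAt (fun q => (q, ψ q)) p := continuousAt_id.prodMk h1.continuousAt
    exact this.eventually_mem (hU.mem_nhds (by simpa only [h0] using hp))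
  have h4 : b =ᶠ[𝓝 p] ψ := by
    filter_upwards [h2, h3, huniq] with q hq2 hq3 hq
    exact hq _ hq3 hq2
  refine ⟨h1.congr_of_eventuallyEq h4, ?_⟩
  filter_upwards [h2, h3, h4] with q hq2 hq3 hq4
  rw [hq4]
  exact ⟨hq3, hq2⟩

/-- Neumann series. -/
theorem isInvertible_of_norm_sub_id_lt_one {A : E →L[ℝ] E} (hA : ‖.id ℝ E - A‖ < 1) :
    A.IsInvertible := by
  have : IsUnit (1 - (1 - A)) := (Units.oneSub (1 - A) hA).isUnit
  rw [sub_sub_cancel] at this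
  obtain ⟨u, hu⟩ := this
  exact ⟨ContinuousLinearEquiv.unitsEquiv ℝ E u, by ext x; rw [← hu]; rfl⟩

/-- The fixed point of a uniform contraction depends in a `C¹` way on parameters. -/
theorem exists_contDiffOn_fixedPoint {F : P × E → E} (hF : ContDiff ℝ 1 F) {U : Set P}
    (hU : IsOpen U) {R : ℝ}
    (hlip : ∀ q ∈ U, ∀ x ∈ Metric.closedBall (0 : E) R, ∀ y ∈ Metric.closedBall (0 : E) R,
      ‖F (q, x) - F (q, y)‖ ≤ 1 / 2 * ‖x - y‖)
    (hR : 0 ≤ R)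
    (hmaps : ∀ q ∈ U, ∀ x ∈ Metric.closedBall (0 : E) R, F (q, x) ∈ Metric.ball (0 : E) R) :
    ∃ b : P → E, (∀ q ∈ U, b q ∈ Metric.ball (0 : E) R ∧ F (q, b q) = b q) ∧
      ContDiffOn ℝ 1 b U := by
  have hex : ∀ q ∈ U, ∃ y ∈ Metric.ball (0 : E) R, F (q, y) = y := by
    intro q hq
    have hms : MapsTo (fun x => F (q, x)) (Metric.closedBall (0 : E) R)
        (Metric.closedBall (0 : E) R) := fun x hx => Metric.ball_subset_closedBall (hmaps q hq x hx)
    have hc : ContractingWith (1 / 2) (hms.restrict _ _ _) := by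
      refine ⟨by rw [← NNReal.coe_lt_coe]; norm_num, LipschitzWith.of_dist_le_mul fun x y => ?_⟩
      simpa [Subtype.dist_eq, dist_eq_norm] using hlip q hq x x.2 y y.2
    obtain ⟨y, hy, hfix, -⟩ := hc.exists_fixedPoint' (x := 0) Metric.isClosed_closedBall.isComplete
      hms (by simpa using hR) (edist_ne_top _ _)
    exact ⟨y, by rw [← hfix.eq]; exact hmaps q hq y hy, hfix.eq⟩
  classical
  let b : P → E := fun q => if h : q ∈ U then (hex q h).choose else 0
  have hb : ∀ q ∈ U, b q ∈ Metric.ball (0 : E) R ∧ F (q, b q) = b q := by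
    intro q hq
    simp only [b, hq, dif_pos]
    exact (hex q hq).choose_spec
  refine ⟨b, hb, fun p hp => ContDiffAt.contDiffWithinAt ?_⟩
  -- The fixed point is a zero of `y - F (q, y)`, whose derivative in `y` is within `1/2` of the
  -- identity by the Lipschitz bound.
  have hG : ContDiff ℝ 1 (fun z : P × E => z.2 - F z) := contDiff_snd.sub hF
  have hdiff : DifferentiableAt ℝ F (p, b p) := hF.differentiable one_ne_zero _
  refine (contDiffAt_of_locally_unique_solution (F := fun z : P × E => z.2 - F z)
    (U := U ×ˢ Metric.ball 0 R) (hU.prod Metric.isOpen_ball) ⟨hp, (hb p hp).1⟩ hG.contDiffAt ?_ ?_).1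
  · apply isInvertible_of_norm_sub_id_lt_one
    have h1 : fderiv ℝ (fun z : P × E => z.2 - F z) (p, b p) =
        .snd ℝ P E - fderiv ℝ F (p, b p) :=
      (hasFDerivAt_snd.sub hdiff.hasFDerivAt).fderiv
    have h2 : ContinuousLinearMap.id ℝ E - (fderiv ℝ (fun z : P × E => z.2 - F z) (p, b p)) ∘L
        .inr ℝ P E = fderiv ℝ F (p, b p) ∘L .inr ℝ P E := by
      rw [h1]; ext x; simp
    have h3 : HasFDerivAt (fun x => F (p, x)) (fderiv ℝ F (p, b p) ∘L .inr ℝ P E) (b p) :=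
      hdiff.hasFDerivAt.comp (b p) (hasFDerivAt_prodMk_right p (b p))
    -- A Lipschitz bound controls the derivative only at interior points. This is why `F` is
    -- required to map into the open ball.
    have h4 := h3.le_of_lipschitzOn (C := 1 / 2) (Metric.isOpen_ball.mem_nhds (hb p hp).1)
      (LipschitzOnWith.of_dist_le_mul fun x hx y hy => by
        simpa [dist_eq_norm] using hlip p hp x (Metric.ball_subset_closedBall hx) y
          (Metric.ball_subset_closedBall hy))
    have h5 : ((1 / 2 : NNReal) : ℝ) < 1 := by norm_num
    rw [h2]
    exact h4.trans_lt h5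
  · filter_upwards with q y hy hFy
    have hq := hb q hy.1
    have : F (q, y) = y := by
      simp only [(hb p hp).2, sub_self] at hFy
      exact (sub_eq_zero.1 hFy).symm
    have h6 := hlip q hy.1 _ (Metric.ball_subset_closedBall hq.1) y
      (Metric.ball_subset_closedBall hy.2)
    rw [hq.2, this] at h6
    have h7 : ‖b q - y‖ = 0 := le_antisymm (by linarith [norm_nonneg (b q - y)]) (norm_nonneg _)
    exact sub_eq_zero.1 (norm_eq_zero.1 h7)

end FixedPoint

/-! ### The boundary value problem `x'' = φ` on the unit interval -/

section Paths

/-- Continuous real functions on the unit interval. -/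
abbrev Path01 := C(unitInterval, ℝ)

/-- Extension of a path to the real line. -/
noncomputable def Path01.ext (φ : Path01) : ℝ → ℝ := IccExtend zero_le_one φ

theorem Path01.continuous_ext (φ : Path01) : Continuous φ.ext := φ.continuous.Icc_extend'

theorem Path01.ext_of_mem (φ : Path01) {u : ℝ} (hu : u ∈ Icc (0 : ℝ) 1) : φ.ext u = φ ⟨u, hu⟩ :=
  IccExtend_of_mem _ _ hu

theorem Path01.ext_coe (φ : Path01) (u : unitInterval) : φ.ext u = φ u :=
  IccExtend_val _ _ u

theorem Path01.abs_ext_le (φ : Path01) (u : ℝ) : |φ.ext u| ≤ ‖φ‖ := by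
  rw [← Real.norm_eq_abs]; exact ContinuousMap.norm_coe_le_norm φ _

/-- The primitive vanishing at `0`. -/
noncomputable def primitive : Path01 →L[ℝ] Path01 :=
  LinearMap.mkContinuous (E := Path01) (F := Path01)
    { toFun := fun φ => ⟨fun u => ∫ x in (0 : ℝ)..u, φ.ext x,
        (intervalIntegral.continuous_primitive
          (fun a b => φ.continuous_ext.intervalIntegrable a b) 0).comp continuous_subtype_val⟩
      map_add' := fun φ ψ => by
        ext u
        exact intervalIntegral.integral_add (φ.continuous_ext.intervalIntegrable 0 u)
          (ψ.continuous_ext.intervalIntegrable 0 u)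
      map_smul' := fun c φ => by
        ext u
        exact intervalIntegral.integral_const_mul c _ } 1 (fun φ => by
      rw [ContinuousMap.norm_le _ (by positivity)]
      intro u
      have h := intervalIntegral.norm_integral_le_of_norm_le_const (a := 0) (b := u) (f := φ.ext)
        (C := ‖φ‖) (fun x _ => φ.abs_ext_le x)
      have hu := u.2
      rw [sub_zero, abs_of_nonneg hu.1] at h
      refine h.trans ?_
      rw [one_mul]
      exact mul_le_of_le_one_right (norm_nonneg _) hu.2)

theorem primitive_apply (φ : Path01) (u : unitInterval) :
    primitive φ u = ∫ x in (0 : ℝ)..u, φ.ext x := rfl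

theorem norm_primitive_le (φ : Path01) : ‖primitive φ‖ ≤ ‖φ‖ := by
  have := primitive.le_of_opNorm_le (LinearMap.mkContinuous_norm_le _ zero_le_one _) φ
  simpa using this

@[simp] theorem primitive_zero (φ : Path01) : primitive φ 0 = 0 := by simp [primitive_apply]

theorem hasDerivWithinAt_primitive (φ : Path01) {u : ℝ} (hu : u ∈ Icc (0 : ℝ) 1) :
    HasDerivWithinAt (primitive φ).ext (φ.ext u) (Icc 0 1) u := by
  have h := (φ.continuous_ext.integral_hasStrictDerivAt 0 u).hasDerivAt.hasDerivWithinAt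
    (s := Icc (0 : ℝ) 1)
  refine h.congr (fun x hx => ?_) ?_
  · rw [Path01.ext_of_mem _ hx]; rfl
  · rw [Path01.ext_of_mem _ hu]; rfl

/-- Velocity along the solution of `x'' = φ`, `x 0 = x 1 = 0`. -/
noncomputable def bvpVelocity : Path01 →L[ℝ] Path01 :=
  primitive - (ContinuousMap.evalCLM ℝ (1 : unitInterval) ∘L primitive ∘L primitive).smulRight
    (1 : Path01)

/-- Position along the solution of `x'' = φ`, `x 0 = x 1 = 0`. -/
noncomputable def bvpPosition : Path01 →L[ℝ] Path01 := primitive ∘L bvpVelocity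

theorem bvpVelocity_apply (φ : Path01) (u : unitInterval) :
    bvpVelocity φ u = primitive φ u - primitive (primitive φ) 1 := by
  simp [bvpVelocity]

theorem bvpVelocity_eq (φ : Path01) :
    bvpVelocity φ = primitive φ - primitive (primitive φ) 1 • (1 : Path01) := by
  simp [bvpVelocity]

theorem bvpPosition_zero (φ : Path01) : bvpPosition φ 0 = 0 := by simp [bvpPosition]

theorem bvpPosition_one (φ : Path01) : bvpPosition φ 1 = 0 := by
  have h1 : primitive (1 : Path01) 1 = 1 := by
    have : (1 : Path01).ext = fun _ => (1 : ℝ) := by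
      ext u; simp [Path01.ext, IccExtend]
    simp [primitive_apply, this]
  simp [bvpPosition, bvpVelocity_eq, h1]

theorem norm_bvpVelocity_le (φ : Path01) : ‖bvpVelocity φ‖ ≤ 2 * ‖φ‖ := by
  rw [bvpVelocity_eq]
  have h1 := norm_primitive_le φ
  have h2 := ContinuousMap.norm_coe_le_norm (primitive (primitive φ)) 1
  have h3 := norm_primitive_le (primitive φ)
  have h4 : ‖primitive (primitive φ) 1 • (1 : Path01)‖ ≤ ‖primitive (primitive φ) 1‖ := by
    rw [norm_smul]; simp
  have := norm_sub_le (primitive φ) (primitive (primitive φ) 1 • (1 : Path01))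
  linarith

theorem norm_bvpPosition_le (φ : Path01) : ‖bvpPosition φ‖ ≤ 2 * ‖φ‖ :=
  (norm_primitive_le _).trans (norm_bvpVelocity_le φ)

theorem hasDerivWithinAt_bvpPosition (φ : Path01) {u : ℝ} (hu : u ∈ Icc (0 : ℝ) 1) :
    HasDerivWithinAt (bvpPosition φ).ext ((bvpVelocity φ).ext u) (Icc 0 1) u :=
  hasDerivWithinAt_primitive _ hu

theorem hasDerivWithinAt_bvpVelocity (φ : Path01) {u : ℝ} (hu : u ∈ Icc (0 : ℝ) 1) :
    HasDerivWithinAt (bvpVelocity φ).ext (φ.ext u) (Icc 0 1) u := by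
  refine ((hasDerivWithinAt_primitive φ hu).sub_const (primitive (primitive φ) 1)).congr
    (fun x hx => ?_) ?_
  · rw [Path01.ext_of_mem _ hx, Path01.ext_of_mem _ hx, bvpVelocity_apply]
  · rw [Path01.ext_of_mem _ hu, Path01.ext_of_mem _ hu, bvpVelocity_apply]

theorem eqOn_Icc_of_hasDerivWithinAt {f g f' : ℝ → ℝ} {a b : ℝ}
    (hf : ∀ x ∈ Icc a b, HasDerivWithinAt f (f' x) (Icc a b) x)
    (hg : ∀ x ∈ Icc a b, HasDerivWithinAt g (f' x) (Icc a b) x) (h : f a = g a) :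
    EqOn f g (Icc a b) := by
  intro x hx
  rcases hx.1.eq_or_lt with rfl | hlt
  · exact h
  have hab : a < b := hlt.trans_le hx.2
  have := constant_of_derivWithin_zero (f := fun x => f x - g x) (a := a) (b := b)
    (fun y hy => ((hf y hy).sub (hg y hy)).differentiableWithinAt)
    (fun y hy => by
      have h1 := (hf y ⟨hy.1, hy.2.le⟩).sub (hg y ⟨hy.1, hy.2.le⟩)
      have := h1.derivWithin (uniqueDiffOn_Icc hab y ⟨hy.1, hy.2.le⟩)
      rw [sub_self] at this
      exact this) x hx
  simp only [h, sub_self] at this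
  exact sub_eq_zero.1 this

/-- The solution of `x'' = φ`, `x 0 = x₀`, `x 1 = 0` is unique. -/
theorem eqOn_bvp {φ : Path01} {x y : ℝ → ℝ} {x₀ : ℝ}
    (hx : ∀ u ∈ Icc (0 : ℝ) 1, HasDerivWithinAt x (y u) (Icc 0 1) u)
    (hy : ∀ u ∈ Icc (0 : ℝ) 1, HasDerivWithinAt y (φ.ext u) (Icc 0 1) u)
    (h0 : x 0 = x₀) (h1 : x 1 = 0) (u : unitInterval) :
    x u = x₀ * (1 - u) + bvpPosition φ u ∧ y u = -x₀ + bvpVelocity φ u := by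
  have m0 : (0 : ℝ) ∈ Icc (0 : ℝ) 1 := ⟨le_rfl, zero_le_one⟩
  have m1 : (1 : ℝ) ∈ Icc (0 : ℝ) 1 := ⟨zero_le_one, le_rfl⟩
  -- The differential equation fixes `y` up to the constant `c`. The condition `x 1 = 0` then forces
  -- `c = -x₀`.
  set c : ℝ := y 0 - (bvpVelocity φ).ext 0 with hc
  have hyv : EqOn y (fun u => (bvpVelocity φ).ext u + c) (Icc 0 1) :=
    eqOn_Icc_of_hasDerivWithinAt hy (fun u hu => (hasDerivWithinAt_bvpVelocity φ hu).add_const c)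
      (by simp [hc])
  have hxp : EqOn x (fun u => (bvpPosition φ).ext u + (x₀ + c * u)) (Icc 0 1) := by
    refine eqOn_Icc_of_hasDerivWithinAt hx (fun u hu => ?_) ?_
    · have h2 : HasDerivWithinAt (fun u => (bvpPosition φ).ext u + (x₀ + c * u))
          ((bvpVelocity φ).ext u + c * 1) (Icc 0 1) u := (hasDerivWithinAt_bvpPosition φ hu).add
        (((hasDerivWithinAt_id u (Icc 0 1)).const_mul c).const_add x₀)
      rw [mul_one] at h2
      rwa [hyv hu]
    · have := bvpPosition_zero φ
      rw [Path01.ext_of_mem _ m0, h0]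
      change x₀ = bvpPosition φ 0 + _
      rw [this]; ring
  have hc' : c = -x₀ := by
    have h3 := hxp m1
    have := bvpPosition_one φ
    simp only at h3
    rw [h1, Path01.ext_of_mem _ m1] at h3
    change 0 = bvpPosition φ 1 + _ at h3
    rw [this] at h3
    linarith
  constructor
  · rw [hxp u.2]; simp only [Path01.ext_coe, hc']; ring
  · rw [hyv u.2]; simp only [Path01.ext_coe, hc']; ring

end Paths

/-! ### Flights parametrised by starting time and duration -/

section Family

/-- Time, position and velocity along the flight with data `q = (e, s, t)`. -/
noncomputable def flightPath (q : ℝ × ℝ × ℝ) (φ : Path01) : C(unitInterval, ℝ × ℝ × ℝ × ℝ) :=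
  ⟨fun u => (q.1, q.2.1 + q.2.2 * u, q.2.2 ^ 2 * bvpPosition φ u, q.2.2 * bvpVelocity φ u),
    by fun_prop⟩

/-- In normalized time the path is polynomial in `q` and depends on `φ` only through continuous
linear maps. Durations that are zero or negative are as good as positive ones. -/
theorem contDiff_flightPath :
    ContDiff ℝ 1 (fun z : (ℝ × ℝ × ℝ) × Path01 => flightPath z.1 z.2) := by
  let ι : (ℝ →L[ℝ] ℝ × ℝ × ℝ × ℝ) → (Path01 →L[ℝ] C(unitInterval, ℝ × ℝ × ℝ × ℝ)) := fun c =>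
    c.compLeftContinuous ℝ unitInterval
  let c1 : ℝ →L[ℝ] ℝ × ℝ × ℝ × ℝ := .inl ℝ ℝ _
  let c2 : ℝ →L[ℝ] ℝ × ℝ × ℝ × ℝ := .inr ℝ ℝ _ ∘L .inl ℝ ℝ _
  let c3 : ℝ →L[ℝ] ℝ × ℝ × ℝ × ℝ := .inr ℝ ℝ _ ∘L .inr ℝ ℝ _ ∘L .inl ℝ ℝ ℝ
  let c4 : ℝ →L[ℝ] ℝ × ℝ × ℝ × ℝ := .inr ℝ ℝ _ ∘L .inr ℝ ℝ _ ∘L .inr ℝ ℝ ℝ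
  let idp : Path01 := ⟨fun u => u, continuous_subtype_val⟩
  have h : (fun z : (ℝ × ℝ × ℝ) × Path01 => flightPath z.1 z.2) = fun z =>
      ι c1 (z.1.1 • (1 : Path01)) + ι c2 (z.1.2.1 • (1 : Path01) + z.1.2.2 • idp) +
      ι c3 (z.1.2.2 ^ 2 • bvpPosition z.2) + ι c4 (z.1.2.2 • bvpVelocity z.2) := by
    funext z
    ext u <;> simp [flightPath, ι, c1, c2, c3, c4, idp]
  rw [h]
  fun_prop

variable {Φ : ℝ × ℝ × ℝ × ℝ → ℝ}

/-- The map whose fixed points are the accelerations of flights. -/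
noncomputable def flightMap (Φ : ℝ × ℝ × ℝ × ℝ → ℝ) (hΦ : Continuous Φ)
    (z : (ℝ × ℝ × ℝ) × Path01) : Path01 :=
  ContinuousMap.comp ⟨Φ, hΦ⟩ (flightPath z.1 z.2)

theorem contDiff_flightMap (hΦ : ContDiff ℝ 1 Φ) : ContDiff ℝ 1 (flightMap Φ hΦ.continuous) :=
  (contDiff_one_postcomp hΦ).comp contDiff_flightPath

/-- The parameter box `|e| < e₀`, `|s| < M`, `|t| < M`. -/
def box (e₀ M : ℝ) : Set (ℝ × ℝ × ℝ) := Ioo (-e₀) e₀ ×ˢ Ioo (-M) M ×ˢ Ioo (-M) M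

theorem isOpen_box (e₀ M : ℝ) : IsOpen (box e₀ M) :=
  isOpen_Ioo.prod (isOpen_Ioo.prod isOpen_Ioo)

/-- For small `e` the field `Φ (e, ·)` is uniformly close to `Φ (0, ·)` and almost independent of
position and velocity. -/
theorem exists_small_parameter (hΦ : ContDiff ℝ 1 Φ) (h0 : ∀ s X Y, Φ (0, s, X, Y) = 1 - s ^ 2)
    (L A : ℝ) {ℓ : ℝ} (hℓ : 0 < ℓ) : ∃ e₀ > 0, ∀ e, |e| < e₀ → ∀ s, |s| ≤ L →
      ∀ p ∈ Metric.closedBall (0 : ℝ × ℝ) A, |Φ (e, s, p) - (1 - s ^ 2)| < ℓ ∧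
      ∀ p' ∈ Metric.closedBall (0 : ℝ × ℝ) A, |Φ (e, s, p) - Φ (e, s, p')| ≤ ℓ * ‖p - p'‖ := by
  let D : ℝ × ℝ × ℝ × ℝ → (ℝ × ℝ →L[ℝ] ℝ) := fun z =>
    fderiv ℝ Φ z ∘L .inr ℝ ℝ _ ∘L .inr ℝ ℝ _
  have hDc : Continuous D := by
    have := hΦ.continuous_fderiv one_ne_zero
    fun_prop
  have hD : ∀ z : ℝ × ℝ × ℝ × ℝ, HasFDerivAt (fun p => Φ (z.1, z.2.1, p)) (D z) z.2.2 := by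
    intro z
    have h1 : HasFDerivAt Φ (fderiv ℝ Φ z) (z.1, z.2.1, z.2.2) :=
      (hΦ.differentiable one_ne_zero z).hasFDerivAt
    exact (h1.comp z.2.2 ((hasFDerivAt_prodMk_right z.1 (z.2.1, z.2.2)).comp z.2.2
      (hasFDerivAt_prodMk_right z.2.1 z.2.2)))
  -- At `e = 0` the field ignores position and velocity, so this derivative vanishes. Compactness
  -- then makes it small for all small `e`.
  have hD0 : ∀ k : ℝ × ℝ × ℝ, D (0, k) = 0 := by
    intro k
    have h1 := hD (0, k)
    have h2 : (fun p : ℝ × ℝ => Φ ((0 : ℝ), k.1, p)) = fun _ => 1 - k.1 ^ 2 := by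
      funext p; exact h0 _ _ _
    rw [show (fun p => Φ (((0 : ℝ), k).1, ((0 : ℝ), k).2.1, p)) = fun _ => 1 - k.1 ^ 2 from h2]
      at h1
    exact h1.unique (hasFDerivAt_const _ _)
  have hK : IsCompact (Icc (-L) L ×ˢ Metric.closedBall (0 : ℝ × ℝ) A) :=
    isCompact_Icc.prod (isCompact_closedBall _ _)
  have key := hK.eventually_forall_of_forall_eventually (x₀ := (0 : ℝ))
    (P := fun e k => |Φ (e, k) - (1 - k.1 ^ 2)| < ℓ ∧ ‖D (e, k)‖ < ℓ) (by
      intro k _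
      refine Filter.Eventually.and ?_ ?_
      · have hc : Continuous fun z : ℝ × ℝ × ℝ × ℝ => |Φ z - (1 - z.2.1 ^ 2)| := by
          have := hΦ.continuous; fun_prop
        refine hc.continuousAt.eventually_lt continuousAt_const ?_
        have := h0 k.1 k.2.1 k.2.2
        simpa [this] using hℓ
      · refine hDc.norm.continuousAt.eventually_lt continuousAt_const ?_
        simpa [hD0] using hℓ)
  obtain ⟨e₀, he₀, hball⟩ := Metric.eventually_nhds_iff.1 key
  refine ⟨e₀, he₀, fun e he s hs p hp => ?_⟩
  have he' : dist e 0 < e₀ := by simpa using he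
  have hmem : ∀ p ∈ Metric.closedBall (0 : ℝ × ℝ) A,
      (s, p) ∈ Icc (-L) L ×ˢ Metric.closedBall (0 : ℝ × ℝ) A := fun p hp => ⟨abs_le.1 hs, hp⟩
  refine ⟨(hball he' _ (hmem p hp)).1, fun p' hp' => ?_⟩
  have := (convex_closedBall (0 : ℝ × ℝ) A).norm_image_sub_le_of_norm_hasFDerivWithin_le
    (f := fun p => Φ (e, s, p)) (f' := fun p => D (e, s, p)) (C := ℓ)
    (fun x _ => (hD (e, s, x)).hasFDerivWithinAt) (fun x hx => (hball he' _ (hmem x hx)).2.le)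
    hp' hp
  simpa using this

end Family

/-- A bound for accelerations of flights with parameters in `box e₀ M`. -/
noncomputable def accBound (M : ℝ) : ℝ := 3 + 4 * M ^ 2

/-- A bound for positions and velocities of flights with parameters in `box e₀ M`. -/
noncomputable def stateBound (M : ℝ) : ℝ := 2 * M ^ 2 * accBound M + 2 * M * accBound M + 1

/-- A Lipschitz constant making the flight map a contraction. -/
noncomputable def contractionConst (M : ℝ) : ℝ := 1 / (2 * (2 * M ^ 2 + 2 * M + 1))

/-- `φ q` is the acceleration, in normalized time, of the flight of `x'' = Φ (e, time, x, x')` which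
starts from `x = 0` at time `s` and comes back to `x = 0` at time `s + t`, where `q = (e, s, t)`. -/
structure IsFlightFamily (Φ : ℝ × ℝ × ℝ × ℝ → ℝ) (M e₀ : ℝ) (φ : ℝ × ℝ × ℝ → Path01) : Prop where
  contDiff_field : ContDiff ℝ 1 Φ
  one_le : 1 ≤ M
  field_zero : ∀ s X Y, Φ (0, s, X, Y) = 1 - s ^ 2
  e₀_pos : 0 < e₀
  contDiffOn : ContDiffOn ℝ 1 φ (box e₀ M)
  fixed : ∀ q ∈ box e₀ M, ∀ u, φ q u = Φ (flightPath q (φ q) u)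
  norm_le : ∀ q ∈ box e₀ M, ‖φ q‖ ≤ accBound M
  unique : ∀ q ∈ box e₀ M, ∀ ψ : Path01, ‖ψ‖ ≤ accBound M →
    (∀ u, ψ u = Φ (flightPath q ψ u)) → ψ = φ q
  lip : ∀ e, |e| < e₀ → ∀ s, |s| ≤ 2 * M →
    ∀ p ∈ Metric.closedBall (0 : ℝ × ℝ) (stateBound M),
    ∀ p' ∈ Metric.closedBall (0 : ℝ × ℝ) (stateBound M),
      |Φ (e, s, p) - Φ (e, s, p')| ≤ contractionConst M * ‖p - p'‖

theorem flightPath_apply (q : ℝ × ℝ × ℝ) (φ : Path01) (u : unitInterval) :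
    flightPath q φ u =
      (q.1, q.2.1 + q.2.2 * u, q.2.2 ^ 2 * bvpPosition φ u, q.2.2 * bvpVelocity φ u) := rfl

theorem mem_box {e₀ M : ℝ} {q : ℝ × ℝ × ℝ} :
    q ∈ box e₀ M ↔ |q.1| < e₀ ∧ |q.2.1| < M ∧ |q.2.2| < M := by
  simp [box, mem_prod, abs_lt]

theorem abs_time_le {M s t : ℝ} (hs : |s| < M) (ht : |t| < M) {u : ℝ} (hu : u ∈ Icc (0 : ℝ) 1) :
    |s + t * u| ≤ 2 * M := by
  have h1 : |t * u| ≤ |t| := by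
    rw [abs_mul, abs_of_nonneg hu.1]; exact mul_le_of_le_one_right (abs_nonneg _) hu.2
  have := abs_add_le s (t * u)
  linarith

theorem norm_scaled_state_le {M t : ℝ} (ht : |t| < M) (φ : Path01) (u : unitInterval) :
    ‖((t ^ 2 * bvpPosition φ u, t * bvpVelocity φ u) : ℝ × ℝ)‖ ≤ (2 * M ^ 2 + 2 * M) * ‖φ‖ := by
  have hM : 0 < M := (abs_nonneg t).trans_lt ht
  have h1 : ‖bvpPosition φ u‖ ≤ 2 * ‖φ‖ :=
    (ContinuousMap.norm_coe_le_norm _ u).trans (norm_bvpPosition_le φ)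
  have h2 : ‖bvpVelocity φ u‖ ≤ 2 * ‖φ‖ :=
    (ContinuousMap.norm_coe_le_norm _ u).trans (norm_bvpVelocity_le φ)
  have hφ := norm_nonneg φ
  rw [Prod.norm_def, max_le_iff]
  constructor
  · rw [norm_mul, norm_pow, Real.norm_eq_abs t]
    calc |t| ^ 2 * ‖bvpPosition φ u‖ ≤ M ^ 2 * (2 * ‖φ‖) := by gcongr
      _ ≤ _ := by nlinarith
  · rw [norm_mul, Real.norm_eq_abs t]
    calc |t| * ‖bvpVelocity φ u‖ ≤ M * (2 * ‖φ‖) := by gcongr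
      _ ≤ _ := by nlinarith [mul_nonneg (sq_nonneg M) hφ]

/-- The factor `2 * M ^ 2 + 2 * M` is the norm bound for the map from accelerations to rescaled
states (`norm_scaled_state_le`), so the flight map has Lipschitz constant at most `1/2`. -/
theorem contractionConst_mul {M : ℝ} (hM : 1 ≤ M) :
    contractionConst M * (2 * M ^ 2 + 2 * M) ≤ 1 / 2 := by
  unfold contractionConst
  rw [div_mul_eq_mul_div, one_mul, div_le_div_iff₀ (by positivity) (by norm_num)]
  nlinarith

/-- At `e = 0` the flight map does not depend on the unknown acceleration at all. For small `e` it
is therefore a contraction of a fixed ball, uniformly over the whole box of starts and durations,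
and its fixed point is `C¹` in the parameters. -/
theorem exists_flightFamily {Φ : ℝ × ℝ × ℝ × ℝ → ℝ} (hΦ : ContDiff ℝ 1 Φ)
    (h0 : ∀ s X Y, Φ (0, s, X, Y) = 1 - s ^ 2) {M : ℝ} (hM : 1 ≤ M) :
    ∃ e₀ > 0, ∃ φ, IsFlightFamily Φ M e₀ φ := by
  have hℓ : 0 < contractionConst M := by unfold contractionConst; positivity
  obtain ⟨e₀, he₀, hsmall⟩ := exists_small_parameter hΦ h0 (2 * M) (stateBound M) hℓ
  have hℓ1 : contractionConst M ≤ 1 := by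
    unfold contractionConst; rw [div_le_one (by positivity)]; nlinarith
  have hR : 0 ≤ accBound M := by unfold accBound; positivity
  have hstate : ∀ (q : ℝ × ℝ × ℝ), q ∈ box e₀ M → ∀ ψ : Path01, ‖ψ‖ ≤ accBound M → ∀ u,
      ((q.2.2 ^ 2 * bvpPosition ψ u, q.2.2 * bvpVelocity ψ u) : ℝ × ℝ) ∈
        Metric.closedBall (0 : ℝ × ℝ) (stateBound M) := by
    intro q hq ψ hψ u
    rw [mem_closedBall_zero_iff]
    refine (norm_scaled_state_le (mem_box.1 hq).2.2 ψ u).trans ?_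
    unfold stateBound
    have : (2 * M ^ 2 + 2 * M) * ‖ψ‖ ≤ (2 * M ^ 2 + 2 * M) * accBound M := by gcongr
    linarith
  have hlip : ∀ q ∈ box e₀ M, ∀ x ∈ Metric.closedBall (0 : Path01) (accBound M),
      ∀ y ∈ Metric.closedBall (0 : Path01) (accBound M),
      ‖flightMap Φ hΦ.continuous (q, x) - flightMap Φ hΦ.continuous (q, y)‖ ≤ 1 / 2 * ‖x - y‖ := by
    intro q hq x hx y hy
    rw [mem_closedBall_zero_iff] at hx hy
    obtain ⟨h1, h2, h3⟩ := mem_box.1 hq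
    rw [ContinuousMap.norm_le _ (by positivity)]
    intro u
    have key := (hsmall q.1 h1 (q.2.1 + q.2.2 * u) (abs_time_le h2 h3 u.2) _
      (hstate q hq x hx u)).2 _ (hstate q hq y hy u)
    refine (key.trans ?_)
    have hsub : ((q.2.2 ^ 2 * bvpPosition x u, q.2.2 * bvpVelocity x u) : ℝ × ℝ) -
        (q.2.2 ^ 2 * bvpPosition y u, q.2.2 * bvpVelocity y u) =
        (q.2.2 ^ 2 * bvpPosition (x - y) u, q.2.2 * bvpVelocity (x - y) u) := by
      simp only [map_sub, ContinuousMap.sub_apply, Prod.mk_sub_mk, mul_sub]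
    rw [hsub]
    calc _ ≤ contractionConst M * ((2 * M ^ 2 + 2 * M) * ‖x - y‖) := by
          gcongr; exact norm_scaled_state_le h3 _ u
      _ = contractionConst M * (2 * M ^ 2 + 2 * M) * ‖x - y‖ := by ring
      _ ≤ _ := by gcongr; exact contractionConst_mul hM
  have hmaps : ∀ q ∈ box e₀ M, ∀ x ∈ Metric.closedBall (0 : Path01) (accBound M),
      flightMap Φ hΦ.continuous (q, x) ∈ Metric.ball (0 : Path01) (accBound M) := by
    intro q hq x hx
    rw [mem_closedBall_zero_iff] at hx
    obtain ⟨h1, h2, h3⟩ := mem_box.1 hq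
    rw [mem_ball_zero_iff]
    -- Times along a flight are at most `2 * M`, so `|1 - time²|` is at most `1 + 4 * M ^ 2`. The
    -- perturbation costs at most one more, and the last unit in `accBound` keeps the image in the
    -- open ball.
    have hb : 2 + 4 * M ^ 2 < accBound M := by unfold accBound; linarith
    refine lt_of_le_of_lt ?_ hb
    rw [ContinuousMap.norm_le _ (by positivity)]
    intro u
    have ht := abs_time_le h2 h3 u.2
    have key := (hsmall q.1 h1 (q.2.1 + q.2.2 * u) ht _ (hstate q hq x hx u)).1
    have h4 := sq_le_sq' (abs_le.1 ht).1 (abs_le.1 ht).2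
    have h5 := abs_lt.1 key
    change |Φ (q.1, q.2.1 + q.2.2 * u, _)| ≤ _
    rw [abs_le]
    constructor <;> nlinarith [sq_nonneg (q.2.1 + q.2.2 * (u : ℝ))]
  obtain ⟨φ, hφ, hφd⟩ := exists_contDiffOn_fixedPoint (contDiff_flightMap hΦ) (isOpen_box e₀ M)
    hlip hR hmaps
  refine ⟨e₀, he₀, φ, hΦ, hM, h0, he₀, hφd, fun q hq u => ?_, fun q hq => ?_, ?_, ?_⟩
  · exact (congrArg (fun ψ : Path01 => ψ u) (hφ q hq).2).symm
  · exact (mem_ball_zero_iff.1 (hφ q hq).1).le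
  · intro q hq ψ hψ hfix
    have e1 : flightMap Φ hΦ.continuous (q, ψ) = ψ := by ext u; exact (hfix u).symm
    have h6 := hlip q hq ψ (mem_closedBall_zero_iff.2 hψ) (φ q)
      (Metric.ball_subset_closedBall (hφ q hq).1)
    rw [e1, (hφ q hq).2] at h6
    have h7 : ‖ψ - φ q‖ = 0 := le_antisymm (by linarith [norm_nonneg (ψ - φ q)]) (norm_nonneg _)
    exact sub_eq_zero.1 (norm_eq_zero.1 h7)
  · intro e he s hs p hp p' hp'
    exact (hsmall e he s hs p hp).2 p' hp'

/-! ### Launch and landing speeds, explicit at `e = 0` -/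

namespace IsFlightFamily

variable {Φ : ℝ × ℝ × ℝ × ℝ → ℝ} {M e₀ : ℝ} {φ : ℝ × ℝ × ℝ → Path01}

/-- Launch speed of the flight, divided by its duration. -/
noncomputable def launch (φ : ℝ × ℝ × ℝ → Path01) (q : ℝ × ℝ × ℝ) : ℝ := bvpVelocity (φ q) 0

/-- Landing speed of the flight, divided by its duration. -/
noncomputable def landing (φ : ℝ × ℝ × ℝ → Path01) (q : ℝ × ℝ × ℝ) : ℝ := -bvpVelocity (φ q) 1

theorem contDiffOn_launch (h : IsFlightFamily Φ M e₀ φ) :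
    ContDiffOn ℝ 1 (launch φ) (box e₀ M) :=
  ((ContinuousMap.evalCLM ℝ (0 : unitInterval) ∘L bvpVelocity).contDiff.comp_contDiffOn
    h.contDiffOn)

theorem contDiffOn_landing (h : IsFlightFamily Φ M e₀ φ) :
    ContDiffOn ℝ 1 (landing φ) (box e₀ M) :=
  ((ContinuousMap.evalCLM ℝ (1 : unitInterval) ∘L bvpVelocity).contDiff.comp_contDiffOn
    h.contDiffOn).neg

/-- The right side is the derivative of an explicit quartic vanishing at both ends, and `eqOn_bvp`
says that the solution is unique. -/
theorem bvpVelocity_of_quadratic {ψ : Path01} {s t : ℝ} (hψ : ∀ u, ψ u = 1 - (s + t * u) ^ 2)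
    (u : unitInterval) : bvpVelocity ψ u =
      u - s ^ 2 * u - s * t * u ^ 2 - t ^ 2 * u ^ 3 / 3
        + ((s ^ 2 - 1) / 2 + s * t / 3 + t ^ 2 / 12) := by
  have hd : ∀ v ∈ Icc (0 : ℝ) 1, ψ.ext v = 1 - (s + t * v) ^ 2 := fun v hv => by
    rw [Path01.ext_of_mem _ hv, hψ]
  have key := eqOn_bvp (φ := ψ) (x₀ := 0)
    (x := fun u => (1 - s ^ 2) / 2 * u ^ 2 - s * t / 3 * u ^ 3 - t ^ 2 / 12 * u ^ 4
        + ((s ^ 2 - 1) / 2 + s * t / 3 + t ^ 2 / 12) * u)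
    (y := fun u => u - s ^ 2 * u - s * t * u ^ 2 - t ^ 2 * u ^ 3 / 3
        + ((s ^ 2 - 1) / 2 + s * t / 3 + t ^ 2 / 12))
    (fun u _ => by
      have := ((((hasDerivAt_pow 2 u).const_mul ((1 - s ^ 2) / 2)).sub
        ((hasDerivAt_pow 3 u).const_mul (s * t / 3))).sub
        ((hasDerivAt_pow 4 u).const_mul (t ^ 2 / 12))).add
        ((hasDerivAt_id u).const_mul ((s ^ 2 - 1) / 2 + s * t / 3 + t ^ 2 / 12))
      refine (this.congr_deriv ?_).hasDerivWithinAt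
      norm_num; ring)
    (fun u hu => by
      rw [hd u hu]
      have := (((hasDerivAt_id u).sub ((hasDerivAt_id u).const_mul (s ^ 2))).sub
        ((hasDerivAt_pow 2 u).const_mul (s * t))).sub
        (((hasDerivAt_pow 3 u).const_mul (t ^ 2)).div_const 3) |>.add_const
        ((s ^ 2 - 1) / 2 + s * t / 3 + t ^ 2 / 12)
      refine (this.congr_deriv ?_).hasDerivWithinAt
      norm_num; ring)
    (by ring) (by ring) u
  have := key.2
  linarith

theorem launch_zero (h : IsFlightFamily Φ M e₀ φ) {s t : ℝ} (hs : |s| < M) (ht : |t| < M) :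
    launch φ (0, s, t) = (s ^ 2 - 1) / 2 + s * t / 3 + t ^ 2 / 12 := by
  have hq : ((0 : ℝ), s, t) ∈ box e₀ M := mem_box.2 ⟨by simpa using h.e₀_pos, hs, ht⟩
  have := bvpVelocity_of_quadratic (ψ := φ (0, s, t)) (s := s) (t := t)
    (fun u => by rw [h.fixed _ hq, flightPath_apply, h.field_zero]) 0
  simpa [launch] using this

theorem landing_zero (h : IsFlightFamily Φ M e₀ φ) {s t : ℝ} (hs : |s| < M) (ht : |t| < M) :
    landing φ (0, s, t) = (s ^ 2 - 1) / 2 + 2 * s * t / 3 + t ^ 2 / 4 := by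
  have hq : ((0 : ℝ), s, t) ∈ box e₀ M := mem_box.2 ⟨by simpa using h.e₀_pos, hs, ht⟩
  have := bvpVelocity_of_quadratic (ψ := φ (0, s, t)) (s := s) (t := t)
    (fun u => by rw [h.fixed _ hq, flightPath_apply, h.field_zero]) 1
  simp only [Icc.coe_one] at this
  rw [landing, this]; ring

/-- As `t` tends to `0` the normalized flight tends to a parabola with constant acceleration. Zeros
of `launch` at duration zero are thus exactly the zeros of the initial acceleration. -/
theorem launch_time_zero (h : IsFlightFamily Φ M e₀ φ) {e s : ℝ} (he : |e| < e₀) (hs : |s| < M) :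
    launch φ (e, s, 0) = -Φ (e, s, 0, 0) / 2 := by
  have hM := h.one_le
  have hq : (e, s, (0 : ℝ)) ∈ box e₀ M := mem_box.2 ⟨he, hs, by simpa using by linarith⟩
  set c := Φ (e, s, 0, 0)
  have hc : ∀ u, φ (e, s, 0) u = c := fun u => by
    rw [h.fixed _ hq, flightPath_apply]; simp [c]
  have key := eqOn_bvp (φ := φ (e, s, 0)) (x₀ := 0)
    (x := fun u => c / 2 * u ^ 2 - c / 2 * u) (y := fun u => c * u - c / 2)
    (fun u _ => by
      have := ((hasDerivAt_pow 2 u).const_mul (c / 2)).sub ((hasDerivAt_id u).const_mul (c / 2))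
      refine (this.congr_deriv ?_).hasDerivWithinAt
      norm_num; ring)
    (fun u hu => by
      rw [Path01.ext_of_mem _ hu, hc]
      have := ((hasDerivAt_id u).const_mul c).sub_const (c / 2)
      refine (this.congr_deriv ?_).hasDerivWithinAt
      ring)
    (by ring) (by ring) 0
  have := key.2
  simp only [Icc.coe_zero] at this
  rw [launch]; linarith

end IsFlightFamily

theorem Path01.ext_one_zero (φ : Path01) : φ.ext 0 = φ 0 ∧ φ.ext 1 = φ 1 :=
  ⟨Path01.ext_of_mem _ ⟨le_rfl, zero_le_one⟩, Path01.ext_of_mem _ ⟨zero_le_one, le_rfl⟩⟩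

/-! ### Flights as solutions in unscaled time, and their stability -/

namespace IsFlightFamily

variable {Φ : ℝ × ℝ × ℝ × ℝ → ℝ} {M e₀ : ℝ} {φ : ℝ × ℝ × ℝ → Path01}

/-- Position along the flight with data `(e, s, t)` after elapsed time `ς`. -/
noncomputable def position (φ : ℝ × ℝ × ℝ → Path01) (q : ℝ × ℝ × ℝ) (ς : ℝ) : ℝ :=
  q.2.2 ^ 2 * (bvpPosition (φ q)).ext (ς / q.2.2)

/-- Velocity along the flight with data `(e, s, t)` after elapsed time `ς`. -/
noncomputable def velocity (φ : ℝ × ℝ × ℝ → Path01) (q : ℝ × ℝ × ℝ) (ς : ℝ) : ℝ :=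
  q.2.2 * (bvpVelocity (φ q)).ext (ς / q.2.2)

theorem div_mem_Icc {t ς : ℝ} (ht : 0 < t) (hς : ς ∈ Icc 0 t) : ς / t ∈ Icc (0 : ℝ) 1 :=
  ⟨div_nonneg hς.1 ht.le, (div_le_one ht).2 hς.2⟩

theorem hasDerivWithinAt_comp_div {x : ℝ → ℝ} {x' t ς : ℝ} (ht : 0 < t)
    (hx : HasDerivWithinAt x x' (Icc 0 1) (ς / t)) :
    HasDerivWithinAt (fun ς => x (ς / t)) (x' / t) (Icc 0 t) ς := by
  have h1 : HasDerivWithinAt (fun ς : ℝ => ς / t) (1 / t) (Icc 0 t) ς :=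
    (hasDerivWithinAt_id ς _).div_const t
  have := hx.comp ς h1 (fun y hy => div_mem_Icc ht hy)
  rwa [mul_one_div] at this

section Flight

variable {e s t : ℝ}

theorem hasDerivWithinAt_position (φ : ℝ × ℝ × ℝ → Path01) (ht : 0 < t) {ς : ℝ}
    (hς : ς ∈ Icc 0 t) :
    HasDerivWithinAt (position φ (e, s, t)) (velocity φ (e, s, t) ς) (Icc 0 t) ς := by
  have := (hasDerivWithinAt_comp_div ht
    (hasDerivWithinAt_bvpPosition (φ (e, s, t)) (div_mem_Icc ht hς))).const_mul (t ^ 2)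
  refine this.congr_deriv ?_
  simp only [velocity]; field_simp

theorem hasDerivWithinAt_velocity (h : IsFlightFamily Φ M e₀ φ) (hq : (e, s, t) ∈ box e₀ M)
    (ht : 0 < t) {ς : ℝ} (hς : ς ∈ Icc 0 t) :
    HasDerivWithinAt (velocity φ (e, s, t))
      (Φ (e, s + ς, position φ (e, s, t) ς, velocity φ (e, s, t) ς)) (Icc 0 t) ς := by
  have hu := div_mem_Icc ht hς
  have := (hasDerivWithinAt_comp_div ht
    (hasDerivWithinAt_bvpVelocity (φ (e, s, t)) hu)).const_mul t
  refine this.congr_deriv ?_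
  rw [Path01.ext_of_mem _ hu, h.fixed _ hq, flightPath_apply, mul_div_cancel₀ _ ht.ne']
  simp only [position, velocity]
  rw [Path01.ext_of_mem _ hu, Path01.ext_of_mem _ hu, mul_div_cancel₀ _ ht.ne']

theorem position_zero : position φ (e, s, t) 0 = 0 := by
  simp [position, (Path01.ext_one_zero _).1, bvpPosition_zero]

theorem position_end (ht : 0 < t) : position φ (e, s, t) t = 0 := by
  simp [position, (Path01.ext_one_zero _).2, bvpPosition_one, ht.ne']

theorem velocity_zero : velocity φ (e, s, t) 0 = t * launch φ (e, s, t) := by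
  simp [velocity, launch, (Path01.ext_one_zero _).1]

theorem velocity_end (ht : 0 < t) : velocity φ (e, s, t) t = -(t * landing φ (e, s, t)) := by
  simp [velocity, landing, (Path01.ext_one_zero _).2, ht.ne']

theorem abs_field_le (h : IsFlightFamily Φ M e₀ φ) (hq : (e, s, t) ∈ box e₀ M)
    (ht : 0 < t) {ς : ℝ} (hς : ς ∈ Icc 0 t) :
    |Φ (e, s + ς, position φ (e, s, t) ς, velocity φ (e, s, t) ς)| ≤ accBound M := by
  have hu := div_mem_Icc ht hς
  have h1 := h.fixed _ hq ⟨ς / t, hu⟩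
  rw [flightPath_apply] at h1
  simp only [mul_div_cancel₀ _ ht.ne'] at h1
  simp only [position, velocity]
  rw [Path01.ext_of_mem _ hu, Path01.ext_of_mem _ hu, ← h1]
  exact (ContinuousMap.norm_coe_le_norm _ _).trans (h.norm_le _ hq)

theorem norm_state_le (h : IsFlightFamily Φ M e₀ φ) (hq : (e, s, t) ∈ box e₀ M)
    (ht : 0 < t) {ς : ℝ} (hς : ς ∈ Icc 0 t) :
    ‖((position φ (e, s, t) ς, velocity φ (e, s, t) ς) : ℝ × ℝ)‖ ≤ stateBound M - 1 := by
  have hu := div_mem_Icc ht hς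
  have := norm_scaled_state_le (mem_box.1 hq).2.2 (φ (e, s, t)) ⟨ς / t, hu⟩
  simp only [position, velocity]
  rw [Path01.ext_of_mem _ hu, Path01.ext_of_mem _ hu]
  refine this.trans ?_
  have hM := h.one_le
  have : (2 * M ^ 2 + 2 * M) * ‖φ (e, s, t)‖ ≤ (2 * M ^ 2 + 2 * M) * accBound M := by
    gcongr; exact h.norm_le _ hq
  unfold stateBound
  linarith

/-- Solutions with bounded acceleration which come back to `0` are close to the flight with the same
data if they start close to `0`. -/
theorem bvp_stability (h : IsFlightFamily Φ M e₀ φ) (hq : (e, s, t) ∈ box e₀ M) (ht : 0 < t)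
    {x y : ℝ → ℝ} (hx : ∀ ς ∈ Icc 0 t, HasDerivWithinAt x (y ς) (Icc 0 t) ς)
    (hy : ∀ ς ∈ Icc 0 t, HasDerivWithinAt y (Φ (e, s + ς, x ς, y ς)) (Icc 0 t) ς)
    (hx1 : x t = 0) (hbd : ∀ ς ∈ Icc 0 t, |Φ (e, s + ς, x ς, y ς)| ≤ accBound M)
    (h0 : |x 0| ≤ 1) (h0' : |x 0| ≤ t) :
    |y 0 - t * launch φ (e, s, t)| ≤ (1 / t + 2 * M * (1 + 1 / t)) * |x 0| ∧
    |y t + t * landing φ (e, s, t)| ≤ (1 / t + 2 * M * (1 + 1 / t)) * |x 0| := by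
  have hM := h.one_le
  obtain ⟨he, hs, htM⟩ := mem_box.1 hq
  simp only at he hs htM
  have hmul : ∀ u : unitInterval, t * (u : ℝ) ∈ Icc 0 t := fun u =>
    ⟨mul_nonneg ht.le u.2.1, mul_le_of_le_one_right ht.le u.2.2⟩
  have hxc : Continuous fun u : unitInterval => x (t * u) :=
    ContinuousOn.comp_continuous (fun ς hς => (hx ς hς).continuousWithinAt)
      (by fun_prop) hmul
  have hyc : Continuous fun u : unitInterval => y (t * u) :=
    ContinuousOn.comp_continuous (fun ς hς => (hy ς hς).continuousWithinAt)
      (by fun_prop) hmul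
  let ψ : Path01 := ⟨fun u => Φ (e, s + t * u, x (t * u), y (t * u)), by
    exact h.contDiff_field.continuous.comp (continuous_const.prodMk
      ((by fun_prop : Continuous fun u : unitInterval => s + t * (u : ℝ)).prodMk
        (hxc.prodMk hyc)))⟩
  have hscale : ∀ {z : ℝ → ℝ} {z' : ℝ} {u : ℝ}, u ∈ Icc (0 : ℝ) 1 →
      HasDerivWithinAt z z' (Icc 0 t) (t * u) →
      HasDerivWithinAt (fun u => z (t * u)) (z' * t) (Icc 0 1) u := by
    intro z z' u hu hz
    have h1 : HasDerivWithinAt (fun u : ℝ => t * u) (t * 1) (Icc 0 1) u :=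
      (hasDerivWithinAt_id u _).const_mul t
    rw [mul_one] at h1
    exact hz.comp u h1 (fun v hv => hmul ⟨v, hv⟩)
  have key := eqOn_bvp (φ := ψ) (x := fun u => x (t * u) / t ^ 2) (y := fun u => y (t * u) / t)
    (x₀ := x 0 / t ^ 2)
    (fun u hu => ((hscale hu (hx _ (hmul ⟨u, hu⟩))).div_const (t ^ 2)).congr_deriv (by
      field_simp))
    (fun u hu => ((hscale hu (hy _ (hmul ⟨u, hu⟩))).div_const t).congr_deriv (by
      rw [Path01.ext_of_mem _ hu, mul_div_assoc, div_self ht.ne', mul_one]; rfl))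
    (by simp) (by simp [hx1])
  have hX : ∀ u : unitInterval, x (t * u) = x 0 * (1 - u) + t ^ 2 * bvpPosition ψ u := by
    intro u
    have := (key u).1
    rw [div_eq_iff (by positivity)] at this
    rw [this]; field_simp
  have hY : ∀ u : unitInterval, y (t * u) = -(x 0 / t) + t * bvpVelocity ψ u := by
    intro u
    have := (key u).2
    rw [div_eq_iff ht.ne'] at this
    rw [this]; field_simp
  have hψ : ‖ψ‖ ≤ accBound M := by
    rw [ContinuousMap.norm_le _ (by unfold accBound; positivity)]
    intro u; exact hbd _ (hmul u)
  have hR : 0 ≤ accBound M := by unfold accBound; positivity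
  set η := ‖ψ - φ (e, s, t)‖ with hη
  have hx0t : |x 0 / t| ≤ 1 := by
    rw [abs_div, abs_of_pos ht, div_le_one ht]; exact h0'
  have hoff : ∀ u : unitInterval,
      ‖((x 0 * (1 - u), -(x 0 / t)) : ℝ × ℝ)‖ ≤ |x 0| * (1 + 1 / t) ∧
      ‖((x 0 * (1 - u), -(x 0 / t)) : ℝ × ℝ)‖ ≤ 1 := by
    intro u
    have h1 : |x 0 * (1 - u)| ≤ |x 0| := by
      rw [abs_mul, abs_of_nonneg (a := 1 - (u : ℝ)) (by linarith [u.2.2])]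
      exact mul_le_of_le_one_right (abs_nonneg (x 0)) (by linarith [u.2.1])
    have h2 : |-(x 0 / t)| = |x 0| * (1 / t) := by
      rw [abs_neg, abs_div, abs_of_pos ht]; ring
    have h3 : 0 ≤ |x 0| * (1 / t) := by positivity
    simp only [Prod.norm_def, Real.norm_eq_abs, max_le_iff]
    refine ⟨⟨?_, ?_⟩, ?_, ?_⟩
    · linarith
    · linarith [abs_nonneg (x 0)]
    · linarith
    · rw [abs_neg]; exact hx0t
  have hcontr := contractionConst_mul hM
  have hℓ : 0 < contractionConst M := by unfold contractionConst; positivity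
  have hℓ2 : contractionConst M ≤ 1 / 2 := by
    unfold contractionConst
    exact one_div_le_one_div_of_le (by norm_num) (by nlinarith)
  -- Perturbed fixed point estimate: `ψ` solves the same fixed point equation up to the offset
  -- created by `x 0`, and half of `η` can be absorbed on the left.
  have hstep : η ≤ contractionConst M * (|x 0| * (1 + 1 / t)) + 1 / 2 * η := by
    rw [hη, ContinuousMap.norm_le _ (by positivity)]
    intro u
    have hstate1 := norm_scaled_state_le htM ψ u
    have hstate2 := norm_scaled_state_le htM (φ (e, s, t)) u
    have hb1 : (2 * M ^ 2 + 2 * M) * ‖ψ‖ ≤ (2 * M ^ 2 + 2 * M) * accBound M := by gcongr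
    have hb2 : (2 * M ^ 2 + 2 * M) * ‖φ (e, s, t)‖ ≤ (2 * M ^ 2 + 2 * M) * accBound M := by
      gcongr; exact h.norm_le _ hq
    have hp : ((x (t * u), y (t * u)) : ℝ × ℝ) =
        (x 0 * (1 - u), -(x 0 / t)) + (t ^ 2 * bvpPosition ψ u, t * bvpVelocity ψ u) := by
      rw [hX, hY]; rfl
    have hm1 : ((x (t * u), y (t * u)) : ℝ × ℝ) ∈ Metric.closedBall (0 : ℝ × ℝ) (stateBound M) := by
      rw [mem_closedBall_zero_iff, hp]
      refine (norm_add_le _ _).trans ?_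
      have := (hoff u).2
      unfold stateBound
      linarith
    have hm2 : ((t ^ 2 * bvpPosition (φ (e, s, t)) u, t * bvpVelocity (φ (e, s, t)) u) : ℝ × ℝ) ∈
        Metric.closedBall (0 : ℝ × ℝ) (stateBound M) := by
      rw [mem_closedBall_zero_iff]
      unfold stateBound
      linarith
    have hl := h.lip e he (s + t * u) (abs_time_le hs htM u.2) _ hm1 _ hm2
    have hsub : ((x (t * u), y (t * u)) : ℝ × ℝ) -
        (t ^ 2 * bvpPosition (φ (e, s, t)) u, t * bvpVelocity (φ (e, s, t)) u) =
        (x 0 * (1 - u), -(x 0 / t)) +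
        (t ^ 2 * bvpPosition (ψ - φ (e, s, t)) u, t * bvpVelocity (ψ - φ (e, s, t)) u) := by
      rw [hp]
      simp only [map_sub, ContinuousMap.sub_apply, mul_sub, Prod.mk_add_mk, Prod.mk_sub_mk]
      congr 1 <;> ring
    have hfin : ‖((x (t * u), y (t * u)) : ℝ × ℝ) -
        (t ^ 2 * bvpPosition (φ (e, s, t)) u, t * bvpVelocity (φ (e, s, t)) u)‖ ≤
        |x 0| * (1 + 1 / t) + (2 * M ^ 2 + 2 * M) * η := by
      rw [hsub]
      exact (norm_add_le _ _).trans (add_le_add (hoff u).1 (norm_scaled_state_le htM _ u))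
    have hfix := h.fixed _ hq u
    rw [flightPath_apply] at hfix
    rw [ContinuousMap.sub_apply, hfix]
    change |Φ (e, s + t * u, x (t * u), y (t * u)) - _| ≤ _
    refine hl.trans ?_
    calc _ ≤ contractionConst M * (|x 0| * (1 + 1 / t) + (2 * M ^ 2 + 2 * M) * η) := by gcongr
      _ = contractionConst M * (|x 0| * (1 + 1 / t)) +
          contractionConst M * (2 * M ^ 2 + 2 * M) * η := by ring
      _ ≤ _ := by gcongr
  have hη2 : η ≤ |x 0| * (1 + 1 / t) := by
    have : contractionConst M * (|x 0| * (1 + 1 / t)) ≤ 1 / 2 * (|x 0| * (1 + 1 / t)) := by gcongr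
    linarith
  have hvel : ∀ u : unitInterval,
      |y (t * u) - t * bvpVelocity (φ (e, s, t)) u| ≤ (1 / t + 2 * M * (1 + 1 / t)) * |x 0| := by
    intro u
    have h1 : y (t * u) - t * bvpVelocity (φ (e, s, t)) u =
        -(x 0 / t) + t * bvpVelocity (ψ - φ (e, s, t)) u := by
      rw [hY, map_sub, ContinuousMap.sub_apply]; ring
    have h2 : |bvpVelocity (ψ - φ (e, s, t)) u| ≤ 2 * η :=
      (ContinuousMap.norm_coe_le_norm _ u).trans (norm_bvpVelocity_le _)
    have h3 : |t * bvpVelocity (ψ - φ (e, s, t)) u| ≤ M * (2 * (|x 0| * (1 + 1 / t))) := by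
      rw [abs_mul]; gcongr; exact h2.trans (by gcongr)
    have h4 : |-(x 0 / t)| = |x 0| * (1 / t) := by
      rw [abs_neg, abs_div, abs_of_pos ht]; ring
    rw [h1]
    refine (abs_add_le _ _).trans ?_
    rw [h4]
    linarith
  refine ⟨?_, ?_⟩
  · have := hvel 0
    simpa [launch] using this
  · have := hvel 1
    simpa [landing, sub_eq_add_neg] using this

/-- Stability with `x 0 = 0`: a solution returning to the obstacle with bounded acceleration is the
flight of the family, so its initial velocity is determined. -/
theorem launch_of_bvp (h : IsFlightFamily Φ M e₀ φ) (hq : (e, s, t) ∈ box e₀ M) (ht : 0 < t)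
    {x y : ℝ → ℝ} (hx : ∀ ς ∈ Icc 0 t, HasDerivWithinAt x (y ς) (Icc 0 t) ς)
    (hy : ∀ ς ∈ Icc 0 t, HasDerivWithinAt y (Φ (e, s + ς, x ς, y ς)) (Icc 0 t) ς)
    (hx0 : x 0 = 0) (hx1 : x t = 0)
    (hbd : ∀ ς ∈ Icc 0 t, |Φ (e, s + ς, x ς, y ς)| ≤ accBound M) :
    y 0 = t * launch φ (e, s, t) := by
  have := (h.bvp_stability hq ht hx hy hx1 hbd (by simp [hx0]) (by simp [hx0, ht.le])).1
  rw [hx0, abs_zero, mul_zero] at this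
  exact sub_eq_zero.1 (abs_nonpos_iff.1 this)

/-- If a flight with launch speed `t * launch` meets the obstacle at an intermediate time `t'`, then
the flight of duration `t'` has the same launch speed. -/
theorem launch_of_position_eq_zero (h : IsFlightFamily Φ M e₀ φ) (hq : (e, s, t) ∈ box e₀ M)
    {t' : ℝ} (ht' : 0 < t') (htt : t' < t) (hp : position φ (e, s, t) t' = 0) :
    t' * launch φ (e, s, t') = t * launch φ (e, s, t) := by
  have ht := ht'.trans htt
  have hsub : Icc 0 t' ⊆ Icc 0 t := Icc_subset_Icc_right htt.le
  obtain ⟨he, hs, htM⟩ := mem_box.1 hq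
  have hq' : (e, s, t') ∈ box e₀ M := by
    refine mem_box.2 ⟨he, hs, ?_⟩
    simp only at htM ⊢
    rw [abs_of_pos ht'] ; rw [abs_of_pos ht] at htM; linarith
  rw [← h.launch_of_bvp hq' ht' (x := position φ (e, s, t)) (y := velocity φ (e, s, t))
    (fun ς hς => (hasDerivWithinAt_position φ ht (hsub hς)).mono hsub)
    (fun ς hς => (h.hasDerivWithinAt_velocity hq ht (hsub hς)).mono hsub)
    position_zero hp (fun ς hς => h.abs_field_le hq ht (hsub hς)), velocity_zero]

end Flight

end IsFlightFamily

theorem abs_sub_le_of_hasDerivWithinAt {f f' : ℝ → ℝ} {a b C : ℝ}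
    (hf : ∀ x ∈ Icc a b, HasDerivWithinAt f (f' x) (Icc a b) x)
    (hC : ∀ x ∈ Icc a b, |f' x| ≤ C) {x y : ℝ} (hx : x ∈ Icc a b) (hy : y ∈ Icc a b) :
    |f y - f x| ≤ C * |y - x| :=
  (convex_Icc a b).norm_image_sub_le_of_norm_hasDerivWithin_le hf hC hx hy

/-! ### Comparison of flights that land simultaneously -/

namespace IsFlightFamily

variable {Φ : ℝ × ℝ × ℝ × ℝ → ℝ} {M e₀ : ℝ} {φ : ℝ × ℝ × ℝ → Path01}

/-- Two flights which land simultaneously, one of which starts tangentially where the acceleration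
is small: comparison of their launch and landing speeds. -/
theorem compare_simultaneous (h : IsFlightFamily Φ M e₀ φ) {e p t δ b : ℝ}
    (hp : (e, p, t + δ) ∈ box e₀ M) (hq : (e, p + δ, t) ∈ box e₀ M) (ht : 1 ≤ t) (hδ : 0 < δ)
    (hsmall : δ * (2 * (1 + 4 * M) + stateBound M + 2) ≤ 1)
    (hb : b = 0 ∨ b = -δ)
    (ha : ∀ ς ∈ Icc 0 δ, |Φ (e, p + ς, 0, 0) - 2 * (b + ς)| ≤ δ / 20)
    (hV : launch φ (e, p, t + δ) = 0 ∨ launch φ (e, p + δ, t) = 0) :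
    |t * launch φ (e, p + δ, t) - (t + δ) * launch φ (e, p, t + δ) - (δ ^ 2 + 2 * b * δ)| ≤
      δ ^ 2 / 20 + (6 + 12 * (1 + 4 * M)) * δ ^ 3 ∧
    |t * landing φ (e, p + δ, t) - (t + δ) * landing φ (e, p, t + δ)| ≤
      12 * (1 + 4 * M) * δ ^ 3 := by
  have hM := h.one_le
  have ht0 : 0 < t := by linarith
  have htδ : 0 < t + δ := by linarith
  have hS : 1 ≤ stateBound M := by
    have : 0 ≤ accBound M := by unfold accBound; positivity
    unfold stateBound
    have : 0 ≤ 2 * M ^ 2 * accBound M := by positivity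
    have : 0 ≤ 2 * M * accBound M := by positivity
    linarith
  set C := 1 + 4 * M with hC
  set x := position φ (e, p, t + δ) with hxdef
  set y := velocity φ (e, p, t + δ) with hydef
  set z : ℝ → ℝ := fun ς => Φ (e, p + ς, x ς, y ς) with hz
  have hsub : Icc 0 δ ⊆ Icc 0 (t + δ) := Icc_subset_Icc_right (by linarith)
  have hx : ∀ ς ∈ Icc 0 (t + δ), HasDerivWithinAt x (y ς) (Icc 0 (t + δ)) ς :=
    fun ς hς => hasDerivWithinAt_position φ htδ hς
  have hy : ∀ ς ∈ Icc 0 (t + δ), HasDerivWithinAt y (z ς) (Icc 0 (t + δ)) ς :=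
    fun ς hς => h.hasDerivWithinAt_velocity hp htδ hς
  have hx' : ∀ ς ∈ Icc 0 δ, HasDerivWithinAt x (y ς) (Icc 0 δ) ς :=
    fun ς hς => (hx ς (hsub hς)).mono hsub
  have hy' : ∀ ς ∈ Icc 0 δ, HasDerivWithinAt y (z ς) (Icc 0 δ) ς :=
    fun ς hς => (hy ς (hsub hς)).mono hsub
  have hδ0 : (0 : ℝ) ∈ Icc 0 δ := ⟨le_rfl, hδ.le⟩
  have hδ1 : δ ∈ Icc 0 δ := ⟨hδ.le, le_rfl⟩
  have hx0 : x 0 = 0 := position_zero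
  have hstate : ∀ ς ∈ Icc 0 δ, |y ς| ≤ stateBound M - 1 := fun ς hς => by
    have := h.norm_state_le hp htδ (hsub hς)
    rw [Prod.norm_def, max_le_iff] at this
    exact this.2
  have hδS : δ * stateBound M ≤ 1 := by nlinarith
  have hδC : δ * C ≤ 1 / 2 := by nlinarith
  have hδh : δ ≤ 1 / 2 := by nlinarith
  -- crude bound of the position at time `δ`
  have hxδ1 : |x δ| ≤ 1 := by
    have := abs_sub_le_of_hasDerivWithinAt hx' hstate hδ0 hδ1
    rw [hx0, sub_zero, sub_zero, abs_of_pos hδ] at this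
    nlinarith
  -- the rest of the flight is close to the flight starting at `p + δ`
  have hstab : |y δ - t * launch φ (e, p + δ, t)| ≤ C * |x δ| ∧
      |y (t + δ) + t * landing φ (e, p + δ, t)| ≤ C * |x δ| := by
    have hmap : MapsTo (fun ς : ℝ => δ + ς) (Icc 0 t) (Icc 0 (t + δ)) := fun ς hς =>
      ⟨by linarith [hς.1], by linarith [hς.2]⟩
    have hshift : ∀ {w : ℝ → ℝ} {w' ς : ℝ}, ς ∈ Icc 0 t →
        HasDerivWithinAt w w' (Icc 0 (t + δ)) (δ + ς) →
        HasDerivWithinAt (fun ς => w (δ + ς)) w' (Icc 0 t) ς := by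
      intro w w' ς _ hw
      have := hw.comp ς ((hasDerivWithinAt_id ς (Icc 0 t)).const_add δ) hmap
      rwa [mul_one] at this
    have key := h.bvp_stability hq ht0 (x := fun ς => x (δ + ς)) (y := fun ς => y (δ + ς))
      (fun ς hς => hshift hς (hx _ (hmap hς)))
      (fun ς hς => by
        have := hshift hς (hy _ (hmap hς))
        simpa only [hz, add_assoc] using this)
      (by rw [add_comm]; exact position_end htδ)
      (fun ς hς => by
        have := h.abs_field_le hp htδ (hmap hς)
        simpa only [add_assoc] using this)
      (by simpa using hxδ1) (by simpa using hxδ1.trans ht)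
    have hc : 1 / t + 2 * M * (1 + 1 / t) ≤ C := by
      have : 1 / t ≤ 1 := (div_le_one ht0).2 ht
      nlinarith
    simp only [add_zero, add_comm δ t] at key
    exact ⟨key.1.trans (by gcongr), key.2.trans (by gcongr)⟩
  -- maximal acceleration on the first part of the flight
  obtain ⟨ς₀, hς₀, hmax⟩ := isCompact_Icc.exists_isMaxOn (s := Icc (0 : ℝ) δ)
    (f := fun ς => |z ς|) ⟨0, hδ0⟩ (by
      have hxc : ContinuousOn x (Icc 0 δ) := fun ς hς => (hx' ς hς).continuousWithinAt
      have hyc : ContinuousOn y (Icc 0 δ) := fun ς hς => (hy' ς hς).continuousWithinAt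
      have : ContinuousOn z (Icc 0 δ) := h.contDiff_field.continuous.comp_continuousOn
        (continuousOn_const.prodMk ((continuousOn_const.add continuousOn_id).prodMk
          (hxc.prodMk hyc)))
      exact this.abs)
  set m := |z ς₀| with hm
  have hm0 : 0 ≤ m := abs_nonneg _
  have hzm : ∀ ς ∈ Icc 0 δ, |z ς| ≤ m := fun ς hς => hmax hς
  have hyb : ∀ ς ∈ Icc 0 δ, |y ς| ≤ C * |x δ| + m * δ := by
    intro ς hς
    -- One of the two flights is tangential. If it is the earlier one, `y` vanishes at `0`. If it is
    -- the later one, `y δ` is controlled by `x δ` through `hstab`. Either way `y` is bounded by `m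
    -- * δ` plus a term that can be absorbed.
    rcases hV with hV | hV
    · have h0 : y 0 = 0 := by rw [hydef, velocity_zero, hV, mul_zero]
      have := abs_sub_le_of_hasDerivWithinAt hy' hzm hδ0 hς
      rw [h0, sub_zero, sub_zero, abs_of_nonneg hς.1] at this
      have h1 : m * ς ≤ m * δ := by gcongr; exact hς.2
      have h2 : 0 ≤ C * |x δ| := by positivity
      linarith
    · have h1 := hstab.1
      rw [hV, mul_zero, sub_zero] at h1
      have h2 := abs_sub_le_of_hasDerivWithinAt hy' hzm hδ1 hς
      have h3 : m * |ς - δ| ≤ m * δ := by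
        gcongr; rw [abs_le]; constructor <;> linarith [hς.1, hς.2]
      have h4 := abs_sub_abs_le_abs_sub (y ς) (y δ)
      linarith
  have hxb : ∀ ς ∈ Icc 0 δ, |x ς| ≤ (C * |x δ| + m * δ) * δ := by
    intro ς hς
    have := abs_sub_le_of_hasDerivWithinAt hx' hyb hδ0 hς
    rw [hx0, sub_zero, sub_zero, abs_of_nonneg hς.1] at this
    exact this.trans (by gcongr; exact hς.2)
  have hxδ : |x δ| ≤ 2 * m * δ ^ 2 := by
    have h1 := hxb δ hδ1
    have h2 : δ * C * |x δ| ≤ 1 / 2 * |x δ| := by gcongr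
    nlinarith
  have hyb2 : ∀ ς ∈ Icc 0 δ, |y ς| ≤ 2 * m * δ := by
    intro ς hς
    have h1 := hyb ς hς
    have h2 : C * |x δ| ≤ C * (2 * m * δ ^ 2) := by gcongr
    have h3 : C * (2 * m * δ ^ 2) = (δ * C) * (2 * m * δ) := by ring
    have h4 : (δ * C) * (2 * m * δ) ≤ 1 / 2 * (2 * m * δ) := by gcongr
    linarith
  have hxb2 : ∀ ς ∈ Icc 0 δ, |x ς| ≤ 2 * m * δ := by
    intro ς hς
    have h0 := abs_sub_le_of_hasDerivWithinAt hx' hyb2 hδ0 hς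
    rw [hx0, sub_zero, sub_zero, abs_of_nonneg hς.1] at h0
    have : 2 * m * δ * ς ≤ 2 * m * δ * 1 := by gcongr; linarith [hς.2]
    linarith
  have hℓ2 : contractionConst M ≤ 1 / 2 := by
    unfold contractionConst
    exact one_div_le_one_div_of_le (by norm_num) (by nlinarith)
  have hℓ0 : 0 ≤ contractionConst M := by unfold contractionConst; positivity
  obtain ⟨he, hpM, htM⟩ := mem_box.1 hp
  simp only at he hpM htM
  have hzΦ : ∀ ς ∈ Icc 0 δ, |z ς - Φ (e, p + ς, 0, 0)| ≤ m * δ := by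
    intro ς hς
    have hn := h.norm_state_le hp htδ (hsub hς)
    have habs : |p + ς| ≤ 2 * M := by
      have h1 := abs_add_le p ς
      have h2 : |ς| = ς := abs_of_nonneg hς.1
      have h3 : ς ≤ t + δ := by linarith [hς.2]
      rw [abs_of_pos htδ] at htM
      linarith
    have := h.lip e he (p + ς) habs (x ς, y ς)
      (mem_closedBall_zero_iff.2 (hn.trans (by linarith))) (0, 0)
      (mem_closedBall_zero_iff.2 (by
        rw [Prod.mk_zero_zero, norm_zero]; linarith))
    refine this.trans ?_
    have hnn : ‖((x ς, y ς) : ℝ × ℝ) - (0, 0)‖ ≤ 2 * m * δ := by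
      simp only [Prod.mk_zero_zero, sub_zero, Prod.norm_def, max_le_iff, Real.norm_eq_abs]
      exact ⟨hxb2 ς hς, hyb2 ς hς⟩
    calc _ ≤ 1 / 2 * (2 * m * δ) := by gcongr
      _ = m * δ := by ring
  have hbς : ∀ ς ∈ Icc 0 δ, |2 * (b + ς)| ≤ 2 * δ := by
    intro ς hς
    rw [abs_mul, abs_two]
    gcongr
    rw [abs_le]
    rcases hb with rfl | rfl <;> constructor <;> linarith [hς.1, hς.2]
  -- The acceleration is within `m * δ` of its value at the obstacle, which is at most `2 * δ + δ /
  -- 20`. As `δ ≤ 1/2`, the bound closes on itself, and the position at time `δ` is cubic in `δ`.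
  have hm6 : m ≤ 6 * δ := by
    have h1 := hzΦ ς₀ hς₀
    have h2 := ha ς₀ hς₀
    have h3 := hbς ς₀ hς₀
    have h4 : m ≤ m * δ + δ / 20 + 2 * δ := by
      rw [abs_le] at h1 h2 h3
      rw [hm, abs_le]
      constructor <;> linarith
    nlinarith
  have hxδ3 : |x δ| ≤ 12 * δ ^ 3 := by
    have : 2 * m * δ ^ 2 ≤ 2 * (6 * δ) * δ ^ 2 := by gcongr
    nlinarith
  have hCx : C * |x δ| ≤ 12 * C * δ ^ 3 := by
    have : C * |x δ| ≤ C * (12 * δ ^ 3) := by gcongr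
    linarith
  have hy0 : y 0 = (t + δ) * launch φ (e, p, t + δ) := velocity_zero
  have hyend : y (t + δ) = -((t + δ) * landing φ (e, p, t + δ)) := velocity_end htδ
  -- The main term is the integral of `2 * (b + ς)` over `[0, δ]`. Here `b` stands for the start `p`
  -- minus the tangency, so it is `0` or `-δ` according to which flight is tangential.
  have hdy : |y δ - y 0 - (δ ^ 2 + 2 * b * δ)| ≤ δ ^ 2 / 20 + 6 * δ ^ 3 := by
    have := abs_sub_le_of_hasDerivWithinAt (f := fun ς => y ς - (ς ^ 2 + 2 * b * ς))
      (f' := fun ς => z ς - 2 * (b + ς)) (a := 0) (b := δ) (C := δ / 20 + 6 * δ ^ 2)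
      (fun ς hς => by
        have h1 := ((hasDerivAt_pow 2 ς).add ((hasDerivAt_id ς).const_mul (2 * b))).hasDerivWithinAt
          (s := Icc 0 δ)
        refine ((hy' ς hς).sub h1).congr_deriv ?_
        norm_num; ring)
      (fun ς hς => by
        have h1 := hzΦ ς hς
        have h2 := ha ς hς
        have h3 : m * δ ≤ 6 * δ * δ := by gcongr
        have h4 : 6 * δ * δ = 6 * δ ^ 2 := by ring
        rw [abs_le] at h1 h2 ⊢
        constructor <;> linarith) hδ0 hδ1
    rw [sub_zero δ, abs_of_pos hδ] at this
    have e1 : y δ - (δ ^ 2 + 2 * b * δ) - (y 0 - (0 ^ 2 + 2 * b * 0)) =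
        y δ - y 0 - (δ ^ 2 + 2 * b * δ) := by ring
    rw [e1] at this
    refine this.trans (le_of_eq ?_)
    ring
  obtain ⟨hs1, hs2⟩ := hstab
  rw [hyend] at hs2
  rw [hy0] at hdy
  refine ⟨?_, ?_⟩
  · have e1 : (6 + 12 * C) * δ ^ 3 = 6 * δ ^ 3 + 12 * C * δ ^ 3 := by ring
    rw [e1]
    rw [abs_le] at hs1 hdy ⊢
    constructor <;> linarith
  · rw [abs_le] at hs2 ⊢
    constructor <;> linarith

/-- Comparison of the tangential flight with nearby flights landing at the same time. -/
theorem compare_with_tangential (h : IsFlightFamily Φ M e₀ φ) (hM : 7 ≤ M) :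
    ∃ κ > 0, ∃ C > 0, ∃ e₁ > 0, ∀ e, |e| < e₁ → ∀ sA tA s, |sA + 1| < κ → |tA - 4| < κ →
      |s - sA| < κ → launch φ (e, sA, 0) = 0 → launch φ (e, sA, tA) = 0 →
      |(sA + tA - s) * launch φ (e, s, sA + tA - s) - (s - sA) ^ 2| ≤ (s - sA) ^ 2 / 10 ∧
      |(sA + tA - s) * landing φ (e, s, sA + tA - s) - tA * landing φ (e, sA, tA)| ≤
        C * |s - sA| ^ 3 := by
  have he₀ := h.e₀_pos
  -- the derivative of the acceleration at the obstacle is close to `2` near `(0, -1)`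
  have hda : ∀ z : ℝ × ℝ, HasDerivAt (fun s => Φ (z.1, s, 0, 0))
      (fderiv ℝ Φ (z.1, z.2, 0, 0) (0, 1, 0, 0)) z.2 := by
    intro z
    have h1 : HasFDerivAt Φ (fderiv ℝ Φ (z.1, z.2, 0, 0)) (z.1, z.2, 0, 0) :=
      (h.contDiff_field.differentiable one_ne_zero _).hasFDerivAt
    have h2 : HasDerivAt (fun s : ℝ => ((z.1, s, 0, 0) : ℝ × ℝ × ℝ × ℝ)) (0, 1, 0, 0) z.2 :=
      (hasDerivAt_const _ _).prodMk ((hasDerivAt_id _).prodMk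
        ((hasDerivAt_const _ _).prodMk (hasDerivAt_const _ _)))
    exact h1.comp_hasDerivAt z.2 h2
  have hd0 : fderiv ℝ Φ (0, -1, 0, 0) (0, 1, 0, 0) = 2 := by
    have h1 := hda (0, -1)
    simp only [h.field_zero] at h1
    have h2 : HasDerivAt (fun s : ℝ => 1 - s ^ 2) (-(2 * (-1))) (-1) := by
      simpa using (hasDerivAt_pow 2 (-1 : ℝ)).const_sub 1
    rw [h1.unique h2]; norm_num
  have hcont : Continuous fun z : ℝ × ℝ => fderiv ℝ Φ (z.1, z.2, 0, 0) (0, 1, 0, 0) := by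
    have := h.contDiff_field.continuous_fderiv one_ne_zero
    fun_prop
  obtain ⟨ε, hε, hball⟩ := Metric.continuousAt_iff.1 (hcont.continuousAt (x := (0, -1))) (1 / 20)
    (by norm_num)
  simp only [hd0] at hball
  set K := 2 * (1 + 4 * M) + stateBound M + 2 with hK
  have hKpos : 0 < K := by
    have : 0 ≤ accBound M := by unfold accBound; positivity
    have : 0 ≤ stateBound M := by unfold stateBound; positivity
    rw [hK]; linarith
  set N := 6 + 12 * (1 + 4 * M) with hN
  -- The bound `1 / K` meets the smallness condition of `compare_simultaneous`, and `1 / (20 * N)`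
  -- turns its cubic error into `δ² / 20`. With the error from the acceleration this gives the total
  -- `1/10`.
  refine ⟨min (min (ε / 2) (1 / 2)) (min (1 / K) (1 / (20 * N))),
    by simp only [gt_iff_lt, lt_min_iff]; refine ⟨⟨?_, ?_⟩, ?_, ?_⟩ <;> positivity, 12 * (1 + 4 * M),
    by positivity, min ε e₀, by simp [hε, he₀], ?_⟩
  intro e he sA tA s hsA htA hs hLA0 hLA
  simp only [lt_min_iff] at he hsA htA hs
  obtain ⟨⟨hsA1, hsA2⟩, -, -⟩ := hsA
  obtain ⟨⟨-, htA2⟩, -, -⟩ := htA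
  obtain ⟨⟨hs1, hs2⟩, hs3, hs4⟩ := hs
  rw [abs_lt] at hsA2 htA2
  have hs2' := abs_lt.1 hs2
  have haA : Φ (e, sA, 0, 0) = 0 := by
    rw [h.launch_time_zero he.2 (by rw [abs_lt]; constructor <;> linarith)] at hLA0
    linarith
  have hacc : ∀ ς, |ς - sA| ≤ |s - sA| → |Φ (e, ς, 0, 0) - 2 * (ς - sA)| ≤ |s - sA| / 20 := by
    intro ς hς
    have := (convex_closedBall sA |s - sA|).norm_image_sub_le_of_norm_hasDerivWithin_le
      (f := fun ς => Φ (e, ς, 0, 0) - 2 * ς) (C := 1 / 20)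
      (f' := fun ς => fderiv ℝ Φ (e, ς, 0, 0) (0, 1, 0, 0) - 2)
      (fun x _ => by
        have := (hda (e, x)).sub ((hasDerivAt_id x).const_mul 2)
        rw [mul_one] at this
        exact this.hasDerivWithinAt)
      (fun x hx => by
        rw [Metric.mem_closedBall, Real.dist_eq] at hx
        have hd : dist ((e, x) : ℝ × ℝ) (0, -1) < ε := by
          rw [Prod.dist_eq, max_lt_iff]
          refine ⟨by simpa using he.1, ?_⟩
          rw [Real.dist_eq, abs_lt]
          rw [abs_le] at hx
          rw [abs_lt] at hsA1
          constructor <;> linarith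
        exact (hball hd).le)
      (x := sA) (y := ς) (Metric.mem_closedBall_self (abs_nonneg _))
      (by rw [Metric.mem_closedBall, Real.dist_eq]; exact hς)
    rw [haA, Real.norm_eq_abs, Real.norm_eq_abs] at this
    have e1 : Φ (e, ς, 0, 0) - 2 * ς - (0 - 2 * sA) = Φ (e, ς, 0, 0) - 2 * (ς - sA) := by ring
    rw [e1] at this
    linarith
  have hbox : ∀ s t, |s| < M → |t| < M → (e, s, t) ∈ box e₀ M := fun s t h1 h2 =>
    mem_box.2 ⟨he.2, h1, h2⟩
  have hsmallδ : |s - sA| * K ≤ 1 := by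
    rw [lt_div_iff₀ hKpos] at hs3; linarith
  have hcubic : ∀ δ : ℝ, 0 ≤ δ → δ = |s - sA| → N * δ ^ 3 ≤ δ ^ 2 / 20 := by
    intro δ hδ0 hδ
    rw [← hδ, lt_div_iff₀ (by positivity)] at hs4
    nlinarith [sq_nonneg δ]
  -- The flight starting first plays the role of `p`: the compared one if `s < sA`, the tangential
  -- one if `s > sA`.
  rcases lt_trichotomy s sA with hlt | heq | hgt
  · have hδ : |s - sA| = sA - s := by rw [abs_of_neg (by linarith)]; ring
    rw [hδ] at hacc hsmallδ hcubic ⊢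
    have key := h.compare_simultaneous (e := e) (p := s) (t := tA) (δ := sA - s) (b := -(sA - s))
      (hbox _ _ (by rw [abs_lt]; constructor <;> linarith)
        (by rw [abs_lt]; constructor <;> linarith))
      (hbox _ _ (by rw [abs_lt]; constructor <;> linarith)
        (by rw [abs_lt]; constructor <;> linarith)) (by linarith) (by linarith)
      hsmallδ (Or.inr rfl)
      (fun ς hς => by
        have := hacc (s + ς) (by rw [abs_le]; constructor <;> linarith [hς.1, hς.2])
        have e1 : s + ς - sA = -(sA - s) + ς := by ring
        rwa [e1] at this)
      (Or.inr (by simpa using hLA))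
    have e1 : tA + (sA - s) = sA + tA - s := by ring
    rw [e1, add_sub_cancel, hLA] at key
    obtain ⟨k1, k2⟩ := key
    have hc := hcubic (sA - s) (by linarith) rfl
    refine ⟨?_, ?_⟩
    · have e2 : (sA - s) ^ 2 + 2 * -(sA - s) * (sA - s) = -(s - sA) ^ 2 := by ring
      have e3 : (sA - s) ^ 2 = (s - sA) ^ 2 := by ring
      rw [← hN, e2, mul_zero] at k1
      rw [e3] at k1 hc
      rw [abs_le] at k1 ⊢
      constructor <;> linarith [sq_nonneg (s - sA)]
    · rw [abs_sub_comm]; exact k2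
  · subst heq
    simp [hLA]
  · have hδ : |s - sA| = s - sA := abs_of_pos (by linarith)
    rw [hδ] at hacc hsmallδ hcubic ⊢
    have key := h.compare_simultaneous (e := e) (p := sA) (t := sA + tA - s) (δ := s - sA) (b := 0)
      (hbox _ _ (by rw [abs_lt]; constructor <;> linarith)
        (by rw [abs_lt]; constructor <;> linarith))
      (hbox _ _ (by rw [abs_lt]; constructor <;> linarith)
        (by rw [abs_lt]; constructor <;> linarith)) (by linarith) (by linarith)
      hsmallδ (Or.inl rfl)
      (fun ς hς => by
        have := hacc (sA + ς) (by rw [abs_le]; constructor <;> linarith [hς.1, hς.2])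
        have e1 : sA + ς - sA = 0 + ς := by ring
        rwa [e1] at this)
      (Or.inl (by simpa using hLA))
    have e1 : sA + tA - s + (s - sA) = tA := by ring
    rw [e1, add_sub_cancel, hLA] at key
    obtain ⟨k1, k2⟩ := key
    have hc := hcubic (s - sA) (by linarith) rfl
    refine ⟨?_, ?_⟩
    · rw [← hN, mul_zero, mul_zero, zero_mul, add_zero, sub_zero] at k1
      rw [abs_le] at k1 ⊢
      constructor <;> linarith [sq_nonneg (s - sA)]
    · exact k2

end IsFlightFamily

/-! ### Functions that are `C¹` on the fibers of the parameter -/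

section FiberC1

variable {E G H : Type*} [NormedAddCommGroup E] [NormedSpace ℝ E] [NormedAddCommGroup G]
  [NormedSpace ℝ G] [NormedAddCommGroup H] [NormedSpace ℝ H]

/-- Near `z` the function `F (e, p)` is `C¹` in `p`, and it and its derivative in `p` are jointly
continuous in `(e, p)`. -/
def FiberC1At (F : ℝ × E → G) (z : ℝ × E) : Prop :=
  ∃ F' : ℝ × E → E →L[ℝ] G, ∀ᶠ w in 𝓝 z,
    HasFDerivAt (fun p => F (w.1, p)) (F' w) w.2 ∧ ContinuousAt F' w ∧ ContinuousAt F w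

theorem FiberC1At.eventually {F : ℝ × E → G} {z : ℝ × E} (h : FiberC1At F z) :
    ∀ᶠ w in 𝓝 z, FiberC1At F w := by
  obtain ⟨F', hF'⟩ := h
  filter_upwards [hF'.eventually_nhds] with w hw
  exact ⟨F', hw⟩

theorem FiberC1At.continuousAt {F : ℝ × E → G} {z : ℝ × E} (h : FiberC1At F z) :
    ContinuousAt F z := by
  obtain ⟨F', hF'⟩ := h
  exact hF'.self_of_nhds.2.2

theorem FiberC1At.differentiableAt {F : ℝ × E → G} {z : ℝ × E} (h : FiberC1At F z) :
    DifferentiableAt ℝ (fun p => F (z.1, p)) z.2 := by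
  obtain ⟨F', hF'⟩ := h
  exact hF'.self_of_nhds.1.differentiableAt

theorem FiberC1At.continuousAt_fderiv {F : ℝ × E → G} {z : ℝ × E} (h : FiberC1At F z) :
    ContinuousAt (fun w : ℝ × E => fderiv ℝ (fun p => F (w.1, p)) w.2) z := by
  obtain ⟨F', hF'⟩ := h
  refine hF'.self_of_nhds.2.1.congr ?_
  filter_upwards [hF'] with w hw
  exact hw.1.fderiv.symm

theorem FiberC1At.contDiffAt {F : ℝ × E → G} {e : ℝ} {p : E} (h : FiberC1At F (e, p)) :
    ContDiffAt ℝ 1 (fun p => F (e, p)) p := by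
  obtain ⟨F', hF'⟩ := h
  have hc : ContinuousAt (fun p : E => (e, p)) p := by fun_prop
  have h2 := hc.eventually hF'
  rw [contDiffAt_one_iff]
  refine ⟨fun p => F' (e, p), _, h2, fun x hx => ?_, fun x hx => hx.1⟩
  have hx' : ContinuousAt F' (e, x) := hx.2.1
  exact (hx'.comp (f := fun p : E => (e, p)) (x := x) (by fun_prop)).continuousWithinAt

theorem FiberC1At.congr {F F₁ : ℝ × E → G} {z : ℝ × E} (h : FiberC1At F z) (h1 : F₁ =ᶠ[𝓝 z] F) :
    FiberC1At F₁ z := by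
  obtain ⟨F', hF'⟩ := h
  refine ⟨F', ?_⟩
  filter_upwards [hF', h1.eventuallyEq_nhds] with w hw hw1
  refine ⟨?_, hw.2.1, hw.2.2.congr hw1.symm⟩
  refine hw.1.congr_of_eventuallyEq ?_
  have hc : ContinuousAt (fun p : E => (w.1, p)) w.2 := by fun_prop
  exact hc.eventually (p := fun v => F₁ v = F v) hw1

theorem FiberC1At.of_contDiffAt {F : ℝ × E → G} {z : ℝ × E} (h : ContDiffAt ℝ 1 F z) :
    FiberC1At F z := by
  refine ⟨fun w => fderiv ℝ F w ∘L .inr ℝ ℝ E, ?_⟩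
  filter_upwards [h.eventually (by simp)] with w hw
  refine ⟨?_, ?_, hw.continuousAt⟩
  · exact (hw.differentiableAt one_ne_zero).hasFDerivAt.comp w.2 (hasFDerivAt_prodMk_right w.1 w.2)
  · have : ContinuousAt (fderiv ℝ F) w := (hw.fderiv_right (m := 0) (by simp)).continuousAt
    exact this.clm_comp continuousAt_const

theorem FiberC1At.comp {F : ℝ × G → H} {K : ℝ × E → G} {z : ℝ × E}
    (hF : FiberC1At F (z.1, K z)) (hK : FiberC1At K z) :
    FiberC1At (fun w => F (w.1, K w)) z := by
  have hKc := hK.continuousAt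
  obtain ⟨F', hF'⟩ := hF
  obtain ⟨K', hK'⟩ := hK
  have hpair : ContinuousAt (fun w : ℝ × E => (w.1, K w)) z := continuousAt_fst.prodMk hKc
  refine ⟨fun w => F' (w.1, K w) ∘L K' w, ?_⟩
  filter_upwards [hpair.eventually hF', hK'] with w hw1 hw2
  have hp : ContinuousAt (fun w : ℝ × E => (w.1, K w)) w := continuousAt_fst.prodMk hw2.2.2
  refine ⟨HasFDerivAt.comp (g := fun p => F (w.1, p)) (f := fun p => K (w.1, p)) w.2 hw1.1 hw2.1,
    ?_, ?_⟩
  · exact (ContinuousAt.comp (g := F') (f := fun w : ℝ × E => (w.1, K w)) hw1.2.1 hp).clm_comp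
      hw2.2.1
  · exact ContinuousAt.comp (g := F) (f := fun w : ℝ × E => (w.1, K w)) hw1.2.2 hp

theorem FiberC1At.prodMk {F : ℝ × E → G} {K : ℝ × E → H} {z : ℝ × E}
    (hF : FiberC1At F z) (hK : FiberC1At K z) : FiberC1At (fun w => (F w, K w)) z := by
  obtain ⟨F', hF'⟩ := hF
  obtain ⟨K', hK'⟩ := hK
  refine ⟨fun w => (F' w).prod (K' w), ?_⟩
  filter_upwards [hF', hK'] with w h1 h2
  refine ⟨h1.1.prodMk h2.1, ?_, h1.2.2.prodMk h2.2.2⟩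
  exact (ContinuousLinearMap.prodₗᵢ ℝ (E := E) (F := G) (G := H) (𝕜 := ℝ)).continuous.continuousAt.comp
    (f := fun w => (F' w, K' w)) (h1.2.1.prodMk h2.2.1)

end FiberC1

/-! ### Limits of orbits near a line of fixed points -/

section Stable

/-- The two step map `(s, t) ↦ (s + t, τ (e, s, t))`, fibered over the parameter `e`. -/
def shiftMap (τ : ℝ × ℝ × ℝ → ℝ) (z : ℝ × ℝ × ℝ) : ℝ × ℝ × ℝ := (z.1, z.2.1 + z.2.2, τ z)

/-- The `n`-th step length along the orbit of `z`. -/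
def stepLength (τ : ℝ × ℝ × ℝ → ℝ) (n : ℕ) (z : ℝ × ℝ × ℝ) : ℝ := ((shiftMap τ)^[n] z).2.2

/-- The limit of the first coordinate along the orbit of `z`. -/
noncomputable def limitPoint (τ : ℝ × ℝ × ℝ → ℝ) (z : ℝ × ℝ × ℝ) : ℝ :=
  z.2.1 + ∑' n, stepLength τ n z

theorem shiftMap_iterate_fst (τ : ℝ × ℝ × ℝ → ℝ) (n : ℕ) (z : ℝ × ℝ × ℝ) :
    ((shiftMap τ)^[n] z).1 = z.1 := by
  induction n with
  | zero => rfl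
  | succ n ih => rw [Function.iterate_succ_apply']; exact ih

theorem shiftMap_iterate_snd_fst (τ : ℝ × ℝ × ℝ → ℝ) (n : ℕ) (z : ℝ × ℝ × ℝ) :
    ((shiftMap τ)^[n] z).2.1 = z.2.1 + ∑ k ∈ Finset.range n, stepLength τ k z := by
  induction n with
  | zero => simp
  | succ n ih =>
    rw [Function.iterate_succ_apply', Finset.sum_range_succ, ← add_assoc, ← ih]
    rfl

theorem tendsto_of_summable_stepLength {τ : ℝ × ℝ × ℝ → ℝ} {z : ℝ × ℝ × ℝ}
    (h : Summable fun n => stepLength τ n z) :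
    Tendsto (fun n => ((shiftMap τ)^[n] z).2.1) atTop (𝓝 (limitPoint τ z)) := by
  simp only [shiftMap_iterate_snd_fst]
  exact h.hasSum.tendsto_sum_nat.const_add _

theorem stepLength_shift (τ : ℝ × ℝ × ℝ → ℝ) (n : ℕ) (z : ℝ × ℝ × ℝ) :
    stepLength τ n (shiftMap τ z) = stepLength τ (n + 1) z := rfl

/-- The limit belongs to the orbit and not to its initial point. This lets regularity be transported
from the tail of an orbit back to its start. -/
theorem limitPoint_shift {τ : ℝ × ℝ × ℝ → ℝ} {z : ℝ × ℝ × ℝ}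
    (h : Summable fun n => stepLength τ n z) : limitPoint τ (shiftMap τ z) = limitPoint τ z := by
  unfold limitPoint
  simp only [stepLength_shift]
  rw [h.tsum_eq_zero_add]
  simp only [shiftMap, stepLength, Function.iterate_zero, id]
  ring

theorem limitPoint_of_step_zero {τ : ℝ × ℝ × ℝ → ℝ} {z : ℝ × ℝ × ℝ}
    (h : ∀ n, stepLength τ n z = 0) : limitPoint τ z = z.2.1 := by
  simp [limitPoint, h]

/-- Near a point `(0, σ, 0)` where step lengths contract, orbits converge and their limit is a `C¹`
function of the initial point. -/
theorem exists_limitPoint_fiberC1 {τ : ℝ × ℝ × ℝ → ℝ} {σ : ℝ}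
    (hτ : FiberC1At τ (0, σ, 0)) (h0 : ∀ᶠ z : ℝ × ℝ × ℝ in 𝓝 (0, σ, 0), τ (z.1, z.2.1, 0) = 0)
    (hslope : |fderiv ℝ (fun p => τ (0, p)) (σ, 0) (0, 1)| < 1)
    {C : ℝ} (hrate : ∀ᶠ z : ℝ × ℝ × ℝ in 𝓝 (0, σ, 0),
      |fderiv ℝ (fun p => τ (z.1, p)) z.2 (1, 0)| ≤ C * |z.2.2|)
    {𝒩 : Set (ℝ × ℝ × ℝ)} (h𝒩 : 𝒩 ∈ 𝓝 ((0, σ, 0) : ℝ × ℝ × ℝ)) :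
    ∃ U ∈ 𝓝 ((0, σ, 0) : ℝ × ℝ × ℝ), IsOpen U ∧ ∃ q, 0 ≤ q ∧ q < 1 ∧ ∀ z ∈ U,
      (∀ n, (shiftMap τ)^[n] z ∈ 𝒩 ∧ |stepLength τ n z| ≤ q ^ n * |z.2.2|) ∧
      FiberC1At (limitPoint τ) z := by
  obtain ⟨F', hF'⟩ := hτ
  set z₀ : ℝ × ℝ × ℝ := (0, σ, 0) with hz₀
  obtain ⟨q, hq1, hq2⟩ := exists_between hslope
  have hq0 : 0 ≤ q := (abs_nonneg _).trans hq1.le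
  -- Steps decay at rate `q`, their derivatives only at the slower rate `q₁`. The gap `q₁ - q` pays
  -- for the dependence of `τ` on the starting time.
  set q₁ := (1 + q) / 2 with hq₁
  have hq₁1 : q₁ < 1 := by rw [hq₁]; linarith
  have hq₁0 : 0 ≤ q₁ := by rw [hq₁]; linarith
  have hslope' : ∀ᶠ z in 𝓝 z₀, |F' z (0, 1)| < q := by
    have h1 : F' z₀ = fderiv ℝ (fun p => τ (0, p)) (σ, 0) := hF'.self_of_nhds.1.fderiv.symm
    have h2 : ContinuousAt (fun z => |F' z (0, 1)|) z₀ :=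
      (hF'.self_of_nhds.2.1.clm_apply continuousAt_const).abs
    refine h2.eventually_lt continuousAt_const ?_
    simpa only [h1] using hq1
  have hrate' : ∀ᶠ z in 𝓝 z₀, |F' z (1, 0)| ≤ C * |z.2.2| := by
    filter_upwards [hrate, hF'] with z h1 h2
    rwa [h2.1.fderiv] at h1
  obtain ⟨ε₁, hε₁, hball₁⟩ := Metric.eventually_nhds_iff_ball.1
    (hF'.and (h0.and (hslope'.and (hrate'.and h𝒩))))
  -- Bounds the derivative of the starting time after any number of steps: its own initial value
  -- plus a geometric series in `q₁`.
  set c := 1 + 1 / (1 - q₁) with hc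
  have hcpos : 0 < c := by
    have : 0 < 1 / (1 - q₁) := by apply one_div_pos.2; linarith
    rw [hc]; linarith
  set ε := min ε₁ ((q₁ - q) / ((|C| + 1) * c)) with hε
  have hεpos : 0 < ε := by
    rw [hε, lt_min_iff]
    refine ⟨hε₁, div_pos (by rw [hq₁]; linarith) (by positivity)⟩
  have hball : ∀ z ∈ Metric.ball z₀ ε, (HasFDerivAt (fun p => τ (z.1, p)) (F' z) z.2 ∧
      ContinuousAt F' z ∧ ContinuousAt τ z) ∧ τ (z.1, z.2.1, 0) = 0 ∧ |F' z (0, 1)| < q ∧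
      |F' z (1, 0)| ≤ C * |z.2.2| ∧ z ∈ 𝒩 := fun z hz =>
    hball₁ z (Metric.ball_subset_ball (min_le_left _ _) hz)
  have hmem : ∀ {r : ℝ} {z : ℝ × ℝ × ℝ}, z ∈ Metric.ball z₀ r ↔
      |z.1| < r ∧ |z.2.1 - σ| < r ∧ |z.2.2| < r := by
    intro r z
    simp [hz₀, Metric.mem_ball, Prod.dist_eq, Real.dist_eq]
  have hCε : |C| * ε * c ≤ q₁ - q := by
    have h1 : ε ≤ (q₁ - q) / ((|C| + 1) * c) := min_le_right _ _
    rw [le_div_iff₀ (by positivity)] at h1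
    have : 0 ≤ ε * c := by positivity
    linarith
  -- contraction of steps
  have hcontr : ∀ z ∈ Metric.ball z₀ ε, |τ z| ≤ q * |z.2.2| := by
    rintro ⟨e, s, t⟩ hz
    obtain ⟨he, hs, ht⟩ := hmem.1 hz
    simp only at he hs ht ⊢
    have hin : ∀ t' ∈ segment ℝ 0 t, (e, s, t') ∈ Metric.ball z₀ ε := by
      intro t' ht'
      obtain ⟨θ, hθ, rfl⟩ := (segment_eq_image ℝ 0 t) ▸ ht'
      refine hmem.2 ⟨he, hs, ?_⟩
      simp only [smul_eq_mul, mul_zero, zero_add, abs_mul, abs_of_nonneg hθ.1]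
      exact (mul_le_of_le_one_left (abs_nonneg _) hθ.2).trans_lt ht
    have := (convex_segment (𝕜 := ℝ) 0 t).norm_image_sub_le_of_norm_hasDerivWithin_le
      (f := fun t' => τ (e, s, t')) (f' := fun t' => F' (e, s, t') (0, 1)) (C := q)
      (fun t' ht' => by
        have h1 := (hball _ (hin t' ht')).1.1
        have h2 : HasDerivAt (fun t' : ℝ => ((s, t') : ℝ × ℝ)) (0, 1) t' :=
          (hasDerivAt_const _ _).prodMk (hasDerivAt_id _)
        exact (h1.comp_hasDerivAt t' h2).hasDerivWithinAt)
      (fun t' ht' => (hball _ (hin t' ht')).2.2.1.le)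
      (left_mem_segment ℝ _ _) (right_mem_segment ℝ _ _)
    rw [(hball _ hz).2.1] at this
    simpa using this
  -- The steps from a point with `|t| < ε'` add up to at most `ε' / (1 - q) = ε / 2`. The initial
  -- offset takes at most the other half of `ε`.
  set ε' := ε * (1 - q) / 2 with hε'
  have hε'pos : 0 < ε' := by rw [hε']; apply div_pos (mul_pos hεpos (by linarith)); norm_num
  have hε'ε : ε' ≤ ε := by rw [hε']; nlinarith
  -- orbits stay in the larger ball
  have horbit : ∀ z ∈ Metric.ball z₀ ε', ∀ n, (shiftMap τ)^[n] z ∈ Metric.ball z₀ ε ∧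
      |stepLength τ n z| ≤ q ^ n * |z.2.2| := by
    intro z hz
    obtain ⟨he, hs, ht⟩ := hmem.1 hz
    have aux : ∀ n, (shiftMap τ)^[n] z ∈ Metric.ball z₀ ε ∧
        |stepLength τ n z| ≤ q ^ n * |z.2.2| ∧
        |((shiftMap τ)^[n] z).2.1 - z.2.1| * (1 - q) ≤ |z.2.2| * (1 - q ^ n) := by
      intro n
      induction n with
      | zero => exact ⟨Metric.ball_subset_ball hε'ε hz, by simp [stepLength], by simp⟩
      | succ n ih =>
        obtain ⟨ih1, ih2, ih3⟩ := ih
        have h1 : |stepLength τ (n + 1) z| ≤ q ^ (n + 1) * |z.2.2| := by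
          have : stepLength τ (n + 1) z = τ ((shiftMap τ)^[n] z) := by
            unfold stepLength; rw [Function.iterate_succ_apply']; rfl
          rw [this]
          refine (hcontr _ ih1).trans ?_
          rw [pow_succ', mul_assoc]
          exact mul_le_mul_of_nonneg_left ih2 hq0
        have h2 : |((shiftMap τ)^[n + 1] z).2.1 - z.2.1| * (1 - q) ≤
            |z.2.2| * (1 - q ^ (n + 1)) := by
          have e1 : ((shiftMap τ)^[n + 1] z).2.1 - z.2.1 =
              (((shiftMap τ)^[n] z).2.1 - z.2.1) + stepLength τ n z := by
            rw [Function.iterate_succ_apply']; simp only [shiftMap, stepLength]; ring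
          rw [e1]
          have h3 := abs_add_le (((shiftMap τ)^[n] z).2.1 - z.2.1) (stepLength τ n z)
          calc _ ≤ (|((shiftMap τ)^[n] z).2.1 - z.2.1| + q ^ n * |z.2.2|) * (1 - q) := by
                apply mul_le_mul_of_nonneg_right _ (by linarith); linarith
            _ ≤ |z.2.2| * (1 - q ^ n) + q ^ n * |z.2.2| * (1 - q) := by
                rw [add_mul]; linarith
            _ = _ := by ring
        refine ⟨hmem.2 ⟨?_, ?_, ?_⟩, h1, h2⟩
        · rw [shiftMap_iterate_fst]; exact he.trans_le hε'ε
        · have hqn : 0 ≤ q ^ (n + 1) := pow_nonneg hq0 _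
          have h4 : |((shiftMap τ)^[n + 1] z).2.1 - z.2.1| * (1 - q) ≤ ε' := by
            refine h2.trans ?_
            have : |z.2.2| * (1 - q ^ (n + 1)) ≤ |z.2.2| * 1 := by gcongr; linarith
            linarith
          have h5 : |((shiftMap τ)^[n + 1] z).2.1 - z.2.1| ≤ ε / 2 := by
            rw [hε'] at h4
            have : 0 < 1 - q := by linarith
            by_contra hcon
            push Not at hcon
            nlinarith
          have h6 := abs_add_le (((shiftMap τ)^[n + 1] z).2.1 - z.2.1) (z.2.1 - σ)
          rw [sub_add_sub_cancel] at h6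
          have h7 : ε' ≤ ε / 2 := by rw [hε']; nlinarith
          linarith
        · have : q ^ (n + 1) ≤ 1 := pow_le_one₀ hq0 hq2.le
          have h3 : q ^ (n + 1) * |z.2.2| ≤ |z.2.2| := mul_le_of_le_one_left (abs_nonneg _) this
          change |stepLength τ (n + 1) z| < ε
          linarith
    exact fun n => ⟨(aux n).1, (aux n).2.1⟩
  -- derivatives of the iterates
  let A : ℝ × ℝ × ℝ → (ℝ × ℝ →L[ℝ] ℝ × ℝ) := fun w =>
    (ContinuousLinearMap.fst ℝ ℝ ℝ + ContinuousLinearMap.snd ℝ ℝ ℝ).prod (F' w)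
  let L : ℕ → ℝ × ℝ × ℝ → (ℝ × ℝ →L[ℝ] ℝ × ℝ) := fun n z =>
    Nat.rec (.id ℝ (ℝ × ℝ)) (fun n Ln => A ((shiftMap τ)^[n] z) ∘L Ln) n
  have hLsucc : ∀ n z, L (n + 1) z = A ((shiftMap τ)^[n] z) ∘L L n z := fun n z => rfl
  have hA : ∀ w ∈ Metric.ball z₀ ε,
      HasFDerivAt (fun p => (shiftMap τ (w.1, p)).2) (A w) w.2 := by
    intro w hw
    exact (hasFDerivAt_fst.add hasFDerivAt_snd).prodMk (hball w hw).1.1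
  have hAc : ∀ w ∈ Metric.ball z₀ ε, ContinuousAt A w := by
    intro w hw
    exact (ContinuousLinearMap.prodₗᵢ ℝ (E := ℝ × ℝ) (F := ℝ) (G := ℝ)
      (𝕜 := ℝ)).continuous.continuousAt.comp
      (f := fun w => (ContinuousLinearMap.fst ℝ ℝ ℝ + ContinuousLinearMap.snd ℝ ℝ ℝ, F' w))
      (continuousAt_const.prodMk (hball w hw).1.2.1)
  have hL : ∀ n, ∀ z ∈ Metric.ball z₀ ε',
      HasFDerivAt (fun p => ((shiftMap τ)^[n] (z.1, p)).2) (L n z) z.2 := by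
    intro n
    induction n with
    | zero => intro z _; exact hasFDerivAt_id _
    | succ n ih =>
      intro z hz
      have h1 := hA _ (horbit z hz n).1
      have h2 := HasFDerivAt.comp (f := fun p => ((shiftMap τ)^[n] (z.1, p)).2)
        (g := fun p => (shiftMap τ (z.1, p)).2) z.2
        (by rw [shiftMap_iterate_fst] at h1; exact h1) (ih z hz)
      refine h2.congr_of_eventuallyEq (Filter.Eventually.of_forall fun p => ?_)
      simp only [Function.iterate_succ_apply', Function.comp]
      have h3 := shiftMap_iterate_fst τ n (z.1, p)
      simp only at h3
      have : (shiftMap τ)^[n] (z.1, p) = (z.1, ((shiftMap τ)^[n] (z.1, p)).2) :=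
        Prod.ext h3 rfl
      rw [← this]
  have hTc : ∀ n, ∀ z ∈ Metric.ball z₀ ε', ContinuousAt ((shiftMap τ)^[n]) z := by
    intro n
    induction n with
    | zero => intro z _; exact continuousAt_id
    | succ n ih =>
      intro z hz
      rw [Function.iterate_succ']
      refine ContinuousAt.comp ?_ (ih z hz)
      exact continuousAt_fst.prodMk (ContinuousAt.prodMk (by fun_prop)
        (hball _ (horbit z hz n).1).1.2.2)
  have hLc : ∀ n, ∀ z ∈ Metric.ball z₀ ε', ContinuousAt (L n) z := by
    intro n
    induction n with
    | zero => intro z _; exact continuousAt_const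
    | succ n ih =>
      intro z hz
      exact ((hAc _ (horbit z hz n).1).comp (hTc n z hz)).clm_comp (ih z hz)
  -- Joint induction. The first component accumulates the second one. The second is multiplied by
  -- less than `q` and receives the first times `F' w (1, 0)`, which by the rate hypothesis is of
  -- the order of the current step, hence of `q ^ n`.
  have hLbound : ∀ n, ∀ z ∈ Metric.ball z₀ ε', ∀ v : ℝ × ℝ,
      |(L n z v).1| * (1 - q₁) ≤ (1 - q₁ + (1 - q₁ ^ n)) * ‖v‖ ∧ |(L n z v).2| ≤ q₁ ^ n * ‖v‖ := by
    intro n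
    induction n with
    | zero =>
      intro z _ v
      have h1 : ‖v.1‖ ≤ ‖v‖ := norm_fst_le v
      have h2 : ‖v.2‖ ≤ ‖v‖ := norm_snd_le v
      rw [Real.norm_eq_abs] at h1 h2
      have h3 : (0 : ℝ) < 1 - q₁ := by linarith
      constructor
      · change |v.1| * (1 - q₁) ≤ _
        have := mul_le_mul_of_nonneg_right h1 h3.le
        simp only [pow_zero]; linarith
      · change |v.2| ≤ _
        simpa using h2
    | succ n ih =>
      intro z hz v
      obtain ⟨ih1, ih2⟩ := ih z hz v
      obtain ⟨ho1, ho2⟩ := horbit z hz n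
      obtain ⟨-, -, hb1, hb2, -⟩ := hball _ ho1
      set w := (shiftMap τ)^[n] z with hw
      have hv := norm_nonneg v
      have h3 : (0 : ℝ) < 1 - q₁ := by linarith
      have hqn1 : q₁ ^ n ≤ 1 := pow_le_one₀ hq₁0 hq₁1.le
      have e1 : (L (n + 1) z v).1 = (L n z v).1 + (L n z v).2 := rfl
      have e2 : (L (n + 1) z v).2 = F' w (L n z v) := rfl
      have e3 : F' w (L n z v) = (L n z v).1 * F' w (1, 0) + (L n z v).2 * F' w (0, 1) := by
        have : L n z v = (L n z v).1 • ((1, 0) : ℝ × ℝ) + (L n z v).2 • ((0, 1) : ℝ × ℝ) := by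
          ext <;> simp
        conv_lhs => rw [this]
        simp only [map_add, map_smul, smul_eq_mul]
      constructor
      · rw [e1]
        have h4 := abs_add_le (L n z v).1 (L n z v).2
        calc |(L n z v).1 + (L n z v).2| * (1 - q₁)
            ≤ (|(L n z v).1| + q₁ ^ n * ‖v‖) * (1 - q₁) := by gcongr; linarith
          _ ≤ (1 - q₁ + (1 - q₁ ^ n)) * ‖v‖ + q₁ ^ n * ‖v‖ * (1 - q₁) := by
              rw [add_mul]; linarith
          _ = _ := by ring
      · rw [e2, e3]
        have ha : |(L n z v).1| ≤ c * ‖v‖ := by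
          have h5 : |(L n z v).1| * (1 - q₁) ≤ (1 - q₁ + 1) * ‖v‖ := by
            refine ih1.trans ?_
            gcongr
            have := pow_nonneg hq₁0 n
            linarith
          have h6 : c * (1 - q₁) = 1 - q₁ + 1 := by
            rw [hc, add_mul, one_mul, one_div, inv_mul_cancel₀ h3.ne']
          have h7 : |(L n z v).1| * (1 - q₁) ≤ c * ‖v‖ * (1 - q₁) := by
            calc _ ≤ (1 - q₁ + 1) * ‖v‖ := h5
              _ = c * ‖v‖ * (1 - q₁) := by rw [← h6]; ring
          exact le_of_mul_le_mul_right h7 h3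
        have hz2 : |z.2.2| ≤ ε := ((hmem.1 hz).2.2.le).trans hε'ε
        have hqq : q ^ n ≤ q₁ ^ n := by
          gcongr; rw [hq₁]; linarith
        have hb : |F' w (1, 0)| ≤ |C| * ε * q₁ ^ n := by
          have h8 : |w.2.2| ≤ q₁ ^ n * ε := by
            refine ho2.trans ?_
            gcongr
          calc _ ≤ C * |w.2.2| := hb2
            _ ≤ |C| * |w.2.2| := by gcongr; exact le_abs_self C
            _ ≤ |C| * (q₁ ^ n * ε) := by gcongr
            _ = _ := by ring
        have h9 := abs_add_le ((L n z v).1 * F' w (1, 0)) ((L n z v).2 * F' w (0, 1))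
        rw [abs_mul, abs_mul] at h9
        refine h9.trans ?_
        calc |(L n z v).1| * |F' w (1, 0)| + |(L n z v).2| * |F' w (0, 1)|
            ≤ (c * ‖v‖) * (|C| * ε * q₁ ^ n) + (q₁ ^ n * ‖v‖) * q := by gcongr
          _ = (|C| * ε * c + q) * (q₁ ^ n * ‖v‖) := by ring
          _ ≤ q₁ * (q₁ ^ n * ‖v‖) := by gcongr; linarith
          _ = _ := by ring
  refine ⟨Metric.ball z₀ ε', Metric.ball_mem_nhds _ hε'pos, Metric.isOpen_ball, q, hq0, hq2,
    fun z hz => ⟨fun n => ⟨(hball _ (horbit z hz n).1).2.2.2.2, (horbit z hz n).2⟩, ?_⟩⟩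
  have hsum : Summable fun n : ℕ => q₁ ^ n := summable_geometric_of_lt_one hq₁0 hq₁1
  have hsumq : Summable fun n : ℕ => q ^ n * ε :=
    (summable_geometric_of_lt_one hq0 hq2).mul_right ε
  let S : ℕ → ℝ × ℝ × ℝ → (ℝ × ℝ →L[ℝ] ℝ) := fun n z => .snd ℝ ℝ ℝ ∘L L n z
  have hSbound : ∀ n, ∀ z ∈ Metric.ball z₀ ε', ‖S n z‖ ≤ q₁ ^ n := fun n z hz =>
    ContinuousLinearMap.opNorm_le_bound _ (pow_nonneg hq₁0 n) fun v => (hLbound n z hz v).2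
  have hstep : ∀ n, ∀ z ∈ Metric.ball z₀ ε', |stepLength τ n z| ≤ q ^ n * ε := by
    intro n z hz
    refine (horbit z hz n).2.trans ?_
    have := pow_nonneg hq0 n
    gcongr
    exact ((hmem.1 hz).2.2.le).trans hε'ε
  have hcS : ContinuousOn (fun z => ∑' n, S n z) (Metric.ball z₀ ε') :=
    continuousOn_tsum (fun n z hz => (continuousAt_const.clm_comp
      (hLc n z hz)).continuousWithinAt) hsum hSbound
  have hcΘ : ContinuousOn (fun z => ∑' n, stepLength τ n z) (Metric.ball z₀ ε') :=
    continuousOn_tsum (fun n z hz => (ContinuousAt.comp (g := fun w : ℝ × ℝ × ℝ => w.2.2)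
      (by fun_prop) (hTc n z hz)).continuousWithinAt) hsumq hstep
  refine ⟨fun w => .fst ℝ ℝ ℝ + ∑' n, S n w, ?_⟩
  filter_upwards [Metric.isOpen_ball.mem_nhds hz] with w hw
  have hnw := Metric.isOpen_ball.mem_nhds hw
  refine ⟨?_, continuousAt_const.add (hcS.continuousAt hnw),
    ContinuousAt.add (by fun_prop) (hcΘ.continuousAt hnw)⟩
  have hfib : ∀ p ∈ Metric.ball ((σ, 0) : ℝ × ℝ) ε', (w.1, p) ∈ Metric.ball z₀ ε' := by
    intro p hp
    have h1 : p ∈ Metric.ball (σ, (0 : ℝ)) ε' ↔ |p.1 - σ| < ε' ∧ |p.2| < ε' := by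
      simp [Metric.mem_ball, Prod.dist_eq, Real.dist_eq]
    exact hmem.2 ⟨(hmem.1 hw).1, (h1.1 hp).1, (h1.1 hp).2⟩
  have hwp : w.2 ∈ Metric.ball ((σ, 0) : ℝ × ℝ) ε' := by
    have h1 := hmem.1 hw
    simp only [Metric.mem_ball, Prod.dist_eq, Real.dist_eq, sub_zero, max_lt_iff]
    exact h1.2
  -- The series of steps is differentiated termwise, with the majorant `q₁ ^ n` for the derivatives.
  have hder := hasFDerivAt_tsum_of_isPreconnected (𝕜 := ℝ) (u := fun n => q₁ ^ n)
    (s := Metric.ball ((σ, 0) : ℝ × ℝ) ε')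
    (f := fun n p => stepLength τ n (w.1, p)) (f' := fun n p => S n (w.1, p)) hsum
    Metric.isOpen_ball (convex_ball _ _).isPreconnected
    (fun n p hp => (hasFDerivAt_snd.comp (g := Prod.snd) p (hL n _ (hfib p hp))))
    (fun n p hp => hSbound n _ (hfib p hp)) hwp
    (Summable.of_norm_bounded hsumq fun n => hstep n _ (hfib _ hwp)) hwp
  exact hasFDerivAt_fst.add hder

end Stable

/-! ### Speeds and their derivatives -/

/-- `speed φ (e, s, t)` is the launch speed of the flight from `(s, 0)` to `(s + t, 0)`. -/
noncomputable def speed (φ : ℝ × ℝ × ℝ → Path01) (q : ℝ × ℝ × ℝ) : ℝ :=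
  q.2.2 * IsFlightFamily.launch φ q

/-- `impact φ (e, s, t)` is the landing speed of the flight from `(s, 0)` to `(s + t, 0)`. -/
noncomputable def impact (φ : ℝ × ℝ × ℝ → Path01) (q : ℝ × ℝ × ℝ) : ℝ :=
  q.2.2 * IsFlightFamily.landing φ q

theorem IsFlightFamily.mono {Φ : ℝ × ℝ × ℝ × ℝ → ℝ} {M e₀ e₁ : ℝ} {φ : ℝ × ℝ × ℝ → Path01}
    (h : IsFlightFamily Φ M e₀ φ) (h1 : 0 < e₁) (h2 : e₁ ≤ e₀) : IsFlightFamily Φ M e₁ φ := by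
  have hsub : box e₁ M ⊆ box e₀ M := fun q hq => by
    rw [mem_box] at hq ⊢
    exact ⟨hq.1.trans_le h2, hq.2⟩
  exact ⟨h.contDiff_field, h.one_le, h.field_zero, h1, h.contDiffOn.mono hsub,
    fun q hq => h.fixed q (hsub hq), fun q hq => h.norm_le q (hsub hq),
    fun q hq => h.unique q (hsub hq), fun e he => h.lip e (he.trans_le h2)⟩

namespace IsFlightFamily

variable {Φ : ℝ × ℝ × ℝ × ℝ → ℝ} {M e₀ : ℝ} {φ : ℝ × ℝ × ℝ → Path01}

theorem contDiffAt_speed (h : IsFlightFamily Φ M e₀ φ) {q : ℝ × ℝ × ℝ} (hq : q ∈ box e₀ M) :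
    ContDiffAt ℝ 1 (speed φ) q :=
  (contDiffAt_snd.snd).mul (h.contDiffOn_launch.contDiffAt ((isOpen_box e₀ M).mem_nhds hq))

theorem contDiffAt_impact (h : IsFlightFamily Φ M e₀ φ) {q : ℝ × ℝ × ℝ} (hq : q ∈ box e₀ M) :
    ContDiffAt ℝ 1 (impact φ) q :=
  (contDiffAt_snd.snd).mul (h.contDiffOn_landing.contDiffAt ((isOpen_box e₀ M).mem_nhds hq))

theorem speed_zero (h : IsFlightFamily Φ M e₀ φ) {s t : ℝ} (hs : |s| < M) (ht : |t| < M) :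
    speed φ (0, s, t) = t * ((s ^ 2 - 1) / 2 + s * t / 3 + t ^ 2 / 12) := by
  rw [speed, h.launch_zero hs ht]

theorem impact_zero (h : IsFlightFamily Φ M e₀ φ) {s t : ℝ} (hs : |s| < M) (ht : |t| < M) :
    impact φ (0, s, t) = t * ((s ^ 2 - 1) / 2 + 2 * s * t / 3 + t ^ 2 / 4) := by
  rw [impact, h.landing_zero hs ht]

/-- The partial derivative of `speed` in `t`. -/
theorem hasDerivAt_speed (h : IsFlightFamily Φ M e₀ φ) {e s t : ℝ} (hq : (e, s, t) ∈ box e₀ M) :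
    HasDerivAt (fun t => speed φ (e, s, t)) (fderiv ℝ (speed φ) (e, s, t) (0, 0, 1)) t := by
  have h1 := ((h.contDiffAt_speed hq).differentiableAt one_ne_zero).hasFDerivAt
  have h2 : HasDerivAt (fun t : ℝ => ((e, s, t) : ℝ × ℝ × ℝ)) (0, 0, 1) t :=
    (hasDerivAt_const _ _).prodMk ((hasDerivAt_const _ _).prodMk (hasDerivAt_id _))
  exact h1.comp_hasDerivAt t h2

theorem continuousAt_fderiv_speed (h : IsFlightFamily Φ M e₀ φ) {q : ℝ × ℝ × ℝ}
    (hq : q ∈ box e₀ M) (v : ℝ × ℝ × ℝ) : ContinuousAt (fun q => fderiv ℝ (speed φ) q v) q :=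
  ((h.contDiffAt_speed hq).fderiv_right (m := 0) (by simp)).continuousAt.clm_apply
    continuousAt_const

/-- This is the same polynomial as in `landing_zero`: at `e = 0` the launch speed increases with the
duration exactly where the landing is transverse. -/
theorem fderiv_speed_zero (h : IsFlightFamily Φ M e₀ φ) {s t : ℝ} (hs : |s| < M) (ht : |t| < M) :
    fderiv ℝ (speed φ) (0, s, t) (0, 0, 1) = (s ^ 2 - 1) / 2 + 2 * s * t / 3 + t ^ 2 / 4 := by
  have hq : ((0 : ℝ), s, t) ∈ box e₀ M := mem_box.2 ⟨by simpa using h.e₀_pos, hs, ht⟩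
  have h1 := h.hasDerivAt_speed hq
  have h2 : HasDerivAt (fun t => t * ((s ^ 2 - 1) / 2 + s * t / 3 + t ^ 2 / 12))
      ((s ^ 2 - 1) / 2 + 2 * s * t / 3 + t ^ 2 / 4) t := by
    have := ((hasDerivAt_id t).mul_const ((s ^ 2 - 1) / 2)).add
      (((hasDerivAt_pow 2 t).mul_const (s / 3)).add ((hasDerivAt_pow 3 t).div_const 12))
    refine (this.congr_deriv (by norm_num; ring)).congr_of_eventuallyEq (.of_forall fun x => ?_)
    simp only [Pi.add_apply, id]; ring
  refine h1.unique (h2.congr_of_eventuallyEq ?_)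
  filter_upwards [(isOpen_lt continuous_abs continuous_const).mem_nhds ht] with x hx
  exact h.speed_zero hs hx

end IsFlightFamily

/-! ### The next flight -/

open Classical in
/-- `duration φ M (e, s, w)` is the duration of the flight from `(s, 0)` with launch speed `w`. -/
noncomputable def duration (φ : ℝ × ℝ × ℝ → Path01) (M : ℝ) (z : ℝ × ℝ × ℝ) : ℝ :=
  if h : ∃ t ∈ Ioo (-1 / 2) (M - 1), speed φ (z.1, z.2.1, t) = z.2.2 then h.choose else 0

/-- The duration of the flight after the one from `(s, 0)` to `(s + t, 0)`; the restitution rule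
is `w ↦ w * k (e, w)`. -/
noncomputable def nextDuration (φ : ℝ × ℝ × ℝ → Path01) (M : ℝ) (k : ℝ × ℝ → ℝ)
    (z : ℝ × ℝ × ℝ) : ℝ :=
  duration φ M (z.1, z.2.1 + z.2.2, impact φ z * k (z.1, impact φ z))

/-- A flight family together with a restitution rule `w ↦ w * k (e, w)`. -/
structure IsScaledFamily (Φ : ℝ × ℝ × ℝ × ℝ → ℝ) (k : ℝ × ℝ → ℝ) (r M e₀ : ℝ)
    (φ : ℝ × ℝ × ℝ → Path01) : Prop where
  flight : IsFlightFamily Φ M e₀ φ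
  seven_le : 7 ≤ M
  r_pos : 0 < r
  r_lt_one : r < 1
  continuous_factor : Continuous k
  factor_zero : ∀ w, k (0, w) = r
  factor_pos : ∀ e > 0, ∀ w > 0, 0 < k (e, w)
  fiberC1 : ∀ w, FiberC1At (fun z : ℝ × ℝ => z.2 * k z) (0, w)
  speed_deriv_pos : ∀ e s t, |e| < e₀ → s ∈ Icc (5 / 2) (M - 1) → t ∈ Icc (-1 / 2) (M - 1) →
    0 < fderiv ℝ (speed φ) (e, s, t) (0, 0, 1)
  landing_pos : ∀ e s t, |e| < e₀ → s ∈ Icc (5 / 2) (M - 1) → t ∈ Icc (-1 / 2) (M - 1) →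
    0 < IsFlightFamily.landing φ (e, s, t)

/-- Both sign conditions concern the same polynomial at `e = 0`, positive for `s ≥ 5/2` and `t ≥
-1/2`. Compactness of the window extends them to small `e`. -/
theorem exists_isScaledFamily {Φ : ℝ × ℝ × ℝ × ℝ → ℝ} {k : ℝ × ℝ → ℝ} {r M : ℝ}
    (hΦ : ContDiff ℝ 1 Φ) (h0 : ∀ s X Y, Φ (0, s, X, Y) = 1 - s ^ 2) (hM : 7 ≤ M)
    (hr : 0 < r) (hr1 : r < 1) (hk : Continuous k) (hk0 : ∀ w, k (0, w) = r)
    (hkpos : ∀ e > 0, ∀ w > 0, 0 < k (e, w))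
    (hk1 : ∀ w, FiberC1At (fun z : ℝ × ℝ => z.2 * k z) (0, w)) :
    ∃ e₀ > 0, ∃ φ, IsScaledFamily Φ k r M e₀ φ := by
  obtain ⟨e₀, he₀, φ, h⟩ := exists_flightFamily hΦ h0 (M := M) (by linarith)
  set K : Set (ℝ × ℝ) := Icc (5 / 2) (M - 1) ×ˢ Icc (-1 / 2) (M - 1)
  have hK : IsCompact K := isCompact_Icc.prod isCompact_Icc
  have hloc : ∀ p ∈ K, ∀ᶠ z : (ℝ × ℝ) × ℝ in 𝓝 (p, 0),
      0 < fderiv ℝ (speed φ) (z.2, z.1) (0, 0, 1) ∧ 0 < IsFlightFamily.landing φ (z.2, z.1) := by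
    rintro ⟨s, t⟩ ⟨⟨hs1, hs2⟩, ht1, ht2⟩
    simp only at hs1 hs2 ht1 ht2
    have hs : |s| < M := abs_lt.2 ⟨by linarith, by linarith⟩
    have ht : |t| < M := abs_lt.2 ⟨by linarith, by linarith⟩
    have hq : ((0 : ℝ), s, t) ∈ box e₀ M := mem_box.2 ⟨by simpa using he₀, hs, ht⟩
    have hpos : 0 < (s ^ 2 - 1) / 2 + 2 * s * t / 3 + t ^ 2 / 4 := by
      nlinarith [mul_nonneg (by linarith : (0 : ℝ) ≤ s - 5 / 2) (by linarith : (0 : ℝ) ≤ t + 1 / 2)]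
    have hsw : ContinuousAt (fun z : (ℝ × ℝ) × ℝ => (z.2, z.1)) ((s, t), 0) := by fun_prop
    have c1 := (h.continuousAt_fderiv_speed hq (0, 0, 1)).eventually_const_lt
      (u := 0) (by simpa only [h.fderiv_speed_zero hs ht] using hpos)
    have c2 : ∀ᶠ z in 𝓝 ((0 : ℝ), s, t), 0 < IsFlightFamily.landing φ z :=
      ((h.contDiffOn_landing.contDiffAt ((isOpen_box e₀ M).mem_nhds hq)).continuousAt).eventually_const_lt
      (by rw [h.landing_zero hs ht]; exact hpos)
    exact (hsw.eventually c1).and (hsw.eventually c2)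
  have := hK.eventually_forall_of_forall_eventually (x₀ := (0 : ℝ))
    (P := fun e p => 0 < fderiv ℝ (speed φ) (e, p) (0, 0, 1) ∧
      0 < IsFlightFamily.landing φ (e, p)) (fun p hp => by
        have hsw : ContinuousAt (fun z : ℝ × ℝ × ℝ => (z.2, z.1)) (0, p) := by fun_prop
        exact hsw.eventually (hloc p hp))
  obtain ⟨e₁, he₁, hball⟩ := Metric.eventually_nhds_iff_ball.1 this
  refine ⟨min e₀ e₁, lt_min he₀ he₁, φ, h.mono (lt_min he₀ he₁) (min_le_left _ _), hM, hr, hr1,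
    hk, hk0, hkpos, hk1, fun e s t he hs ht => ?_, fun e s t he hs ht => ?_⟩
  · exact (hball e (by simpa using he.trans_le (min_le_right _ _)) (s, t) ⟨hs, ht⟩).1
  · exact (hball e (by simpa using he.trans_le (min_le_right _ _)) (s, t) ⟨hs, ht⟩).2

namespace IsScaledFamily

variable {Φ : ℝ × ℝ × ℝ × ℝ → ℝ} {k : ℝ × ℝ → ℝ} {r M e₀ : ℝ} {φ : ℝ × ℝ × ℝ → Path01}

theorem mem_box_of_window (h : IsScaledFamily Φ k r M e₀ φ) {e s t : ℝ} (he : |e| < e₀)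
    (hs : s ∈ Icc (5 / 2) (M - 1)) (ht : t ∈ Icc (-1 / 2) (M - 1)) : (e, s, t) ∈ box e₀ M := by
  have := h.seven_le
  exact mem_box.2 ⟨he, abs_lt.2 ⟨by linarith [hs.1], by linarith [hs.2]⟩,
    abs_lt.2 ⟨by linarith [ht.1], by linarith [ht.2]⟩⟩

theorem strictMonoOn_speed (h : IsScaledFamily Φ k r M e₀ φ) {e s : ℝ} (he : |e| < e₀)
    (hs : s ∈ Icc (5 / 2) (M - 1)) :
    StrictMonoOn (fun t => speed φ (e, s, t)) (Icc (-1 / 2) (M - 1)) := by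
  have hd := fun t ht => h.flight.hasDerivAt_speed (h.mem_box_of_window he hs (t := t) ht)
  refine strictMonoOn_of_deriv_pos (convex_Icc _ _)
    (fun t ht => (hd t ht).continuousAt.continuousWithinAt) fun t ht => ?_
  rw [interior_Icc] at ht
  rw [(hd t (Ioo_subset_Icc_self ht)).deriv]
  exact h.speed_deriv_pos e s t he hs (Ioo_subset_Icc_self ht)

/-- On the window the launch speed is strictly increasing in the duration, so the choice in
`duration` is forced. The window extends below `0` so that rest, `t = 0`, is an interior point. -/
theorem duration_eq (h : IsScaledFamily Φ k r M e₀ φ) {e s t w : ℝ} (he : |e| < e₀)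
    (hs : s ∈ Icc (5 / 2) (M - 1)) (ht : t ∈ Ioo (-1 / 2) (M - 1)) (hw : speed φ (e, s, t) = w) :
    duration φ M (e, s, w) = t := by
  have hex : ∃ t ∈ Ioo (-1 / 2) (M - 1), speed φ (e, s, t) = w := ⟨t, ht, hw⟩
  rw [duration, dif_pos hex]
  have hc := hex.choose_spec
  exact (h.strictMonoOn_speed he hs).injOn (Ioo_subset_Icc_self hc.1) (Ioo_subset_Icc_self ht)
    (hc.2.trans hw.symm)

/-- Implicit function theorem for `speed (e, s, t) = w`, whose derivative in `t` is positive.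
Uniqueness in the window identifies the chosen solution with the implicit function. -/
theorem contDiffAt_duration (h : IsScaledFamily Φ k r M e₀ φ) {e s t w : ℝ} (he : |e| < e₀)
    (hs : s ∈ Ioo (5 / 2) (M - 1)) (ht : t ∈ Ioo (-1 / 2) (M - 1)) (hw : speed φ (e, s, t) = w) :
    ContDiffAt ℝ 1 (duration φ M) (e, s, w) ∧ ∀ᶠ z in 𝓝 (e, s, w),
      duration φ M z ∈ Ioo (-1 / 2) (M - 1) ∧ speed φ (z.1, z.2.1, duration φ M z) = z.2.2 := by
  set U : Set ((ℝ × ℝ × ℝ) × ℝ) :=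
    {y | |y.1.1| < e₀ ∧ y.1.2.1 ∈ Ioo (5 / 2) (M - 1) ∧ y.2 ∈ Ioo (-1 / 2) (M - 1)} with hUdef
  have hU : IsOpen U :=
    (isOpen_lt (f := fun y : (ℝ × ℝ × ℝ) × ℝ => |y.1.1|) (by fun_prop)
      (continuous_const (y := e₀))).inter
      ((isOpen_Ioo.preimage (f := fun y : (ℝ × ℝ × ℝ) × ℝ => y.1.2.1) (by fun_prop)).inter
        (isOpen_Ioo.preimage (f := fun y : (ℝ × ℝ × ℝ) × ℝ => y.2) (by fun_prop)))
  have hb : duration φ M (e, s, w) = t := h.duration_eq he (Ioo_subset_Icc_self hs) ht hw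
  have hq := h.mem_box_of_window he (Ioo_subset_Icc_self hs) (Ioo_subset_Icc_self ht)
  let j : (ℝ × ℝ × ℝ) × ℝ → ℝ × ℝ × ℝ := fun y => (y.1.1, y.1.2.1, y.2)
  let F : (ℝ × ℝ × ℝ) × ℝ → ℝ := fun y => speed φ (j y) - y.1.2.2
  have hF : ContDiffAt ℝ 1 F ((e, s, w), t) :=
    ((h.flight.contDiffAt_speed hq).comp (f := j) ((e, s, w), t)
      (by fun_prop : ContDiff ℝ 1 j).contDiffAt).sub (by fun_prop)
  have hFt : fderiv ℝ F ((e, s, w), t) ∘L .inr ℝ (ℝ × ℝ × ℝ) ℝ =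
      ContinuousLinearMap.toSpanSingleton ℝ (fderiv ℝ (speed φ) (e, s, t) (0, 0, 1)) := by
    have h1 : HasFDerivAt (fun t => F ((e, s, w), t))
        (fderiv ℝ F ((e, s, w), t) ∘L .inr ℝ (ℝ × ℝ × ℝ) ℝ) t :=
      (hF.differentiableAt one_ne_zero).hasFDerivAt.comp t
        (hasFDerivAt_prodMk_right (e, s, w) t)
    exact h1.unique ((h.flight.hasDerivAt_speed hq).sub_const w).hasFDerivAt
  have hpos := h.speed_deriv_pos e s t he (Ioo_subset_Icc_self hs) (Ioo_subset_Icc_self ht)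
  have hinv : (fderiv ℝ F ((e, s, w), t) ∘L .inr ℝ (ℝ × ℝ × ℝ) ℝ).IsInvertible := by
    rw [hFt]
    refine ⟨ContinuousLinearEquiv.unitsEquivAut ℝ (Units.mk0 _ hpos.ne'), ?_⟩
    ext; simp
  have hF0 : F ((e, s, w), t) = 0 := by simp [F, j, hw]
  have key := contDiffAt_of_locally_unique_solution (F := F) hU (b := duration φ M)
    (p := (e, s, w)) (by rw [hb]; exact ⟨he, hs, ht⟩) (by rw [hb]; exact hF)
    (by rw [hb]; exact hinv) (Eventually.of_forall fun q y hy hFy => by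
      rw [hb, hF0] at hFy
      exact h.duration_eq hy.1 (Ioo_subset_Icc_self hy.2.1) hy.2.2 (sub_eq_zero.1 hFy))
  rw [hb, hF0] at key
  refine ⟨key.1, key.2.mono fun z hz => ⟨hz.1.2.2, sub_eq_zero.1 hz.2⟩⟩

/-- At `z = (e, s, t)` the next flight after that from `(s, 0)` to `(s + t, 0)` is well defined,
and its launch speed comes from the restitution rule. -/
structure Regular (φ : ℝ × ℝ × ℝ → Path01) (k : ℝ × ℝ → ℝ) (M e₀ : ℝ) (z : ℝ × ℝ × ℝ) : Prop where
  mem : z ∈ box e₀ M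
  time_mem : z.2.1 + z.2.2 ∈ Ioo (5 / 2) (M - 1)
  next_mem : nextDuration φ M k z ∈ Ioo (-1 / 2) (M - 1)
  speed_next : speed φ (z.1, z.2.1 + z.2.2, nextDuration φ M k z) =
    impact φ z * k (z.1, impact φ z)

theorem Regular.of_speed (h : IsScaledFamily Φ k r M e₀ φ) {z : ℝ × ℝ × ℝ} (hz : z ∈ box e₀ M)
    (h1 : z.2.1 + z.2.2 ∈ Ioo (5 / 2) (M - 1)) {t : ℝ} (ht : t ∈ Ioo (-1 / 2) (M - 1))
    (hs : speed φ (z.1, z.2.1 + z.2.2, t) = impact φ z * k (z.1, impact φ z)) :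
    Regular φ k M e₀ z ∧ nextDuration φ M k z = t := by
  have : nextDuration φ M k z = t :=
    h.duration_eq (mem_box.1 hz).1 (Ioo_subset_Icc_self h1) ht hs
  exact ⟨⟨hz, h1, this ▸ ht, by rw [this, hs]⟩, this⟩

/-- The next flight depends nicely on the data. -/
theorem Regular.fiberC1At (h : IsScaledFamily Φ k r M e₀ φ) {p : ℝ × ℝ}
    (hz : Regular φ k M e₀ (0, p)) :
    FiberC1At (nextDuration φ M k) (0, p) ∧ ∀ᶠ z in 𝓝 ((0 : ℝ), p), Regular φ k M e₀ z := by
  have hbox := (isOpen_box e₀ M).mem_nhds hz.mem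
  have himp : FiberC1At (impact φ) (0, p) := FiberC1At.of_contDiffAt (h.flight.contDiffAt_impact hz.mem)
  have hρ : FiberC1At (fun z : ℝ × ℝ × ℝ => impact φ z * k (z.1, impact φ z)) (0, p) :=
    FiberC1At.comp (F := fun z : ℝ × ℝ => z.2 * k z) (h.fiberC1 _) himp
  have hsum : FiberC1At (fun z : ℝ × ℝ × ℝ => z.2.1 + z.2.2) (0, p) :=
    FiberC1At.of_contDiffAt (by fun_prop)
  have hdur := h.contDiffAt_duration (e := 0) (mem_box.1 hz.mem).1 hz.time_mem hz.next_mem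
    hz.speed_next
  have hin := hsum.prodMk hρ
  have hfib : FiberC1At (nextDuration φ M k) (0, p) :=
    FiberC1At.comp (F := duration φ M) (FiberC1At.of_contDiffAt hdur.1) hin
  refine ⟨hfib, ?_⟩
  have hpair : ContinuousAt (fun z : ℝ × ℝ × ℝ =>
      (z.1, z.2.1 + z.2.2, impact φ z * k (z.1, impact φ z))) (0, p) :=
    continuousAt_fst.prodMk hin.continuousAt
  filter_upwards [hbox, hsum.continuousAt.eventually (isOpen_Ioo.mem_nhds hz.time_mem),
    hpair.eventually hdur.2] with z hz1 hz2 hz3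
  exact ⟨hz1, hz2, hz3.1, hz3.2⟩

theorem speed_time_zero (φ : ℝ × ℝ × ℝ → Path01) (e s : ℝ) : speed φ (e, s, 0) = 0 := by
  simp [speed]

theorem impact_time_zero (φ : ℝ × ℝ × ℝ → Path01) (e s : ℝ) : impact φ (e, s, 0) = 0 := by
  simp [impact]

theorem regular_time_zero (h : IsScaledFamily Φ k r M e₀ φ) {e s : ℝ} (he : |e| < e₀)
    (hs : s ∈ Ioo (5 / 2) (M - 1)) :
    Regular φ k M e₀ (e, s, 0) ∧ nextDuration φ M k (e, s, 0) = 0 := by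
  have hM := h.seven_le
  have h0 : (0 : ℝ) ∈ Ioo (-1 / 2) (M - 1) := ⟨by norm_num, by linarith⟩
  refine Regular.of_speed h (h.mem_box_of_window he (Ioo_subset_Icc_self hs)
    (Ioo_subset_Icc_self h0)) (by simpa using hs) h0 ?_
  simp [impact_time_zero, speed_time_zero]

/-- A positive landing speed rebounds to a positive launch speed, and launch speeds increase with
the duration from the value `0` at `t = 0`. -/
theorem Regular.nextDuration_pos (h : IsScaledFamily Φ k r M e₀ φ) {e s t : ℝ}
    (hz : Regular φ k M e₀ (e, s, t)) (he : 0 < e) (ht : 0 < impact φ (e, s, t)) :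
    0 < nextDuration φ M k (e, s, t) := by
  have hM := h.seven_le
  have hp : 0 < impact φ (e, s, t) * k (e, impact φ (e, s, t)) :=
    mul_pos ht (h.factor_pos e he _ ht)
  have h1 := hz.speed_next
  simp only at h1
  rw [← h1, ← speed_time_zero φ e (s + t)] at hp
  exact ((h.strictMonoOn_speed (mem_box.1 hz.mem).1 (Ioo_subset_Icc_self hz.time_mem)).lt_iff_lt
    ⟨by norm_num, by linarith⟩ (Ioo_subset_Icc_self hz.next_mem)).1 hp

/-- At the unperturbed parameter the duration of flights contracts with factor `r` near `t = 0`. -/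
theorem slope_nextDuration (h : IsScaledFamily Φ k r M e₀ φ) {σ : ℝ}
    (hσ : σ ∈ Ioo (5 / 2) (M - 1)) :
    fderiv ℝ (fun p => nextDuration φ M k (0, p)) (σ, 0) (0, 1) = r := by
  have hM := h.seven_le
  have h0 : |(0 : ℝ)| < e₀ := by simpa using h.flight.e₀_pos
  obtain ⟨hreg, hn0⟩ := h.regular_time_zero h0 hσ
  obtain ⟨hfib, hev⟩ := hreg.fiberC1At h
  have hd := hfib.differentiableAt.hasFDerivAt
  simp only at hd
  have h1 : HasDerivAt (fun t : ℝ => nextDuration φ M k (0, σ, t))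
      (fderiv ℝ (fun p => nextDuration φ M k (0, p)) (σ, 0) (0, 1)) 0 :=
    hd.comp_hasDerivAt 0 ((hasDerivAt_const _ _).prodMk (hasDerivAt_id _))
  set d := fderiv ℝ (fun p => nextDuration φ M k (0, p)) (σ, 0) (0, 1)
  set g := fun t : ℝ => nextDuration φ M k (0, σ, t) with hg
  have hg0 : g 0 = 0 := hn0
  -- Both sides of the restitution equation are differentiated at `t = 0`. As `g 0 = 0`, only the
  -- common factor `(σ² - 1) / 2` survives, and it cancels.
  have hL : HasDerivAt (fun t => g t * (((σ + t) ^ 2 - 1) / 2 + (σ + t) * g t / 3 + g t ^ 2 / 12))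
      (d * ((σ ^ 2 - 1) / 2)) 0 := by
    have h2 : HasDerivAt (fun t : ℝ => σ + t) 1 0 := (hasDerivAt_id 0).const_add σ
    have := h1.mul (((((h2.pow 2).sub_const 1).div_const 2).add ((h2.mul h1).div_const 3)).add
      ((h1.pow 2).div_const 12))
    refine this.congr_deriv ?_
    simp [hg0]
  have hR : HasDerivAt (fun t => (t * ((σ ^ 2 - 1) / 2 + 2 * σ * t / 3 + t ^ 2 / 4)) * r)
      ((σ ^ 2 - 1) / 2 * r) 0 := by
    have h2 : HasDerivAt (fun t : ℝ => t) 1 0 := hasDerivAt_id 0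
    have := (h2.mul (((h2.const_mul (2 * σ)).div_const 3).const_add ((σ ^ 2 - 1) / 2) |>.add
      ((h2.pow 2).div_const 4))).mul_const r
    refine this.congr_deriv ?_
    simp
  have hLR : (fun t => g t * (((σ + t) ^ 2 - 1) / 2 + (σ + t) * g t / 3 + g t ^ 2 / 12)) =ᶠ[𝓝 0]
      fun t => (t * ((σ ^ 2 - 1) / 2 + 2 * σ * t / 3 + t ^ 2 / 4)) * r := by
    have hc : ContinuousAt (fun t : ℝ => ((0 : ℝ), σ, t)) 0 := by fun_prop
    filter_upwards [hc.eventually hev] with t ht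
    have h2 := ht.speed_next
    obtain ⟨-, hs, ht'⟩ := mem_box.1 ht.mem
    have h3 := ht.next_mem
    have h4 := ht.time_mem
    simp only at h2 hs ht' h4
    rw [h.flight.speed_zero (abs_lt.2 ⟨by linarith [h4.1], by linarith [h4.2]⟩)
      (abs_lt.2 ⟨by linarith [h3.1], by linarith [h3.2]⟩), h.factor_zero,
      h.flight.impact_zero hs ht'] at h2
    exact h2
  have h5 := (hL.congr_of_eventuallyEq hLR.symm).unique hR
  have h6 : 0 < (σ ^ 2 - 1) / 2 := by nlinarith [hσ.1]
  have h7 : (σ ^ 2 - 1) / 2 * d = (σ ^ 2 - 1) / 2 * r := by linarith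
  exact mul_left_cancel₀ h6.ne' h7

end IsScaledFamily

theorem ContinuousAt.eventually_abs_lt {X : Type*} [TopologicalSpace X] {f : X → ℝ} {x : X}
    (hf : ContinuousAt f x) : ∀ᶠ y in 𝓝 x, |f y| < |f x| + 1 :=
  hf.abs.eventually_lt continuousAt_const (by linarith)

/-- Differentiation in the starting time leaves the factor duration in place. This is the source of
the rate in `rate_nextDuration`. -/
theorem fderiv_mul_time {α : ℝ × ℝ × ℝ → ℝ} {q : ℝ × ℝ × ℝ} (h : ContDiffAt ℝ 1 α q) :
    fderiv ℝ (fun q => q.2.2 * α q) q (0, 1, 0) = q.2.2 * fderiv ℝ α q (0, 1, 0) := by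
  have h1 : HasFDerivAt (fun q : ℝ × ℝ × ℝ => q.2.2)
      (ContinuousLinearMap.snd ℝ ℝ ℝ ∘L .snd ℝ ℝ (ℝ × ℝ)) q :=
    (ContinuousLinearMap.snd ℝ ℝ ℝ ∘L .snd ℝ ℝ (ℝ × ℝ)).hasFDerivAt
  have h2 := h1.mul (h.differentiableAt one_ne_zero).hasFDerivAt
  have h3 : fderiv ℝ (fun q => q.2.2 * α q) q = _ := HasFDerivAt.fderiv h2
  rw [h3]
  simp

namespace IsScaledFamily

variable {Φ : ℝ × ℝ × ℝ × ℝ → ℝ} {k : ℝ × ℝ → ℝ} {r M e₀ : ℝ} {φ : ℝ × ℝ × ℝ → Path01}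

/-- Differentiating the restitution equation in the starting time expresses the derivative through
terms that carry a factor `t` or the next duration, and the next duration is itself `O(t)`. The
coefficient `V` to divide by exceeds `1`. -/
theorem rate_nextDuration (h : IsScaledFamily Φ k r M e₀ φ) {σ : ℝ}
    (hσ : σ ∈ Ioo (5 / 2) (M - 1)) :
    ∃ C, ∀ᶠ z : ℝ × ℝ × ℝ in 𝓝 (0, σ, 0),
      |fderiv ℝ (fun p => nextDuration φ M k (z.1, p)) z.2 (1, 0)| ≤ C * |z.2.2| := by
  have hM := h.seven_le
  have h0 : |(0 : ℝ)| < e₀ := by simpa using h.flight.e₀_pos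
  obtain ⟨hreg, hn0⟩ := h.regular_time_zero h0 hσ
  obtain ⟨hfib, hev⟩ := hreg.fiberC1At h
  obtain ⟨ρ', hρ'⟩ := h.fiberC1 0
  set z₀ : ℝ × ℝ × ℝ := (0, σ, 0)
  have hbox : z₀ ∈ box e₀ M := hreg.mem
  have hopen := isOpen_box e₀ M
  have hσM : |σ| < M := (mem_box.1 hbox).2.1
  have h0M : |(0 : ℝ)| < M := (mem_box.1 hbox).2.2
  let N : ℝ × ℝ × ℝ → ℝ × ℝ × ℝ := fun z => (z.1, z.2.1 + z.2.2, nextDuration φ M k z)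
  have hN : ContinuousAt N z₀ := continuousAt_fst.prodMk
    (ContinuousAt.prodMk (by fun_prop) hfib.continuousAt)
  have hN0 : N z₀ = z₀ := by simp [N, z₀, hn0]
  have himp : ContinuousAt (impact φ) z₀ := (h.flight.contDiffAt_impact hbox).continuousAt
  have hR : ContinuousAt (fun z => (z.1, impact φ z)) z₀ := continuousAt_fst.prodMk himp
  have hR0 : (z₀.1, impact φ z₀) = (0, 0) := by simp [z₀, impact_time_zero]
  have hlaunch := h.flight.contDiffOn_launch.contDiffAt (hopen.mem_nhds hbox)
  have hland := h.flight.contDiffOn_landing.contDiffAt (hopen.mem_nhds hbox)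
  have c1 : ContinuousAt (fun z => fderiv ℝ (IsFlightFamily.launch φ) (N z) (0, 1, 0)) z₀ :=
    ContinuousAt.comp (g := fun z => fderiv ℝ (IsFlightFamily.launch φ) z (0, 1, 0)) (f := N)
      (hN0.symm ▸ (hlaunch.fderiv_right (m := 0) (by simp)).continuousAt.clm_apply
        continuousAt_const) hN
  have c2 : ContinuousAt (fun z => fderiv ℝ (IsFlightFamily.landing φ) z (0, 1, 0)) z₀ :=
    (hland.fderiv_right (m := 0) (by simp)).continuousAt.clm_apply continuousAt_const
  have c3 : ContinuousAt (fun z => k (z.1, impact φ z)) z₀ :=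
    h.continuous_factor.continuousAt.comp hR
  have c4 : ContinuousAt (fun z => ρ' (z.1, impact φ z) 1) z₀ :=
    ContinuousAt.comp (g := fun z => ρ' z 1) (f := fun z => (z.1, impact φ z))
      (hR0.symm ▸ hρ'.self_of_nhds.2.1.clm_apply continuousAt_const) hR
  have c5 : ContinuousAt (fun z => fderiv ℝ (speed φ) (N z) (0, 0, 1)) z₀ :=
    ContinuousAt.comp (g := fun z => fderiv ℝ (speed φ) z (0, 0, 1)) (f := N)
      (hN0.symm ▸ h.flight.continuousAt_fderiv_speed hbox _) hN
  have c6 : ContinuousAt (fun z => IsFlightFamily.launch φ (N z)) z₀ :=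
    ContinuousAt.comp (g := IsFlightFamily.launch φ) (f := N) (hN0.symm ▸ hlaunch.continuousAt) hN
  have hpos : 1 < (σ ^ 2 - 1) / 2 := by nlinarith [hσ.1]
  have e5 : ∀ᶠ z in 𝓝 z₀, 1 < fderiv ℝ (speed φ) (N z) (0, 0, 1) :=
    c5.eventually_const_lt (by
      beta_reduce
      rw [hN0, h.flight.fderiv_speed_zero hσM h0M]; linarith)
  have e6 : ∀ᶠ z in 𝓝 z₀, 1 < IsFlightFamily.launch φ (N z) :=
    c6.eventually_const_lt (by
      beta_reduce
      rw [hN0, h.flight.launch_zero hσM h0M]; linarith)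
  obtain ⟨B, hB⟩ : ∃ B : ℝ, ∀ᶠ z in 𝓝 z₀,
      |fderiv ℝ (IsFlightFamily.launch φ) (N z) (0, 1, 0)| ≤ B ∧
      |fderiv ℝ (IsFlightFamily.landing φ) z (0, 1, 0)| ≤ B ∧
      |k (z.1, impact φ z)| ≤ B ∧ |ρ' (z.1, impact φ z) 1| ≤ B ∧
      |IsFlightFamily.landing φ z| ≤ B := by
    have hb := ((ContinuousAt.eventually_abs_lt c1).and ((ContinuousAt.eventually_abs_lt c2).and
      ((ContinuousAt.eventually_abs_lt c3).and ((ContinuousAt.eventually_abs_lt c4).and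
      (ContinuousAt.eventually_abs_lt hland.continuousAt)))))
    set b1 := |fderiv ℝ (IsFlightFamily.launch φ) (N z₀) (0, 1, 0)|
    set b2 := |fderiv ℝ (IsFlightFamily.landing φ) z₀ (0, 1, 0)|
    set b3 := |k (z₀.1, impact φ z₀)|
    set b4 := |ρ' (z₀.1, impact φ z₀) 1|
    set b5 := |IsFlightFamily.landing φ z₀|
    have n1 : 0 ≤ b1 := abs_nonneg _
    have n2 : 0 ≤ b2 := abs_nonneg _
    have n3 : 0 ≤ b3 := abs_nonneg _
    have n4 : 0 ≤ b4 := abs_nonneg _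
    have n5 : 0 ≤ b5 := abs_nonneg _
    refine ⟨b1 + b2 + b3 + b4 + b5 + 1, hb.mono fun z hz => ?_⟩
    obtain ⟨z1, z2, z3, z4, z5⟩ := hz
    exact ⟨by linarith, by linarith, by linarith, by linarith, by linarith⟩
  refine ⟨B * B * B + B * B, ?_⟩
  filter_upwards [hev.eventually_nhds, hfib.eventually, e5, e6, hB,
    hR.eventually (hR0.symm ▸ hρ'), hN.eventually (hN0.symm ▸ hopen.mem_nhds hbox)]
    with z hzreg hzfib h5 h6 hzB hzρ hzN
  obtain ⟨e, s, t⟩ := z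
  obtain ⟨B1, B2, B3, B4, B5⟩ := hzB
  have hB0 : 0 ≤ B := (abs_nonneg _).trans B1
  have hz := hzreg.self_of_nhds
  set d := fderiv ℝ (fun p => nextDuration φ M k (e, p)) (s, t) (1, 0) with hdd
  set g := fun s : ℝ => nextDuration φ M k (e, s, t) with hg
  have hline : HasDerivAt (fun s : ℝ => ((s, t) : ℝ × ℝ)) (1, 0) s :=
    (hasDerivAt_id _).prodMk (hasDerivAt_const _ _)
  have hgd : HasDerivAt g d s := by
    have hf := hzfib.differentiableAt.hasFDerivAt
    exact HasFDerivAt.comp_hasDerivAt (l := fun p => nextDuration φ M k (e, p)) s hf hline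
  have hL : HasDerivAt (fun s => speed φ (e, s + t, g s))
      (fderiv ℝ (speed φ) (N (e, s, t)) (0, 1, d)) s := by
    have hs := ((h.flight.contDiffAt_speed hzN).differentiableAt one_ne_zero).hasFDerivAt
    have : HasDerivAt (fun s => ((e, s + t, g s) : ℝ × ℝ × ℝ)) (0, 1, d) s :=
      (hasDerivAt_const _ _).prodMk (((hasDerivAt_id s).add_const t).prodMk hgd)
    exact hs.comp_hasDerivAt s this
  have hI : HasDerivAt (fun s => impact φ (e, s, t))
      (fderiv ℝ (impact φ) (e, s, t) (0, 1, 0)) s := by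
    have hs := ((h.flight.contDiffAt_impact hz.mem).differentiableAt one_ne_zero).hasFDerivAt
    have : HasDerivAt (fun s => ((e, s, t) : ℝ × ℝ × ℝ)) (0, 1, 0) s :=
      (hasDerivAt_const _ _).prodMk ((hasDerivAt_id s).prodMk (hasDerivAt_const _ _))
    exact hs.comp_hasDerivAt s this
  have hRd := HasDerivAt.comp (h₂ := fun w => w * k (e, w)) (h := fun s => impact φ (e, s, t)) s
    hzρ.1.hasDerivAt hI
  have hEq : (fun s => speed φ (e, s + t, g s)) =ᶠ[𝓝 s]
      (fun w => w * k (e, w)) ∘ fun s => impact φ (e, s, t) := by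
    have hc : ContinuousAt (fun s : ℝ => (e, s, t)) s := by fun_prop
    filter_upwards [hc.eventually hzreg] with s' hs'
    exact hs'.speed_next
  have hkey := hL.unique (hRd.congr_of_eventuallyEq hEq)
  have hlaunch' := h.flight.contDiffOn_launch.contDiffAt (hopen.mem_nhds hzN)
  have hland' := h.flight.contDiffOn_landing.contDiffAt (hopen.mem_nhds hz.mem)
  have f1 : fderiv ℝ (speed φ) (N (e, s, t)) (0, 1, 0) =
      g s * fderiv ℝ (IsFlightFamily.launch φ) (N (e, s, t)) (0, 1, 0) := fderiv_mul_time hlaunch'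
  have f2 : fderiv ℝ (impact φ) (e, s, t) (0, 1, 0) =
      t * fderiv ℝ (IsFlightFamily.landing φ) (e, s, t) (0, 1, 0) := fderiv_mul_time hland'
  have f3 : fderiv ℝ (speed φ) (N (e, s, t)) (0, 1, d) =
      fderiv ℝ (speed φ) (N (e, s, t)) (0, 1, 0) +
        d * fderiv ℝ (speed φ) (N (e, s, t)) (0, 0, 1) := by
    have : ((0, 1, d) : ℝ × ℝ × ℝ) = (0, 1, 0) + d • (0, 0, 1) := by simp
    rw [this, map_add, map_smul, smul_eq_mul]
  rw [f3, f1, f2] at hkey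
  have hsp : g s * IsFlightFamily.launch φ (N (e, s, t)) =
      t * IsFlightFamily.landing φ (e, s, t) * k (e, impact φ (e, s, t)) := hz.speed_next
  simp only at B1 B2 B3 B4 B5 h5 h6
  change |d| ≤ _ * |t|
  set V := fderiv ℝ (speed φ) (N (e, s, t)) (0, 0, 1)
  set ls := fderiv ℝ (IsFlightFamily.launch φ) (N (e, s, t)) (0, 1, 0)
  set la := IsFlightFamily.launch φ (N (e, s, t))
  set lb := IsFlightFamily.landing φ (e, s, t)
  set lbs := fderiv ℝ (IsFlightFamily.landing φ) (e, s, t) (0, 1, 0)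
  set kk := k (e, impact φ (e, s, t))
  set ρd := ρ' (e, impact φ (e, s, t)) 1
  have hgB : |g s| ≤ B * B * |t| := by
    have h7 : |g s| * la = |t| * |lb| * |kk| := by
      have := congrArg abs hsp
      rwa [abs_mul, abs_mul, abs_mul, abs_of_pos (by linarith : 0 < la)] at this
    have h8 : |t| * |lb| * |kk| ≤ |t| * B * B := by gcongr
    have h9 : |g s| * 1 ≤ |g s| * la := by gcongr
    linarith
  have hdV : |d| * V ≤ |g s| * |ls| + |ρd| * (|t| * |lbs|) := by
    have h7 : d * V = ρd * (t * lbs) - g s * ls := by linarith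
    have h8 := congrArg abs h7
    rw [abs_mul, abs_of_pos (by linarith : 0 < V)] at h8
    rw [h8]
    refine (abs_sub _ _).trans ?_
    rw [abs_mul, abs_mul, abs_mul]; linarith
  have h7 : |g s| * |ls| ≤ B * B * |t| * B := by gcongr
  have h8 : |ρd| * (|t| * |lbs|) ≤ B * (|t| * B) := by gcongr
  have h9 : |d| * 1 ≤ |d| * V := by gcongr
  linarith

/-- All flights along the orbit of `z` are regular, the orbit converges, and the limit is a nice
function near `z`. -/
structure Convergent (φ : ℝ × ℝ × ℝ → Path01) (k : ℝ × ℝ → ℝ) (M e₀ : ℝ) (z : ℝ × ℝ × ℝ) :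
    Prop where
  regular : ∀ n, Regular φ k M e₀ ((shiftMap (nextDuration φ M k))^[n] z)
  summable : Summable fun n => stepLength (nextDuration φ M k) n z
  fiberC1At : FiberC1At (limitPoint (nextDuration φ M k)) z

theorem shiftMap_iterate_fiberC1At (h : IsScaledFamily Φ k r M e₀ φ) {p : ℝ × ℝ}
    (hreg : ∀ n, Regular φ k M e₀ ((shiftMap (nextDuration φ M k))^[n] (0, p))) (n : ℕ) :
    FiberC1At (fun z => ((shiftMap (nextDuration φ M k))^[n] z).2) (0, p) ∧
      ∀ᶠ z in 𝓝 ((0 : ℝ), p), ∀ i < n, Regular φ k M e₀ ((shiftMap (nextDuration φ M k))^[i] z) := by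
  induction n with
  | zero => exact ⟨FiberC1At.of_contDiffAt (by simpa using contDiffAt_snd), by simp⟩
  | succ n ih =>
    set T := shiftMap (nextDuration φ M k) with hT
    have hfst : ∀ z, (T^[n] z) = (z.1, (T^[n] z).2) := fun z =>
      Prod.ext (shiftMap_iterate_fst _ _ _) rfl
    have hr := hreg n
    rw [hfst] at hr
    obtain ⟨h1, h2⟩ := hr.fiberC1At h
    constructor
    · have h3 : FiberC1At (fun z : ℝ × ℝ × ℝ => (z.2.1 + z.2.2, nextDuration φ M k z))
          (0, (T^[n] (0, p)).2) := (FiberC1At.of_contDiffAt (by fun_prop)).prodMk h1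
      refine (h3.comp ih.1).congr (Eventually.of_forall fun z => ?_)
      simp only [Function.iterate_succ_apply']
      rw [← hfst]; rfl
    · have hc : ContinuousAt (fun z : ℝ × ℝ × ℝ => (z.1, (T^[n] z).2)) (0, p) :=
        continuousAt_fst.prodMk ih.1.continuousAt
      filter_upwards [ih.2, hc.eventually h2] with z hz1 hz2 i hi
      rcases Nat.lt_succ_iff_lt_or_eq.1 hi with hi | rfl
      · exact hz1 i hi
      · rwa [← hfst] at hz2

/-- Orbits close to a regular converging orbit of the unperturbed problem converge. -/
theorem eventually_convergent (h : IsScaledFamily Φ k r M e₀ φ) {p : ℝ × ℝ} {σ : ℝ}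
    (hσ : σ ∈ Ioo (5 / 2) (M - 1))
    (hreg : ∀ n, Regular φ k M e₀ ((shiftMap (nextDuration φ M k))^[n] (0, p)))
    (hlim : Tendsto (fun n => ((shiftMap (nextDuration φ M k))^[n] (0, p)).2) atTop
      (𝓝 (σ, 0))) : ∀ᶠ z in 𝓝 ((0 : ℝ), p), Convergent φ k M e₀ z := by
  have h0 : |(0 : ℝ)| < e₀ := by simpa using h.flight.e₀_pos
  obtain ⟨hreg0, hn0⟩ := h.regular_time_zero h0 hσ
  obtain ⟨hfib, hev⟩ := hreg0.fiberC1At h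
  obtain ⟨C, hC⟩ := h.rate_nextDuration hσ
  have hz0 : ∀ᶠ z : ℝ × ℝ × ℝ in 𝓝 (0, σ, 0), nextDuration φ M k (z.1, z.2.1, 0) = 0 := by
    have c1 : ∀ᶠ z : ℝ × ℝ × ℝ in 𝓝 (0, σ, 0), |z.1| < e₀ :=
      (continuous_fst.abs.continuousAt).eventually_lt continuousAt_const h0
    have c2 : ContinuousAt (fun z : ℝ × ℝ × ℝ => z.2.1) (0, σ, 0) := by fun_prop
    filter_upwards [c1, c2.eventually (isOpen_Ioo.mem_nhds hσ)] with z hz1 hz2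
    exact (h.regular_time_zero hz1 hz2).2
  obtain ⟨U, hU, hUo, q, hq0, hq1, hUz⟩ := exists_limitPoint_fiberC1 hfib hz0
    (by rw [h.slope_nextDuration hσ, abs_of_pos h.r_pos]; exact h.r_lt_one) hC hev
  set T := shiftMap (nextDuration φ M k) with hT
  have hfst : ∀ n z, (T^[n] z) = (z.1, (T^[n] z).2) := fun n z =>
    Prod.ext (shiftMap_iterate_fst _ _ _) rfl
  have hlim' : Tendsto (fun n => T^[n] (0, p)) atTop (𝓝 (0, σ, 0)) := by
    have : (fun n => T^[n] (0, p)) = fun n => ((0 : ℝ), (T^[n] (0, p)).2) := by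
      funext n; exact hfst n _
    rw [this]
    exact tendsto_const_nhds.prodMk_nhds hlim
  -- After `N` steps the unperturbed orbit is in the neighbourhood `U` of its limit where the local
  -- theory applies. The finitely many steps before are handled by continuity.
  obtain ⟨N, hN⟩ := (hlim'.eventually hU).exists
  obtain ⟨hs1, hs2⟩ := h.shiftMap_iterate_fiberC1At hreg N
  have hc : ContinuousAt (T^[N]) (0, p) := by
    have h1 : ContinuousAt (fun z : ℝ × ℝ × ℝ => (z.1, (T^[N] z).2)) (0, p) :=
      continuousAt_fst.prodMk hs1.continuousAt
    refine h1.congr (Eventually.of_forall fun z => (hfst N z).symm)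
  have hev2 : ∀ᶠ z in 𝓝 ((0 : ℝ), p), T^[N] z ∈ U := hc.eventually (hUo.mem_nhds hN)
  have hgood : ∀ᶠ z in 𝓝 ((0 : ℝ), p), (∀ n, Regular φ k M e₀ (T^[n] z)) ∧
      (Summable fun n => stepLength (nextDuration φ M k) n z) ∧
      limitPoint (nextDuration φ M k) z = limitPoint (nextDuration φ M k) (T^[N] z) := by
    filter_upwards [hs2, hev2] with z hz1 hz2
    have hz3 := hUz _ hz2
    have hsum : Summable fun n => stepLength (nextDuration φ M k) n z := by
      rw [← summable_nat_add_iff N]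
      have he : ∀ n, stepLength (nextDuration φ M k) (n + N) z =
          stepLength (nextDuration φ M k) n (T^[N] z) := fun n => by
        unfold stepLength; rw [Function.iterate_add_apply]
      simp only [he]
      exact Summable.of_norm_bounded ((summable_geometric_of_lt_one hq0 hq1).mul_right _)
        fun n => (hz3.1 n).2
    refine ⟨fun n => ?_, hsum, ?_⟩
    · rcases lt_or_ge n N with hn | hn
      · exact hz1 n hn
      · obtain ⟨m, rfl⟩ := Nat.exists_eq_add_of_le' hn
        rw [Function.iterate_add_apply]
        exact (hz3.1 m).1
    · have aux : ∀ n, limitPoint (nextDuration φ M k) (T^[n] z) =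
          limitPoint (nextDuration φ M k) z := by
        intro n
        induction n with
        | zero => rfl
        | succ n ih =>
          rw [Function.iterate_succ_apply', ← ih]
          refine limitPoint_shift ?_
          have he : ∀ m, stepLength (nextDuration φ M k) m (T^[n] z) =
              stepLength (nextDuration φ M k) (m + n) z := fun m => by
            unfold stepLength; rw [Function.iterate_add_apply]
          simp only [he]
          exact (summable_nat_add_iff n).2 hsum
      exact (aux N).symm
  have hfibΘ : FiberC1At (limitPoint (nextDuration φ M k)) (0, p) := by
    have h1 : FiberC1At (limitPoint (nextDuration φ M k)) (0, (T^[N] (0, p)).2) := by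
      have := (hUz _ hN).2
      rwa [hfst] at this
    refine (h1.comp hs1).congr ?_
    filter_upwards [hgood] with z hz
    rw [hz.2.2, hfst]
  filter_upwards [hgood, hfibΘ.eventually] with z hz1 hz2
  exact ⟨hz1.1, hz1.2.1, hz2⟩

end IsScaledFamily

/-! ### Inequalities for the unperturbed equation -/

/-- Launch speed divided by duration for the unperturbed equation `x'' = 1 - time²`. -/
noncomputable def baseLaunch (a t : ℝ) : ℝ := (a ^ 2 - 1) / 2 + a * t / 3 + t ^ 2 / 12

theorem baseLaunch_pos {a t : ℝ} (ha : 3 ≤ a) (ht : 0 ≤ t) : (a ^ 2 - 1) / 2 ≤ baseLaunch a t := by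
  unfold baseLaunch; nlinarith [mul_nonneg (by linarith : 0 ≤ a) ht, sq_nonneg t]

/-- `baseLaunch a (-t)` is landing speed over duration for the flight that lands at time `a`, since
time reversal exchanges launch and landing. The bound on `t` says that the flight starts at time
`-1` or later. -/
theorem baseLaunch_neg_pos {a t : ℝ} (ha : 3 ≤ a) (ht : t ≤ a + 1) : 0 < baseLaunch a (-t) := by
  unfold baseLaunch
  nlinarith [mul_nonneg (by linarith : (0 : ℝ) ≤ a + 1 - t) (by linarith : (0 : ℝ) ≤ 3 * a - 1 - t)]

/-- Cross-multiplied form of the statement that the ratio of `baseLaunch a (-t)` to `baseLaunch a τ`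
does not decrease with `a`. The difference factors through `a' - a` and `t + τ`. -/
theorem baseLaunch_exchange {a a' t τ : ℝ} (ha : 3 ≤ a) (haa : a ≤ a') (ht : 0 ≤ t)
    (hta : t ≤ a + 1) (hτ : 0 ≤ τ) :
    baseLaunch a' τ * baseLaunch a (-t) ≤ baseLaunch a τ * baseLaunch a' (-t) := by
  have h : baseLaunch a τ * baseLaunch a' (-t) - baseLaunch a' τ * baseLaunch a (-t) =
      (a' - a) * ((t + τ) *
        ((a * a' + 1) / 6 + (a + a') * (τ - t) / 24 - τ * t / 36)) := by
    unfold baseLaunch; ring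
  have h1 : 0 ≤ (a * a' + 1) / 6 + (a + a') * (τ - t) / 24 - τ * t / 36 := by
    have e1 : 0 ≤ τ * ((a + a') / 24 - t / 36) := mul_nonneg hτ (by linarith)
    have e2 : (a + a') * t ≤ (a + a') * (a + 1) := by gcongr; linarith
    nlinarith [mul_nonneg (by linarith : 0 ≤ a' - a) (by linarith : 0 ≤ a)]
  have := mul_nonneg (by linarith : 0 ≤ a' - a) (mul_nonneg (by linarith : 0 ≤ t + τ) h1)
  linarith

/-- For a fixed landing time a longer flight lands faster. The divided difference is a positive
definite quadratic up to completing squares, hence the hints. -/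
theorem mul_baseLaunch_neg_mono {a t t' : ℝ} (ha : 3 ≤ a) (htt : t ≤ t') :
    t * baseLaunch a (-t) ≤ t' * baseLaunch a (-t') := by
  have h : t' * baseLaunch a (-t') - t * baseLaunch a (-t) =
      (t' - t) * ((a ^ 2 - 1) / 2 - a * (t + t') / 3 + (t ^ 2 + t * t' + t' ^ 2) / 12) := by
    unfold baseLaunch; ring
  have h1 : 0 ≤ (a ^ 2 - 1) / 2 - a * (t + t') / 3 + (t ^ 2 + t * t' + t' ^ 2) / 12 := by
    nlinarith [sq_nonneg (3 * (t + t') - 8 * a), sq_nonneg (t - t')]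
  have := mul_nonneg (by linarith : 0 ≤ t' - t) h1
  linarith

theorem mul_baseLaunch_strictMono {a t t' : ℝ} (ha : 3 ≤ a) (ht : 0 ≤ t) (htt : t < t') :
    t * baseLaunch a t < t' * baseLaunch a t' := by
  have h : t' * baseLaunch a t' - t * baseLaunch a t =
      (t' - t) * ((a ^ 2 - 1) / 2 + a * (t + t') / 3 + (t ^ 2 + t * t' + t' ^ 2) / 12) := by
    unfold baseLaunch; ring
  have h1 : 0 < (a ^ 2 - 1) / 2 + a * (t + t') / 3 + (t ^ 2 + t * t' + t' ^ 2) / 12 := by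
    have e1 : 0 ≤ a * (t + t') := mul_nonneg (by linarith) (by linarith)
    have e2 : 0 ≤ t * t' := mul_nonneg ht (by linarith)
    nlinarith [sq_nonneg t, sq_nonneg t']
  have := mul_pos (by linarith : 0 < t' - t) h1
  linarith

/-- The next duration is monotone in the landing time and the duration. -/
theorem next_mono {r a a' t t' τ τ' : ℝ} (hr : 0 < r) (ha : 3 ≤ a) (haa : a ≤ a') (ht : 0 ≤ t)
    (hta : t ≤ a + 1) (htt : t ≤ t') (hτ : 0 ≤ τ) (hτ' : 0 ≤ τ')
    (h : τ * baseLaunch a τ = r * (t * baseLaunch a (-t)))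
    (h' : τ' * baseLaunch a' τ' = r * (t' * baseLaunch a' (-t'))) : τ ≤ τ' := by
  by_contra hcon
  push Not at hcon
  have h1 := mul_baseLaunch_strictMono (ha.trans haa) hτ' hcon
  have h2 := mul_baseLaunch_neg_mono (ha.trans haa) htt
  have h3 := baseLaunch_exchange ha haa ht hta hτ
  have hpos := baseLaunch_neg_pos ha hta
  have hposτ : 0 < baseLaunch a τ := by
    have := baseLaunch_pos ha hτ
    nlinarith
  -- If `τ' < τ`, then `τ * baseLaunch a' τ` is at most `r * (t * baseLaunch a' (-t))` by exchange,
  -- hence at most the same with `t'`. That equals `τ' * baseLaunch a' τ'`, which is smaller than `τ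
  -- * baseLaunch a' τ`, a contradiction.
  have h4 : (τ * baseLaunch a' τ) * baseLaunch a τ ≤
      (r * (t * baseLaunch a' (-t))) * baseLaunch a τ := by
    have e1 : (τ * baseLaunch a' τ) * baseLaunch a (-t) ≤
        (τ * baseLaunch a τ) * baseLaunch a' (-t) := by
      have := mul_le_mul_of_nonneg_left h3 hτ
      linarith
    rw [h] at e1
    have e2 : τ * baseLaunch a' τ * baseLaunch a (-t) ≤
        r * (t * baseLaunch a' (-t)) * baseLaunch a (-t) := by linarith
    have e3 := le_of_mul_le_mul_right e2 hpos
    exact mul_le_mul_of_nonneg_right e3 hposτ.le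
  have h5 := le_of_mul_le_mul_right h4 hposτ
  have h6 := mul_le_mul_of_nonneg_left h2 hr.le
  linarith

/-- Speed squared over `s² - 1`, the size of the acceleration towards the obstacle, is no larger at
landing than at launch, and restitution multiplies it by `r²`. This yields geometric decay along
orbits. With `s = 3 + u` the difference expands into a polynomial with nonnegative coefficients in
`u` and `t`. -/
theorem energy_le {s t : ℝ} (hs : 3 ≤ s) (ht : 0 ≤ t) :
    (t * baseLaunch (s + t) (-t)) ^ 2 * (s ^ 2 - 1) ≤
      (t * baseLaunch s t) ^ 2 * ((s + t) ^ 2 - 1) := by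
  obtain ⟨u, rfl⟩ : ∃ u, s = 3 + u := ⟨s - 3, by ring⟩
  have hu : 0 ≤ u := by linarith
  have h1 : baseLaunch (3 + u + t) (-t) ^ 2 * ((3 + u) ^ 2 - 1) ≤
      baseLaunch (3 + u) t ^ 2 * ((3 + u + t) ^ 2 - 1) := by
    rw [← sub_nonneg]
    unfold baseLaunch
    ring_nf
    positivity
  have h2 := mul_le_mul_of_nonneg_left h1 (sq_nonneg t)
  linarith

/-- Bound on the landing times of flights to be considered. -/
noncomputable def reach (r : ℝ) : ℝ := 9 + 4 / (1 - r)

/-- Bound on all landing times. -/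
noncomputable def horizon (r : ℝ) : ℝ :=
  reach r + (5 * reach r ^ 2 / 2 + 8) / (4 * (1 - r)) + 3

/-- Initial flights whose orbits are controlled at the unperturbed parameter. -/
def baseRegion (r : ℝ) : Set (ℝ × ℝ) :=
  {p | -1 ≤ p.1 ∧ 0 ≤ p.2 ∧ p.2 ≤ 5 ∧ 3 ≤ p.1 + p.2 ∧ p.1 + p.2 ≤ reach r}

/-! ### Orbits of the unperturbed problem -/

namespace IsScaledFamily

variable {Φ : ℝ × ℝ × ℝ × ℝ → ℝ} {k : ℝ × ℝ → ℝ} {r M e₀ : ℝ} {φ : ℝ × ℝ × ℝ → Path01}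

theorem speed_base (h : IsScaledFamily Φ k r M e₀ φ) {s t : ℝ} (hs : |s| < M) (ht : |t| < M) :
    speed φ (0, s, t) = t * baseLaunch s t := h.flight.speed_zero hs ht

theorem impact_base (h : IsScaledFamily Φ k r M e₀ φ) {s t : ℝ} (hs : |s| < M) (ht : |t| < M) :
    impact φ (0, s, t) = t * baseLaunch (s + t) (-t) := by
  rw [h.flight.impact_zero hs ht]; unfold baseLaunch; ring

/-- Existence of the next flight of the unperturbed problem, with a bound on its duration. -/
theorem exists_next_base (h : IsScaledFamily Φ k r M e₀ φ) {s t X : ℝ} (hs : |s| < M)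
    (ht : |t| < M) (hst : 3 ≤ s + t) (hst' : s + t < M - 1) (ht0 : 0 ≤ t) (hta : t ≤ s + t + 1)
    (hX : 0 ≤ X) (hXM : X < M - 1)
    (hle : r * (t * baseLaunch (s + t) (-t)) ≤ X * (((s + t) ^ 2 - 1) / 2)) :
    Regular φ k M e₀ (0, s, t) ∧ 0 ≤ nextDuration φ M k (0, s, t) ∧
      nextDuration φ M k (0, s, t) ≤ X ∧
      nextDuration φ M k (0, s, t) * baseLaunch (s + t) (nextDuration φ M k (0, s, t)) =
        r * (t * baseLaunch (s + t) (-t)) := by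
  have hM := h.seven_le
  have hcont : ContinuousOn (fun τ => τ * baseLaunch (s + t) τ) (Icc 0 X) :=
    (show Continuous fun τ => τ * baseLaunch (s + t) τ by unfold baseLaunch; fun_prop).continuousOn
  have hW : 0 ≤ r * (t * baseLaunch (s + t) (-t)) :=
    mul_nonneg h.r_pos.le (mul_nonneg ht0 (baseLaunch_neg_pos hst hta).le)
  have hXV : r * (t * baseLaunch (s + t) (-t)) ≤ X * baseLaunch (s + t) X :=
    hle.trans (mul_le_mul_of_nonneg_left (baseLaunch_pos hst hX) hX)
  obtain ⟨τ, hτ, hτe⟩ := intermediate_value_Icc hX hcont ⟨by simpa using hW, hXV⟩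
  simp only at hτe
  have hτM : τ ∈ Ioo (-1 / 2) (M - 1) := ⟨by linarith [hτ.1], by linarith [hτ.2]⟩
  obtain ⟨h1, h2⟩ := Regular.of_speed h (z := (0, s, t)) (t := τ)
    (mem_box.2 ⟨by simpa using h.flight.e₀_pos, hs, ht⟩)
    ⟨by simp only; linarith, by simpa using hst'⟩ hτM (by
      simp only
      rw [h.speed_base (abs_lt.2 ⟨by linarith, by linarith⟩)
        (abs_lt.2 ⟨by linarith [hτ.1], by linarith [hτ.2]⟩), hτe, h.factor_zero,
        h.impact_base hs ht]; ring)
  rw [h2]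
  exact ⟨h1, hτ.1, hτ.2, hτe⟩

/-- Orbits of the unperturbed problem from `s ≥ 3`. -/
theorem base_tail (h : IsScaledFamily Φ k r M e₀ φ) {s t : ℝ} (hs : 3 ≤ s) (ht : 0 ≤ t)
    (hbd : s + t * baseLaunch s t / (4 * (1 - r)) + 1 < M) (n : ℕ) :
    Regular φ k M e₀ ((shiftMap (nextDuration φ M k))^[n] (0, s, t)) ∧
    3 ≤ ((shiftMap (nextDuration φ M k))^[n] (0, s, t)).2.1 ∧
    0 ≤ stepLength (nextDuration φ M k) n (0, s, t) ∧
    stepLength (nextDuration φ M k) n (0, s, t) ≤ r ^ n * (t * baseLaunch s t / 4) ∧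
    ((shiftMap (nextDuration φ M k))^[n] (0, s, t)).2.1 ≤
      s + t * baseLaunch s t / (4 * (1 - r)) := by
  have hM := h.seven_le
  have hr := h.r_pos
  have hr1 := h.r_lt_one
  set v := t * baseLaunch s t with hv
  have hA0 : 8 ≤ s ^ 2 - 1 := by nlinarith
  have hv0 : 4 * t ≤ v := by
    have := mul_le_mul_of_nonneg_left (baseLaunch_pos hs ht) ht
    nlinarith
  have hv1 : 0 ≤ v := by linarith
  set w := v / (4 * (1 - r)) with hw
  have hw' : w * (1 - r) = v / 4 := by
    rw [hw]; have : 1 - r ≠ 0 := by linarith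
    field_simp
  have hw0 : 0 ≤ w := by rw [hw]; apply div_nonneg hv1; linarith
  have hvw : v / 4 ≤ w := by
    rw [← hw']; exact mul_le_of_le_one_right hw0 (by linarith)
  set T := shiftMap (nextDuration φ M k) with hT
  -- The last inequality is the energy bound and drives the induction. Durations follow from it, and
  -- `w` is the sum of the geometric series bounding them.
  have main : ∀ n, ∀ sn tn, T^[n] (0, s, t) = (0, sn, tn) →
      3 ≤ sn → 0 ≤ tn → tn ≤ r ^ n * (v / 4) → sn ≤ s + w * (1 - r ^ n) →
      (tn * baseLaunch sn tn) ^ 2 * (s ^ 2 - 1) ≤ (r ^ n) ^ 2 * v ^ 2 * (sn ^ 2 - 1) →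
      Regular φ k M e₀ (0, sn, tn) ∧ ∃ tn', T^[n + 1] (0, s, t) = (0, sn + tn, tn') ∧
        0 ≤ tn' ∧ tn' ≤ r ^ (n + 1) * (v / 4) ∧ sn + tn ≤ s + w * (1 - r ^ (n + 1)) ∧
        (tn' * baseLaunch (sn + tn) tn') ^ 2 * (s ^ 2 - 1) ≤
          (r ^ (n + 1)) ^ 2 * v ^ 2 * ((sn + tn) ^ 2 - 1) := by
    intro n sn tn hz hsn htn htn' hsn' hen
    have hrn : 0 ≤ r ^ n := pow_nonneg hr.le n
    have hrn1 : r ^ n ≤ 1 := pow_le_one₀ hr.le hr1.le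
    have hrn' : 0 ≤ r ^ (n + 1) := pow_nonneg hr.le _
    have hrn1' : r ^ (n + 1) ≤ 1 := pow_le_one₀ hr.le hr1.le
    have hsum : sn + tn ≤ s + w * (1 - r ^ (n + 1)) := by
      have : r ^ n * (v / 4) = w * r ^ n - w * r ^ (n + 1) := by rw [← hw', pow_succ]; ring
      linarith
    have hle1 : w * (1 - r ^ (n + 1)) ≤ w := mul_le_of_le_one_right hw0 (by linarith)
    have hA : 8 ≤ sn ^ 2 - 1 := by nlinarith
    have hA' : 8 ≤ (sn + tn) ^ 2 - 1 := by nlinarith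
    have hen2 := energy_le hsn htn
    set W := tn * baseLaunch (sn + tn) (-tn) with hW
    have hW0 : 0 ≤ W := mul_nonneg htn (baseLaunch_neg_pos (by linarith) (by linarith)).le
    have hen3 : (r * W) ^ 2 * (s ^ 2 - 1) ≤ (r ^ (n + 1)) ^ 2 * v ^ 2 * ((sn + tn) ^ 2 - 1) := by
      have e1 : W ^ 2 * (s ^ 2 - 1) * (sn ^ 2 - 1) ≤
          (r ^ n) ^ 2 * v ^ 2 * ((sn + tn) ^ 2 - 1) * (sn ^ 2 - 1) := by
        have i1 := mul_le_mul_of_nonneg_right hen2 (by linarith : 0 ≤ s ^ 2 - 1)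
        have i2 := mul_le_mul_of_nonneg_right hen (by linarith : 0 ≤ (sn + tn) ^ 2 - 1)
        linarith
      have e2 := le_of_mul_le_mul_right e1 (by linarith)
      have e3 := mul_le_mul_of_nonneg_left e2 (sq_nonneg r)
      rw [pow_succ r n]
      linarith
    -- The energy bound is quadratic in the speed. Since `s ^ 2 - 1` and its value at landing are
    -- both at least `8`, it becomes the linear bound wanted by `exists_next_base`.
    have hXle : r * W ≤ r ^ (n + 1) * (v / 4) * (((sn + tn) ^ 2 - 1) / 2) := by
      set Q := r ^ (n + 1) * v with hQ
      have hQ0 : 0 ≤ Q := mul_nonneg hrn' hv1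
      set A' := (sn + tn) ^ 2 - 1 with hA'def
      have e1 : (r * W) ^ 2 * 8 ≤ Q ^ 2 * A' := by
        have : (r * W) ^ 2 * 8 ≤ (r * W) ^ 2 * (s ^ 2 - 1) := by gcongr
        rw [hQ]; linarith
      have e2 : (r * W) ^ 2 ≤ (Q * A' / 8) ^ 2 := by
        have : Q ^ 2 * A' * 8 ≤ Q ^ 2 * A' * A' := by gcongr
        nlinarith
      have e3 := abs_le_of_sq_le_sq' e2 (by positivity)
      have e4 : r ^ (n + 1) * (v / 4) * (A' / 2) = Q * A' / 8 := by rw [hQ]; ring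
      linarith [e3.2]
    have hX0 : 0 ≤ r ^ (n + 1) * (v / 4) := by positivity
    have hXw : r ^ (n + 1) * (v / 4) ≤ v / 4 := mul_le_of_le_one_left (by linarith) hrn1'
    have htnv : tn ≤ v / 4 := htn'.trans (mul_le_of_le_one_left (by linarith) hrn1)
    obtain ⟨g1, g2, g3, g4⟩ := h.exists_next_base (s := sn) (t := tn)
      (abs_lt.2 ⟨by linarith, by linarith⟩) (abs_lt.2 ⟨by linarith, by linarith⟩) (by linarith)
      (by linarith) htn (by linarith) hX0 (by linarith) hXle
    refine ⟨g1, nextDuration φ M k (0, sn, tn), ?_, g2, g3, hsum, ?_⟩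
    · rw [Function.iterate_succ_apply', hz]; rfl
    · rw [g4]; exact hen3
  have all : ∀ n, ∃ sn tn, T^[n] (0, s, t) = (0, sn, tn) ∧
      3 ≤ sn ∧ 0 ≤ tn ∧ tn ≤ r ^ n * (v / 4) ∧ sn ≤ s + w * (1 - r ^ n) ∧
      (tn * baseLaunch sn tn) ^ 2 * (s ^ 2 - 1) ≤ (r ^ n) ^ 2 * v ^ 2 * (sn ^ 2 - 1) := by
    intro n
    induction n with
    | zero => exact ⟨s, t, rfl, hs, ht, by simp; linarith, by simp, by simp [hv]⟩
    | succ n ih =>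
      obtain ⟨sn, tn, h1, h2, h3, h4, h5, h6⟩ := ih
      obtain ⟨-, tn', g1, g2, g3, g4, g5⟩ := main n sn tn h1 h2 h3 h4 h5 h6
      exact ⟨_, _, g1, by linarith, g2, g3, g4, g5⟩
  obtain ⟨sn, tn, h1, h2, h3, h4, h5, h6⟩ := all n
  have hrn : 0 ≤ r ^ n := pow_nonneg hr.le n
  refine ⟨?_, ?_, ?_, ?_, ?_⟩
  · rw [h1]; exact (main n sn tn h1 h2 h3 h4 h5 h6).1
  · rw [h1]; exact h2
  · unfold stepLength; rw [h1]; exact h3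
  · unfold stepLength; rw [h1]; exact h4
  · rw [h1]
    have : w * (1 - r ^ n) ≤ w := mul_le_of_le_one_right hw0 (by linarith)
    simp only; linarith

/-- Orbits of the unperturbed problem from `baseRegion`. -/
theorem base_orbit (h : IsScaledFamily Φ k r M e₀ φ) (hM : horizon r ≤ M) {s t : ℝ}
    (hp : (s, t) ∈ baseRegion r) :
    (∀ n, Regular φ k M e₀ ((shiftMap (nextDuration φ M k))^[n] (0, s, t))) ∧
    (∀ n, 3 ≤ ((shiftMap (nextDuration φ M k))^[n + 1] (0, s, t)).2.1) ∧
    (∀ n, 0 ≤ stepLength (nextDuration φ M k) n (0, s, t)) ∧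
    (Summable fun n => stepLength (nextDuration φ M k) n (0, s, t)) ∧
    3 ≤ limitPoint (nextDuration φ M k) (0, s, t) ∧
    limitPoint (nextDuration φ M k) (0, s, t) ≤
      s + t + t * baseLaunch (s + t) (-t) / (4 * (1 - r)) ∧
    limitPoint (nextDuration φ M k) (0, s, t) < M - 1 := by
  obtain ⟨hs, ht, ht5, hst, hst'⟩ := hp
  simp only at hs ht ht5 hst hst'
  have hr := h.r_pos
  have hr1 := h.r_lt_one
  have h1r : 0 < 1 - r := by linarith
  set a := s + t with ha
  set W := t * baseLaunch a (-t) with hW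
  have hW0 : 0 ≤ W := mul_nonneg ht (baseLaunch_neg_pos hst (by linarith)).le
  have hWle : W ≤ 5 * reach r ^ 2 / 2 + 8 := by
    have e1 : baseLaunch a (-t) ≤ reach r ^ 2 / 2 + 19 / 12 := by
      unfold baseLaunch
      have : a ^ 2 ≤ reach r ^ 2 := by gcongr
      nlinarith [mul_nonneg (by linarith : 0 ≤ a) ht]
    have : W ≤ 5 * (reach r ^ 2 / 2 + 19 / 12) := by
      rw [hW]
      exact mul_le_mul ht5 e1 (baseLaunch_neg_pos hst (by linarith)).le (by norm_num)
    linarith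
  have hWw : W / (4 * (1 - r)) ≤ (5 * reach r ^ 2 / 2 + 8) / (4 * (1 - r)) := by gcongr
  have hW4 : W / 4 ≤ W / (4 * (1 - r)) := by gcongr; linarith
  have hWr : r * W ≤ W := mul_le_of_le_one_left hW0 hr1.le
  have hMr : reach r + (5 * reach r ^ 2 / 2 + 8) / (4 * (1 - r)) + 3 ≤ M := hM
  have hreach : 9 ≤ reach r := by
    unfold reach; have : 0 < 4 / (1 - r) := by positivity
    linarith
  -- The energy estimate needs starting times at least `3`, while this flight may start at `-1`. The
  -- first step is therefore done separately, and `base_tail` is applied from its landing time.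
  obtain ⟨g1, g2, g3, g4⟩ := h.exists_next_base (s := s) (t := t) (X := r * W / 4)
    (abs_lt.2 ⟨by linarith, by linarith⟩) (abs_lt.2 ⟨by linarith, by linarith⟩) hst
    (by linarith) ht (by linarith) (by positivity) (by linarith) (by
      have e1 : (4 : ℝ) ≤ (a ^ 2 - 1) / 2 := by nlinarith
      have := mul_le_mul_of_nonneg_left e1 (by positivity : 0 ≤ r * W / 4)
      linarith)
  set τ := nextDuration φ M k (0, s, t) with hτ
  rw [← ha, ← hW] at g4
  have hT : shiftMap (nextDuration φ M k) (0, s, t) = (0, a, τ) := rfl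
  have hrw : r * W / (4 * (1 - r)) ≤ W / (4 * (1 - r)) := by gcongr
  have tail := h.base_tail hst g2 (by rw [g4]; linarith)
  rw [g4] at tail
  have hit : ∀ n, (shiftMap (nextDuration φ M k))^[n + 1] (0, s, t) =
      (shiftMap (nextDuration φ M k))^[n] (0, a, τ) := fun n => by
    rw [Function.iterate_succ_apply, hT]
  have hst1 : ∀ n, stepLength (nextDuration φ M k) (n + 1) (0, s, t) =
      stepLength (nextDuration φ M k) n (0, a, τ) := fun n => by
    unfold stepLength; rw [hit]
  have hsum : Summable fun n => stepLength (nextDuration φ M k) n (0, s, t) := by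
    rw [← summable_nat_add_iff 1]
    simp only [hst1]
    refine Summable.of_norm_bounded ((summable_geometric_of_lt_one hr.le hr1).mul_right
      (r * W / 4)) fun n => ?_
    rw [Real.norm_eq_abs, abs_of_nonneg (tail n).2.2.1]
    exact (tail n).2.2.2.1
  have hlim := (tendsto_add_atTop_iff_nat 1).2 (tendsto_of_summable_stepLength hsum)
  simp only [hit] at hlim
  have hup : limitPoint (nextDuration φ M k) (0, s, t) ≤ a + r * W / (4 * (1 - r)) :=
    le_of_tendsto hlim (Eventually.of_forall fun n => (tail n).2.2.2.2)
  refine ⟨fun n => ?_, fun n => ?_, fun n => ?_, hsum, ?_, by linarith, by linarith⟩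
  · cases n with
    | zero => exact g1
    | succ n => rw [hit]; exact (tail n).1
  · rw [hit]; exact (tail n).2.1
  · cases n with
    | zero => exact ht
    | succ n => rw [hst1]; exact (tail n).2.2.1
  · exact ge_of_tendsto hlim (Eventually.of_forall fun n => (tail n).2.1)

theorem base_convergent (h : IsScaledFamily Φ k r M e₀ φ) (hM : horizon r ≤ M) {s t : ℝ}
    (hp : (s, t) ∈ baseRegion r) :
    ∀ᶠ z in 𝓝 ((0 : ℝ), s, t), Convergent φ k M e₀ z := by
  obtain ⟨h1, -, -, h4, h5, -, h7⟩ := h.base_orbit hM hp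
  refine h.eventually_convergent (σ := limitPoint (nextDuration φ M k) (0, s, t))
    ⟨by linarith, h7⟩ h1 ?_
  have c1 := tendsto_of_summable_stepLength h4
  have c2 := h4.tendsto_atTop_zero
  unfold stepLength at c2
  exact c1.prodMk_nhds c2

theorem Regular.base_eq (h : IsScaledFamily Φ k r M e₀ φ) {s t : ℝ}
    (hz : Regular φ k M e₀ (0, s, t)) :
    nextDuration φ M k (0, s, t) * baseLaunch (s + t) (nextDuration φ M k (0, s, t)) =
      r * (t * baseLaunch (s + t) (-t)) := by
  have hM := h.seven_le
  have h1 := hz.speed_next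
  have h2 := hz.time_mem
  have h3 := hz.next_mem
  obtain ⟨-, h4, h5⟩ := mem_box.1 hz.mem
  simp only at h1 h2 h4 h5 ⊢
  rw [h.factor_zero, h.impact_base h4 h5,
    h.speed_base (abs_lt.2 ⟨by linarith [h2.1], by linarith [h2.2]⟩)
    (abs_lt.2 ⟨by linarith [h3.1], by linarith [h3.2]⟩)] at h1
  rw [h1]; ring

/-- Along orbits of the unperturbed problem durations and landing times remain ordered. -/
theorem base_orbit_mono (h : IsScaledFamily Φ k r M e₀ φ) (hM : horizon r ≤ M)
    {s t s' t' : ℝ} (hp : (s, t) ∈ baseRegion r) (hp' : (s', t') ∈ baseRegion r)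
    (hst : s + t ≤ s' + t') (htt : t ≤ t') (n : ℕ) :
    stepLength (nextDuration φ M k) n (0, s, t) ≤ stepLength (nextDuration φ M k) n (0, s', t') := by
  obtain ⟨r1, l1, n1, -⟩ := h.base_orbit hM hp
  obtain ⟨r2, -, n2, -⟩ := h.base_orbit hM hp'
  -- What persists is the order of the landing times `a + b` and of the durations. The starting
  -- times need not be ordered.
  have all : ∀ n, ∃ a b a' b', (shiftMap (nextDuration φ M k))^[n] (0, s, t) = (0, a, b) ∧
      (shiftMap (nextDuration φ M k))^[n] (0, s', t') = (0, a', b') ∧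
      a + b ≤ a' + b' ∧ b ≤ b' ∧ 3 ≤ a + b ∧ -1 ≤ a := by
    intro n
    induction n with
    | zero => exact ⟨s, t, s', t', rfl, rfl, hst, htt, hp.2.2.2.1, hp.1⟩
    | succ n ih =>
      obtain ⟨a, b, a', b', i1, i2, i3, i4, i5, i6⟩ := ih
      have e1 : (shiftMap (nextDuration φ M k))^[n + 1] (0, s, t) =
          (0, a + b, nextDuration φ M k (0, a, b)) := by
        rw [Function.iterate_succ_apply', i1]; rfl
      have e2 : (shiftMap (nextDuration φ M k))^[n + 1] (0, s', t') =
          (0, a' + b', nextDuration φ M k (0, a', b')) := by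
        rw [Function.iterate_succ_apply', i2]; rfl
      have j1 := r1 n
      have j2 := r2 n
      have m1 := n1 n
      have m2 := n1 (n + 1)
      have m3 := n2 (n + 1)
      have m4 := l1 n
      unfold stepLength at m1 m2 m3
      rw [i1] at j1 m1
      rw [i2] at j2
      rw [e1] at m2 m4
      rw [e2] at m3
      simp only at m1 m2 m3 m4
      have hle : nextDuration φ M k (0, a, b) ≤ nextDuration φ M k (0, a', b') :=
        next_mono h.r_pos i5 i3 m1 (by linarith) i4 m2 m3 (j1.base_eq h) (j2.base_eq h)
      exact ⟨_, _, _, _, e1, e2, by linarith, hle, by linarith, by linarith⟩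
  obtain ⟨a, b, a', b', i1, i2, -, i4, -⟩ := all n
  unfold stepLength
  rw [i1, i2]
  exact i4

/-- Monotonicity of the limit at the unperturbed parameter. -/
theorem base_limitPoint_mono (h : IsScaledFamily Φ k r M e₀ φ) (hM : horizon r ≤ M)
    {s t s' t' : ℝ} (hp : (s, t) ∈ baseRegion r) (hp' : (s', t') ∈ baseRegion r)
    (hst : s + t ≤ s' + t') (htt : t ≤ t') :
    s' + t' - (s + t) ≤ limitPoint (nextDuration φ M k) (0, s', t') -
      limitPoint (nextDuration φ M k) (0, s, t) := by
  have s1 := (h.base_orbit hM hp).2.2.2.1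
  have s2 := (h.base_orbit hM hp').2.2.2.1
  have s1' := (summable_nat_add_iff 1).2 s1
  have s2' := (summable_nat_add_iff 1).2 s2
  -- Only the steps after the first are compared. The starting point plus the first step is the
  -- landing time, which is kept exactly and gives slope `1`.
  have hle := Summable.tsum_le_tsum
    (fun n => h.base_orbit_mono hM hp hp' hst htt (n + 1)) s1' s2'
  unfold limitPoint
  rw [s1.tsum_eq_zero_add, s2.tsum_eq_zero_add]
  have z1 : stepLength (nextDuration φ M k) 0 (0, s, t) = t := by simp [stepLength]
  have z2 : stepLength (nextDuration φ M k) 0 (0, s', t') = t' := by simp [stepLength]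
  rw [z1, z2]
  linarith

theorem limitPoint_time_zero (h : IsScaledFamily Φ k r M e₀ φ) {e s : ℝ} (he : |e| < e₀)
    (hs : s ∈ Ioo (5 / 2) (M - 1)) : limitPoint (nextDuration φ M k) (e, s, 0) = s := by
  have hfix : shiftMap (nextDuration φ M k) (e, s, 0) = (e, s, 0) := by
    simp [shiftMap, (h.regular_time_zero he hs).2]
  refine limitPoint_of_step_zero fun n => ?_
  unfold stepLength
  rw [Function.iterate_fixed hfix]

end IsScaledFamily

/-! ### Estimates uniform in small `e` -/

/-- The limit of landing times along an orbit of regular flights. -/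
noncomputable abbrev limitTime (φ : ℝ × ℝ × ℝ → Path01) (M : ℝ) (k : ℝ × ℝ → ℝ) :
    ℝ × ℝ × ℝ → ℝ := limitPoint (nextDuration φ M k)

/-- Compact set of initial flights. -/
def coreRegion (r : ℝ) : Set (ℝ × ℝ) :=
  {p | -1 ≤ p.1 ∧ 0 ≤ p.2 ∧ p.2 ≤ 4 ∧ 3 ≤ p.1 + p.2 ∧ p.1 + p.2 ≤ reach r - 1}

theorem isCompact_coreRegion (r : ℝ) : IsCompact (coreRegion r) := by
  refine (isCompact_Icc.prod isCompact_Icc :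
    IsCompact (Icc (-1) (reach r) ×ˢ Icc (0 : ℝ) 4)).of_isClosed_subset ?_ ?_
  · have e1 : IsClosed {p : ℝ × ℝ | -1 ≤ p.1} := isClosed_le (by fun_prop) (by fun_prop)
    have e2 : IsClosed {p : ℝ × ℝ | 0 ≤ p.2} := isClosed_le (by fun_prop) (by fun_prop)
    have e3 : IsClosed {p : ℝ × ℝ | p.2 ≤ 4} := isClosed_le (by fun_prop) (by fun_prop)
    have e4 : IsClosed {p : ℝ × ℝ | 3 ≤ p.1 + p.2} := isClosed_le (by fun_prop) (by fun_prop)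
    have e5 : IsClosed {p : ℝ × ℝ | p.1 + p.2 ≤ reach r - 1} :=
      isClosed_le (by fun_prop) (by fun_prop)
    exact e1.inter (e2.inter (e3.inter (e4.inter e5)))
  · rintro ⟨s, t⟩ ⟨h1, h2, h3, h4, h5⟩
    simp only at h1 h2 h3 h4 h5
    exact ⟨⟨h1, by simp only; linarith⟩, h2, h3⟩

/-- For `s ≥ -1` and `s + t ≥ 3` every term is nonnegative, and all vanish only for the tangential
flight `s = -1`, `t = 4`. -/
theorem baseLaunch_excess (s t : ℝ) : baseLaunch s t =
    (s + 1) ^ 2 / 4 + (s + t - 3) * (s + 3) / 6 + (s + t - 3) ^ 2 / 12 := by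
  unfold baseLaunch; ring

/-- Divided difference of the unperturbed launch speed. -/
theorem baseSpeed_divided_pos {s t t' : ℝ} (hs : -1 ≤ s) (hst : 3 ≤ s + t) (ht' : 0 ≤ t')
    (hne : ¬ (s = -1 ∧ t = 4 ∧ t' = 0)) :
    0 < baseLaunch s t + t' * (4 * s + t + t') / 12 := by
  rw [baseLaunch_excess]
  have h1 : 0 ≤ (s + t - 3) * (s + 3) := mul_nonneg (by linarith) (by linarith)
  have h2 : 0 ≤ t' * (4 * s + t + t') := mul_nonneg ht' (by linarith)
  by_contra hcon
  push Not at hcon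
  have e1 : s + 1 = 0 := by nlinarith [sq_nonneg (s + 1), sq_nonneg (s + t - 3)]
  have e2 : s + t - 3 = 0 := by nlinarith [sq_nonneg (s + 1), sq_nonneg (s + t - 3)]
  have e3 : t' = 0 := by
    have : t' * t' ≤ 0 := by
      have : t' * (4 * s + t + t') = t' * (3 * (s + 1) + (s + t - 3) + t') := by ring
      rw [e1, e2] at this
      nlinarith [sq_nonneg (s + 1), sq_nonneg (s + t - 3)]
    nlinarith
  exact hne ⟨by linarith, by linarith, e3⟩

theorem hasDerivAt_line_snd {F : ℝ × ℝ × ℝ → ℝ} {F' : ℝ × ℝ × ℝ →L[ℝ] ℝ} {e s t : ℝ}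
    (hF : HasFDerivAt F F' (e, s, t)) : HasDerivAt (fun t => F (e, s, t)) (F' (0, 0, 1)) t :=
  HasFDerivAt.comp_hasDerivAt (l := F) (f := fun t => (e, s, t)) t hF
    ((hasDerivAt_const _ _).prodMk ((hasDerivAt_const _ _).prodMk (hasDerivAt_id _)))

theorem hasDerivAt_line_fst {F : ℝ × ℝ × ℝ → ℝ} {F' : ℝ × ℝ × ℝ →L[ℝ] ℝ} {e s t : ℝ}
    (hF : HasFDerivAt F F' (e, s, t)) : HasDerivAt (fun s => F (e, s, t)) (F' (0, 1, 0)) s :=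
  HasFDerivAt.comp_hasDerivAt (l := F) (f := fun s => (e, s, t)) s hF
    ((hasDerivAt_const _ _).prodMk ((hasDerivAt_id _).prodMk (hasDerivAt_const _ _)))

namespace IsScaledFamily

variable {Φ : ℝ × ℝ × ℝ × ℝ → ℝ} {k : ℝ × ℝ → ℝ} {r M e₀ : ℝ} {φ : ℝ × ℝ × ℝ → Path01}

theorem nine_le_reach (h : IsScaledFamily Φ k r M e₀ φ) : 13 < reach r ∧ reach r + 3 ≤ horizon r := by
  have hr1 := h.r_lt_one
  have hr := h.r_pos
  have h1 : 0 < 1 - r := by linarith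
  have h2 : 4 < 4 / (1 - r) := by rw [lt_div_iff₀ h1]; linarith
  constructor
  · unfold reach; linarith
  · unfold horizon
    have : 0 ≤ (5 * reach r ^ 2 / 2 + 8) / (4 * (1 - r)) := by positivity
    linarith

theorem core_subset (p : ℝ × ℝ) (hp : p ∈ coreRegion r) : p ∈ baseRegion r :=
  ⟨hp.1, hp.2.1, by linarith [hp.2.2.1], hp.2.2.2.1, by linarith [hp.2.2.2.2]⟩

theorem hasDerivAt_limitTime {e s t : ℝ} (hz : Convergent φ k M e₀ (e, s, t)) :
    HasDerivAt (fun t => limitTime φ M k (e, s, t))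
      (fderiv ℝ (fun p => limitTime φ M k (e, p)) (s, t) (0, 1)) t := by
  have h1 : HasDerivAt (fun t : ℝ => ((s, t) : ℝ × ℝ)) (0, 1) t :=
    (hasDerivAt_const _ _).prodMk (hasDerivAt_id _)
  have hf := hz.fiberC1At.differentiableAt.hasFDerivAt
  exact HasFDerivAt.comp_hasDerivAt (l := fun p => limitTime φ M k (e, p)) t hf h1

/-- Monotonicity of the limit at `e = 0` bounds its difference quotients in the duration below by
`1`, so the derivative is at least `1` there. Joint continuity of the fiber derivative keeps it
above `1/2` nearby. -/
theorem core_eventually (h : IsScaledFamily Φ k r M e₀ φ) (hM : horizon r ≤ M) {p : ℝ × ℝ}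
    (hp : p ∈ coreRegion r) : ∀ᶠ z in 𝓝 ((0 : ℝ), p), Convergent φ k M e₀ z ∧
      1 / 2 < fderiv ℝ (fun p => limitTime φ M k (z.1, p)) z.2 (0, 1) ∧
      0 < IsFlightFamily.landing φ z ∧ z ∈ box e₀ M := by
  obtain ⟨s, t⟩ := p
  have hbase := core_subset _ hp
  have hconv := h.base_convergent hM hbase
  have hMM := h.nine_le_reach
  obtain ⟨hs, ht, ht4, hst, hst'⟩ := hp
  simp only at hs ht ht4 hst hst'
  have hsM : |s| < M := abs_lt.2 ⟨by linarith, by linarith⟩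
  have htM : |t| < M := abs_lt.2 ⟨by linarith, by linarith⟩
  have hbox : ((0 : ℝ), s, t) ∈ box e₀ M :=
    mem_box.2 ⟨by simpa using h.flight.e₀_pos, hsM, htM⟩
  have hd := hasDerivAt_limitTime hconv.self_of_nhds
  have hge : 1 ≤ fderiv ℝ (fun p => limitTime φ M k (0, p)) (s, t) (0, 1) := by
    have hlim := hd.tendsto_slope_zero_right
    refine ge_of_tendsto hlim ?_
    -- `baseRegion` exceeds `coreRegion` by one unit in duration and landing time, which leaves room
    -- for the increments.
    filter_upwards [Ioo_mem_nhdsGT (show (0 : ℝ) < 1 by norm_num)] with x hx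
    have := h.base_limitPoint_mono hM hbase (s' := s) (t' := t + x)
      ⟨hs, by simp only; linarith [hx.1], by simp only; linarith [hx.2],
        by simp only; linarith [hx.1], by simp only; linarith [hx.2]⟩
      (by linarith [hx.1]) (by linarith [hx.1])
    rw [smul_eq_mul, ← div_eq_inv_mul, le_div_iff₀ hx.1]
    simp only [limitTime] at this ⊢
    linarith
  have hc := hconv.self_of_nhds.fiberC1At.continuousAt_fderiv.clm_apply
    (continuousAt_const (y := ((0, 1) : ℝ × ℝ)))
  have e1 := hc.eventually_const_lt (u := 1 / 2) (by
    beta_reduce; simp only [limitTime] at hge; linarith)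
  have hopen := (isOpen_box e₀ M).mem_nhds hbox
  have e2 : ∀ᶠ z in 𝓝 ((0 : ℝ), s, t), 0 < IsFlightFamily.landing φ z :=
    (h.flight.contDiffOn_landing.contDiffAt hopen).continuousAt.eventually_const_lt (by
      have : IsFlightFamily.landing φ (0, s, t) = baseLaunch (s + t) (-t) := by
        rw [h.flight.landing_zero hsM htM]; unfold baseLaunch; ring
      rw [this]
      exact baseLaunch_neg_pos hst (by linarith))
  filter_upwards [hconv, e1, e2, hopen] with z z1 z2 z3 z4
  exact ⟨z1, z2, z3, z4⟩

/-- Properties of flights close to `coreRegion`, uniformly in small `e`. -/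
theorem exists_band (h : IsScaledFamily Φ k r M e₀ φ) (hM : horizon r ≤ M) :
    ∃ μ > 0, μ < 1 / 4 ∧ ∀ e s t, |e| < μ → -1 - μ ≤ s → -μ ≤ t → t ≤ 4 + μ → 3 - μ ≤ s + t →
      s + t ≤ reach r - 2 → Convergent φ k M e₀ (e, s, t) ∧
      1 / 2 < fderiv ℝ (fun p => limitTime φ M k (e, p)) (s, t) (0, 1) ∧
      0 < IsFlightFamily.landing φ (e, s, t) ∧ (e, s, t) ∈ box e₀ M := by
  have hK : IsCompact ({(0 : ℝ)} ×ˢ coreRegion r) :=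
    isCompact_singleton.prod (isCompact_coreRegion r)
  set S : Set (ℝ × ℝ × ℝ) := {z | ∀ᶠ w in 𝓝 z, Convergent φ k M e₀ w ∧
      1 / 2 < fderiv ℝ (fun p => limitTime φ M k (w.1, p)) w.2 (0, 1) ∧
      0 < IsFlightFamily.landing φ w ∧ w ∈ box e₀ M}
  have hS : IsOpen S := isOpen_setOfPred_eventually_nhds
  have hKS : ({(0 : ℝ)} ×ˢ coreRegion r) ⊆ S := by
    rintro ⟨e, p⟩ ⟨he, hp⟩
    rw [mem_singleton_iff] at he
    simp only at he hp
    subst he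
    exact h.core_eventually hM hp
  obtain ⟨δ, hδ, hsub⟩ := hK.exists_thickening_subset_open hS hKS
  refine ⟨min (δ / 4) (1 / 5), by positivity, by
    linarith [min_le_right (δ / 4) (1 / 5 : ℝ)], ?_⟩
  set μ := min (δ / 4) (1 / 5) with hμ
  have hμ0 : 0 < μ := by positivity
  have hμδ : μ ≤ δ / 4 := min_le_left _ _
  have hμ1 : μ ≤ 1 / 5 := min_le_right _ _
  intro e s t he hs ht ht' hst hst'
  refine (hsub ?_ : (e, s, t) ∈ S).self_of_nhds
  rw [Metric.mem_thickening_iff]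
  -- Clamping `t` to `[0, 4]` moves it by at most `μ`. Shifting `s` by `2 * μ` then restores both `s
  -- ≥ -1` and `s + t ≥ 3`.
  refine ⟨(0, s + 2 * μ, min (max t 0) 4), ⟨rfl, ?_⟩, ?_⟩
  · have h1 : min (max t 0) 4 ≤ t + μ := by
      refine (min_le_left _ _).trans (max_le (by linarith) (by linarith))
    have h2 : t - μ ≤ min (max t 0) 4 := by
      refine le_min ?_ (by linarith)
      linarith [le_max_left t 0]
    exact ⟨by simp only; linarith, le_min (le_max_right _ _) (by norm_num), min_le_right _ _,
      by simp only; linarith, by simp only; linarith⟩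
  · have h1 : |t - min (max t 0) 4| ≤ μ := by
      rw [abs_le]
      constructor
      · have : min (max t 0) 4 ≤ t + μ :=
          (min_le_left _ _).trans (max_le (by linarith) (by linarith))
        linarith
      · have : t - μ ≤ min (max t 0) 4 := by
          refine le_min ?_ (by linarith)
          linarith [le_max_left t 0]
        linarith
    rw [Prod.dist_eq, Prod.dist_eq, Real.dist_eq, Real.dist_eq, Real.dist_eq]
    simp only [sub_zero, max_lt_iff]
    refine ⟨by linarith, ?_, by linarith⟩
    rw [show s - (s + 2 * μ) = -(2 * μ) by ring, abs_neg, abs_of_pos (by linarith)]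
    linarith

/-- The launch speed is larger than that of shorter flights, except close to tangency. -/
theorem exists_no_early (h : IsScaledFamily Φ k r M e₀ φ) (hM : horizon r ≤ M) {κ : ℝ}
    (hκ : 0 < κ) :
    ∃ μ > 0, ∀ e s t t', |e| < μ → -1 - μ ≤ s → t ≤ 4 + μ → 3 - μ ≤ s + t →
      s + t ≤ reach r - 2 → 0 ≤ t' → t' < t → ¬ (|s + 1| < κ ∧ |t - 4| < κ ∧ t' < κ) →
      speed φ (e, s, t') < speed φ (e, s, t) := by
  have hMM := h.nine_le_reach
  set S : Set (ℝ × ℝ × ℝ × ℝ) := {z | ∀ᶠ w in 𝓝 z, w.2.2.2 < w.2.2.1 →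
    speed φ (w.1, w.2.1, w.2.2.2) < speed φ (w.1, w.2.1, w.2.2.1)} with hSdef
  have hS : IsOpen S := isOpen_setOfPred_eventually_nhds
  -- The diagonal `t' = t` is included to make `K` compact. Only a neighbourhood of `s = -1`, `t =
  -- 4`, `t' = 0` is cut out, where the divided difference of launch speeds degenerates.
  set K : Set (ℝ × ℝ × ℝ) := {p | (p.1, p.2.1) ∈ coreRegion r ∧ 0 ≤ p.2.2 ∧ p.2.2 ≤ p.2.1 ∧
    κ / 2 ≤ max (max |p.1 + 1| |p.2.1 - 4|) p.2.2} with hKdef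
  have hK : IsCompact K := by
    have hpre : IsCompact ((fun p : (ℝ × ℝ) × ℝ => (p.1.1, p.1.2, p.2)) ''
        (coreRegion r ×ˢ Icc (0 : ℝ) 4)) :=
      ((isCompact_coreRegion r).prod isCompact_Icc).image (by fun_prop)
    refine hpre.of_isClosed_subset ?_ ?_
    · have hcl : IsClosed (coreRegion r) := (isCompact_coreRegion r).isClosed
      have e1 := hcl.preimage (f := fun p : ℝ × ℝ × ℝ => (p.1, p.2.1)) (by fun_prop)
      have e2 : IsClosed {p : ℝ × ℝ × ℝ | 0 ≤ p.2.2} := isClosed_le (by fun_prop) (by fun_prop)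
      have e3 : IsClosed {p : ℝ × ℝ × ℝ | p.2.2 ≤ p.2.1} :=
        isClosed_le (by fun_prop) (by fun_prop)
      have e4 : IsClosed {p : ℝ × ℝ × ℝ | κ / 2 ≤ max (max |p.1 + 1| |p.2.1 - 4|) p.2.2} :=
        isClosed_le (by fun_prop) (by fun_prop)
      exact e1.inter (e2.inter (e3.inter e4))
    · rintro ⟨s, t, t'⟩ ⟨h1, h2, h3, -⟩
      exact ⟨((s, t), t'), ⟨h1, h2, h3.trans h1.2.2.1⟩, rfl⟩
  have hKS : ({(0 : ℝ)} ×ˢ K) ⊆ S := by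
    rintro ⟨e, s, t, t'⟩ ⟨he, hp, ht0, htt, hfar⟩
    rw [mem_singleton_iff] at he
    simp only at he hp ht0 htt hfar
    subst he
    obtain ⟨hs, ht, ht4, hst, hst'⟩ := hp
    simp only at hs ht ht4 hst hst'
    have hsM : |s| < M := abs_lt.2 ⟨by linarith, by linarith⟩
    have htM : |t| < M := abs_lt.2 ⟨by linarith, by linarith⟩
    have htM' : |t'| < M := abs_lt.2 ⟨by linarith, by linarith⟩
    have hq : ((0 : ℝ), s, t) ∈ box e₀ M := mem_box.2 ⟨by simpa using h.flight.e₀_pos, hsM, htM⟩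
    have hq' : ((0 : ℝ), s, t') ∈ box e₀ M :=
      mem_box.2 ⟨by simpa using h.flight.e₀_pos, hsM, htM'⟩
    have hP := baseSpeed_divided_pos hs hst ht0 (fun hcon => by
      obtain ⟨rfl, rfl, rfl⟩ := hcon
      norm_num at hfar
      linarith)
    -- Off the diagonal the strict inequality is open. On the diagonal the divided difference
    -- becomes the derivative in `t`, and its positivity gives local strict monotonicity.
    rcases htt.lt_or_eq with hlt | rfl
    · have h1 : speed φ (0, s, t') < speed φ (0, s, t) := by
        rw [h.speed_base hsM htM, h.speed_base hsM htM']
        have : t * baseLaunch s t - t' * baseLaunch s t' =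
            (t - t') * (baseLaunch s t + t' * (4 * s + t + t') / 12) := by
          unfold baseLaunch; ring
        have := mul_pos (by linarith : 0 < t - t') hP
        linarith
      have c1 : ContinuousAt (fun w : ℝ × ℝ × ℝ × ℝ => speed φ (w.1, w.2.1, w.2.2.2))
          (0, s, t, t') :=
        ContinuousAt.comp (g := speed φ) (f := fun w : ℝ × ℝ × ℝ × ℝ => (w.1, w.2.1, w.2.2.2))
          (h.flight.contDiffAt_speed hq').continuousAt (by fun_prop)
      have c2 : ContinuousAt (fun w : ℝ × ℝ × ℝ × ℝ => speed φ (w.1, w.2.1, w.2.2.1))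
          (0, s, t, t') :=
        ContinuousAt.comp (g := speed φ) (f := fun w : ℝ × ℝ × ℝ × ℝ => (w.1, w.2.1, w.2.2.1))
          (h.flight.contDiffAt_speed hq).continuousAt (by fun_prop)
      filter_upwards [c1.eventually_lt c2 h1] with w hw _ using hw
    · have hd : 0 < fderiv ℝ (speed φ) (0, s, t') (0, 0, 1) := by
        rw [h.flight.fderiv_speed_zero hsM htM]
        unfold baseLaunch at hP
        linarith
      have e1 := (h.flight.continuousAt_fderiv_speed hq (0, 0, 1)).eventually_const_lt
        (u := 0) hd
      obtain ⟨ε, hε, hball⟩ := Metric.eventually_nhds_iff_ball.1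
        (e1.and ((isOpen_box e₀ M).mem_nhds hq))
      filter_upwards [Metric.ball_mem_nhds _ hε] with w hw hlt
      obtain ⟨e, s₁, t₁, t₂⟩ := w
      simp only [Metric.mem_ball, Prod.dist_eq, Real.dist_eq, max_lt_iff] at hw
      obtain ⟨w1, w2, w3, w4⟩ := hw
      rw [abs_lt] at w3 w4
      have hmem : ∀ x ∈ Icc t₂ t₁, ((e, s₁, x) : ℝ × ℝ × ℝ) ∈ Metric.ball ((0 : ℝ), s, t') ε := by
        intro x hx
        simp only [Metric.mem_ball, Prod.dist_eq, Real.dist_eq, max_lt_iff]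
        exact ⟨w1, w2, abs_lt.2 ⟨by linarith [hx.1], by linarith [hx.2]⟩⟩
      have hder := fun x hx => h.flight.hasDerivAt_speed (hball _ (hmem x hx)).2
      have := strictMonoOn_of_deriv_pos (convex_Icc t₂ t₁) (f := fun x => speed φ (e, s₁, x))
        (fun x hx => (hder x hx).continuousAt.continuousWithinAt) (fun x hx => by
          rw [interior_Icc] at hx
          rw [(hder x (Ioo_subset_Icc_self hx)).deriv]
          exact (hball _ (hmem x (Ioo_subset_Icc_self hx))).1)
      simp only at hlt
      exact this (left_mem_Icc.2 hlt.le) (right_mem_Icc.2 hlt.le) hlt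
  obtain ⟨δ, hδ, hsub⟩ := (isCompact_singleton.prod hK).exists_thickening_subset_open hS hKS
  set μ := min (min (δ / 4) (κ / 4)) (1 / 5) with hμ
  have hμ0 : 0 < μ := by positivity
  have hμδ : μ ≤ δ / 4 := (min_le_left _ _).trans (min_le_left _ _)
  have hμκ : μ ≤ κ / 4 := (min_le_left _ _).trans (min_le_right _ _)
  have hμ1 : μ ≤ 1 / 5 := min_le_right _ _
  refine ⟨μ, hμ0, ?_⟩
  intro e s t t' he hs ht hst hst' ht0 htt hfar
  refine (hsub ?_ : (e, s, t, t') ∈ S).self_of_nhds htt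
  rw [Metric.mem_thickening_iff]
  refine ⟨(0, s + 2 * μ, min t 4, min t' 4), ⟨rfl, ?_⟩, ?_⟩
  · have h2 : t - μ ≤ min t 4 := le_min (by linarith) (by linarith)
    have h1 : min t 4 ≤ t := min_le_left _ _
    have h3 : t' - μ ≤ min t' 4 := le_min (by linarith) (by linarith)
    refine ⟨⟨by simp only; linarith, le_min (by linarith) (by norm_num), min_le_right _ _,
      by simp only; linarith, by simp only; linarith⟩, le_min ht0 (by norm_num),
      min_le_min_right _ htt.le, ?_⟩
    simp only
    by_contra hcon
    push Not at hcon
    rw [max_lt_iff, max_lt_iff, abs_lt, abs_lt] at hcon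
    obtain ⟨⟨a1, a2⟩, a3⟩ := hcon
    exact hfar ⟨abs_lt.2 ⟨by linarith [a1.1], by linarith [a1.2]⟩,
      abs_lt.2 ⟨by linarith [a2.1], by linarith [a2.2]⟩, by linarith⟩
  · have h2 : t - μ ≤ min t 4 := le_min (by linarith) (by linarith)
    have h1 : min t 4 ≤ t := min_le_left _ _
    have h3 : t' - μ ≤ min t' 4 := le_min (by linarith) (by linarith)
    have h4 : min t' 4 ≤ t' := min_le_left _ _
    simp only [Prod.dist_eq, Real.dist_eq, max_lt_iff, sub_zero]
    refine ⟨by linarith, abs_lt.2 ⟨by linarith, by linarith⟩, abs_lt.2 ⟨by linarith, by linarith⟩,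
      abs_lt.2 ⟨by linarith, by linarith⟩⟩

/-- Short flights close to the tangency have small launch speed. -/
theorem exists_speed_lt (h : IsScaledFamily Φ k r M e₀ φ) :
    ∃ κ > 0, κ < 1 ∧ ∀ e s sA t', |e| < κ → |s + 1| < κ → |sA + 1| < κ → 0 < t' → t' < κ →
      IsFlightFamily.launch φ (e, sA, 0) = 0 → speed φ (e, s, t') < 4 / 5 * (s - sA) ^ 2 := by
  have hMM := h.seven_le
  have hbox : ((0 : ℝ), (-1 : ℝ), (0 : ℝ)) ∈ box e₀ M :=
    mem_box.2 ⟨by simpa using h.flight.e₀_pos, by rw [abs_neg, abs_one]; linarith,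
      by rw [abs_zero]; linarith⟩
  have hopen := isOpen_box e₀ M
  have hl := h.flight.contDiffOn_launch.contDiffAt (hopen.mem_nhds hbox)
  have hlc : ∀ v, ContinuousAt (fun q => fderiv ℝ (IsFlightFamily.launch φ) q v) (0, -1, 0) :=
    fun v => (hl.fderiv_right (m := 0) (by simp)).continuousAt.clm_apply continuousAt_const
  have hd := (hl.differentiableAt one_ne_zero).hasFDerivAt
  have v1 : fderiv ℝ (IsFlightFamily.launch φ) (0, -1, 0) (0, 0, 1) = -1 / 3 := by
    have h1 : HasDerivAt (fun t => IsFlightFamily.launch φ (0, -1, t))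
        (fderiv ℝ (IsFlightFamily.launch φ) (0, -1, 0) (0, 0, 1)) 0 :=
      hasDerivAt_line_snd hd
    have h2 : HasDerivAt (fun t : ℝ => ((-1 : ℝ) ^ 2 - 1) / 2 + (-1) * t / 3 + t ^ 2 / 12)
        (-1 / 3) 0 := by
      have := (((hasDerivAt_id (0 : ℝ)).const_mul (-1)).div_const 3).const_add
        (((-1 : ℝ) ^ 2 - 1) / 2) |>.add ((hasDerivAt_pow 2 (0 : ℝ)).div_const 12)
      exact this.congr_deriv (by norm_num)
    refine h1.unique (h2.congr_of_eventuallyEq ?_)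
    filter_upwards [(isOpen_lt continuous_abs continuous_const).mem_nhds
      (show |(0 : ℝ)| < M by rw [abs_zero]; linarith)] with x hx
    exact h.flight.launch_zero (by rw [abs_neg, abs_one]; linarith) hx
  have v2 : fderiv ℝ (IsFlightFamily.launch φ) (0, -1, 0) (0, 1, 0) = -1 := by
    have h1 : HasDerivAt (fun s => IsFlightFamily.launch φ (0, s, 0))
        (fderiv ℝ (IsFlightFamily.launch φ) (0, -1, 0) (0, 1, 0)) (-1) :=
      hasDerivAt_line_fst hd
    have h2 : HasDerivAt (fun s : ℝ => (s ^ 2 - 1) / 2 + s * 0 / 3 + 0 ^ 2 / 12)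
        (-1) (-1) := by
      have := ((((hasDerivAt_pow 2 (-1 : ℝ)).sub_const 1).div_const 2).add
        (((hasDerivAt_id (-1 : ℝ)).mul_const 0).div_const 3)).add_const ((0 : ℝ) ^ 2 / 12)
      exact this.congr_deriv (by norm_num)
    refine h1.unique (h2.congr_of_eventuallyEq ?_)
    filter_upwards [(isOpen_lt continuous_abs continuous_const).mem_nhds
      (show |(-1 : ℝ)| < M by rw [abs_neg, abs_one]; linarith)] with x hx
    exact h.flight.launch_zero hx (by rw [abs_zero]; linarith)
  -- At the corner `launch` has derivatives `-1/3` in `t` and `-1` in `s`. The constants `-0.32` and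
  -- `1.005` leave a little room around them.
  have e1 := (hlc (0, 0, 1)).eventually_lt_const (u := -0.32) (by beta_reduce; rw [v1]; norm_num)
  have e2 := (hlc (0, 1, 0)).abs.eventually_lt_const (u := 1.005) (by beta_reduce; rw [v2]; norm_num)
  obtain ⟨ε, hε, hball⟩ := Metric.eventually_nhds_iff_ball.1
    (e1.and (e2.and (hopen.mem_nhds hbox)))
  have hmem : ∀ {e s t : ℝ}, |e| < ε → |s + 1| < ε → |t| < ε →
      ((e, s, t) : ℝ × ℝ × ℝ) ∈ Metric.ball ((0 : ℝ), (-1 : ℝ), (0 : ℝ)) ε := by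
    intro e s t he hs ht
    simp only [Metric.mem_ball, Prod.dist_eq, Real.dist_eq, max_lt_iff, sub_zero, sub_neg_eq_add]
    exact ⟨he, hs, ht⟩
  refine ⟨min ε (1 / 2), by positivity, by linarith [min_le_right ε (1 / 2)], ?_⟩
  intro e s sA t' he hs hsA ht0 ht hA
  have hm := min_le_left ε (1 / 2)
  have he' : |e| < ε := by linarith
  have hs' : |s + 1| < ε := by linarith
  have hsA' : |sA + 1| < ε := by linarith
  have hlaunch : ∀ {z}, z ∈ Metric.ball ((0 : ℝ), (-1 : ℝ), (0 : ℝ)) ε →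
      HasFDerivAt (IsFlightFamily.launch φ) (fderiv ℝ (IsFlightFamily.launch φ) z) z := fun hz =>
    ((h.flight.contDiffOn_launch.contDiffAt (hopen.mem_nhds (hball _ hz).2.2)).differentiableAt
      one_ne_zero).hasFDerivAt
  have f1 : IsFlightFamily.launch φ (e, s, t') - IsFlightFamily.launch φ (e, s, 0) ≤
      -0.32 * (t' - 0) := by
    refine (convex_Icc 0 t').image_sub_le_mul_sub_of_deriv_le
      (f := fun t => IsFlightFamily.launch φ (e, s, t)) (fun t ht => ?_) (fun t ht => ?_)
      (fun t ht => ?_) 0 (left_mem_Icc.2 ht0.le) t' (right_mem_Icc.2 ht0.le) ht0.le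
    all_goals
      have hb : ∀ t ∈ Icc 0 t', HasDerivAt (fun t => IsFlightFamily.launch φ (e, s, t))
          (fderiv ℝ (IsFlightFamily.launch φ) (e, s, t) (0, 0, 1)) t := fun t ht => by
        have hz := hmem he' hs' (t := t) (abs_lt.2 ⟨by linarith [ht.1], by linarith [ht.2]⟩)
        exact hasDerivAt_line_snd (hlaunch hz)
    · exact (hb t ht).continuousAt.continuousWithinAt
    · rw [interior_Icc] at ht
      exact (hb t (Ioo_subset_Icc_self ht)).differentiableAt.differentiableWithinAt
    · rw [interior_Icc] at ht
      rw [(hb t (Ioo_subset_Icc_self ht)).deriv]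
      exact (hball _ (hmem he' hs' (abs_lt.2 ⟨by linarith [ht.1], by linarith [ht.2]⟩))).1.le
  have f2 : |IsFlightFamily.launch φ (e, s, 0) - IsFlightFamily.launch φ (e, sA, 0)| ≤
      1.005 * |s - sA| := by
    have hconv : Convex ℝ {x : ℝ | |x + 1| < ε} := by
      have : {x : ℝ | |x + 1| < ε} = Ioo (-1 - ε) (-1 + ε) := by
        ext x
        simp only [mem_ofPred_eq, abs_lt, mem_Ioo]
        constructor <;> rintro ⟨a, b⟩ <;> constructor <;> linarith
      rw [this]; exact convex_Ioo _ _
    exact hconv.norm_image_sub_le_of_norm_hasDerivWithin_le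
      (f := fun s => IsFlightFamily.launch φ (e, s, 0))
      (f' := fun s => fderiv ℝ (IsFlightFamily.launch φ) (e, s, 0) (0, 1, 0))
      (fun x hx => (hasDerivAt_line_fst
        (hlaunch (hmem he' hx (by simpa using hε)))).hasDerivWithinAt)
      (fun x hx => (hball _ (hmem he' hx (by simpa using hε))).2.1.le) hsA' hs'
  rw [hA, sub_zero] at f2
  have f3 := (le_abs_self _).trans f2
  have f4 : IsFlightFamily.launch φ (e, s, t') ≤ 1.005 * |s - sA| - 0.32 * t' := by linarith
  have f5 := mul_le_mul_of_nonneg_left f4 ht0.le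
  change t' * IsFlightFamily.launch φ (e, s, t') < _
  have f6 : (s - sA) ^ 2 = |s - sA| ^ 2 := (sq_abs _).symm
  rw [f6]
  set d := |s - sA|
  -- It remains that `t' * (1.005 * d - 0.32 * t')` stays below `4/5 * d²`, which holds because
  -- `1.005²` is less than `4 * 0.8 * 0.32`. With exact constants the maximum would be `3/4 * d²`.
  nlinarith [sq_nonneg (d - 0.628 * t'), mul_pos ht0 ht0]

end IsScaledFamily

theorem FiberC1At.exists_lipschitz {E G : Type*} [NormedAddCommGroup E] [NormedSpace ℝ E]
    [NormedAddCommGroup G] [NormedSpace ℝ G] {F : ℝ × E → G} {e₁ : ℝ} {p₀ : E}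
    (h : FiberC1At F (e₁, p₀)) :
    ∃ C ≥ 0, ∃ ε > 0, ∀ e p p', |e - e₁| < ε → ‖p - p₀‖ < ε → ‖p' - p₀‖ < ε →
      ‖F (e, p) - F (e, p')‖ ≤ C * ‖p - p'‖ := by
  obtain ⟨F', hF'⟩ := h
  have hc : ∀ᶠ w in 𝓝 (e₁, p₀), ‖F' w‖ < ‖F' (e₁, p₀)‖ + 1 :=
    hF'.self_of_nhds.2.1.norm.eventually_lt continuousAt_const (by linarith)
  obtain ⟨ε, hε, hball⟩ := Metric.eventually_nhds_iff_ball.1 (hF'.and hc)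
  refine ⟨‖F' (e₁, p₀)‖ + 1, by positivity, ε, hε, fun e p p' he hp hp' => ?_⟩
  have hmem : ∀ x ∈ Metric.ball p₀ ε, (e, x) ∈ Metric.ball (e₁, p₀) ε := fun x hx => by
    rw [Metric.mem_ball, Prod.dist_eq, max_lt_iff]
    exact ⟨by rwa [Real.dist_eq], hx⟩
  exact (convex_ball p₀ ε).norm_image_sub_le_of_norm_hasFDerivWithin_le
    (f := fun p => F (e, p)) (f' := fun p => F' (e, p))
    (fun x hx => (hball _ (hmem x hx)).1.1.hasFDerivWithinAt)
    (fun x hx => (hball _ (hmem x hx)).2.le) (by rwa [mem_ball_iff_norm])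
    (by rwa [mem_ball_iff_norm])

/-! ### Impact orbits and the tangential flight -/

/-- `z n = (s n, t n)` are the starting times and durations of consecutive flights; the motion
comes to rest at time `σ`. -/
structure IsImpactOrbit (φ : ℝ × ℝ × ℝ → Path01) (k : ℝ × ℝ → ℝ) (M e₀ e σ : ℝ)
    (z : ℕ → ℝ × ℝ) : Prop where
  mem : ∀ n, (e, z n) ∈ box e₀ M
  pos : ∀ n, 0 < (z n).2
  landing_pos : ∀ n, 0 < IsFlightFamily.landing φ (e, z n)
  not_early : ∀ n, ∀ t ∈ Ioo 0 (z n).2, speed φ (e, (z n).1, t) ≠ speed φ (e, z n)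
  time : ∀ n, (z (n + 1)).1 = (z n).1 + (z n).2
  restitution : ∀ n, speed φ (e, z (n + 1)) = impact φ (e, z n) * k (e, impact φ (e, z n))
  tendsto : Tendsto z atTop (𝓝 (σ, 0))

namespace IsScaledFamily

variable {Φ : ℝ × ℝ × ℝ × ℝ → ℝ} {k : ℝ × ℝ → ℝ} {r M e₀ : ℝ} {φ : ℝ × ℝ × ℝ → Path01}

/-- Early impacts have to be excluded by hypothesis for the first flight only. Later flights start
in the window where the launch speed is strictly increasing in the duration. -/
theorem Convergent.exists_orbit (h : IsScaledFamily Φ k r M e₀ φ) {e s t : ℝ}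
    (hz : Convergent φ k M e₀ (e, s, t)) (he : 0 < e) (ht : 0 < t)
    (hland : 0 < IsFlightFamily.landing φ (e, s, t))
    (hne : ∀ t' ∈ Ioo 0 t, speed φ (e, s, t') ≠ speed φ (e, s, t)) :
    ∃ z, z 0 = (s, t) ∧ IsImpactOrbit φ k M e₀ e (limitTime φ M k (e, s, t)) z := by
  have hM := h.seven_le
  set T := shiftMap (nextDuration φ M k) with hT
  have hfst : ∀ n, (T^[n] (e, s, t)) = (e, (T^[n] (e, s, t)).2) := fun n =>
    Prod.ext (shiftMap_iterate_fst _ _ _) rfl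
  have hreg : ∀ n, Regular φ k M e₀ (e, (T^[n] (e, s, t)).2) := fun n => by
    rw [← hfst]; exact hz.regular n
  have hsucc : ∀ n, (T^[n + 1] (e, s, t)).2 = ((T^[n] (e, s, t)).2.1 + (T^[n] (e, s, t)).2.2,
      nextDuration φ M k (e, (T^[n] (e, s, t)).2)) := fun n => by
    rw [Function.iterate_succ_apply', ← hfst]; rfl
  have hhe : |e| < e₀ := (mem_box.1 (hreg 0).mem).1
  have hpos : ∀ n, 0 < (T^[n] (e, s, t)).2.2 ∧
      0 < IsFlightFamily.landing φ (e, (T^[n] (e, s, t)).2) ∧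
      ∀ t' ∈ Ioo 0 (T^[n] (e, s, t)).2.2, speed φ (e, (T^[n] (e, s, t)).2.1, t') ≠
        speed φ (e, (T^[n] (e, s, t)).2) := by
    intro n
    induction n with
    | zero => exact ⟨ht, hland, hne⟩
    | succ n ih =>
      obtain ⟨i1, i2, -⟩ := ih
      have hr := hreg n
      rw [hsucc n]
      have hp := Regular.nextDuration_pos h (s := (T^[n] (e, s, t)).2.1)
        (t := (T^[n] (e, s, t)).2.2) hr he (mul_pos i1 i2)
      have h2 := Ioo_subset_Icc_self hr.next_mem
      have h3 := Ioo_subset_Icc_self hr.time_mem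
      refine ⟨hp, h.landing_pos _ _ _ hhe h3 h2, fun t' ht' => ?_⟩
      exact (h.strictMonoOn_speed hhe h3 ⟨by linarith [ht'.1], ht'.2.le.trans h2.2⟩ h2 ht'.2).ne
  refine ⟨fun n => (T^[n] (e, s, t)).2, rfl, fun n => (hreg n).mem, fun n => (hpos n).1,
    fun n => (hpos n).2.1, fun n => (hpos n).2.2, fun n => ?_, fun n => ?_, ?_⟩
  · simp only [hsucc n]
  · simp only [hsucc n]
    exact (hreg n).speed_next
  · have c1 := tendsto_of_summable_stepLength hz.summable
    have c2 := hz.summable.tendsto_atTop_zero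
    unfold stepLength at c2
    exact c1.prodMk_nhds c2

theorem base_corner_mem (h : IsScaledFamily Φ k r M e₀ φ) : ((-1, 4) : ℝ × ℝ) ∈ coreRegion r := by
  have := h.nine_le_reach
  exact ⟨le_rfl, by norm_num, le_rfl, by norm_num, by simp only; linarith⟩

theorem corner_box (h : IsScaledFamily Φ k r M e₀ φ) {t : ℝ} (ht : |t| < M) :
    ((0 : ℝ), (-1 : ℝ), t) ∈ box e₀ M :=
  mem_box.2 ⟨by simpa using h.flight.e₀_pos, by
    have := h.seven_le
    rw [abs_neg, abs_one]; linarith, ht⟩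

/-- For small `e` there is a flight leaving and landing like the tangential flight. -/
theorem exists_tangential (h : IsScaledFamily Φ k r M e₀ φ) {κ : ℝ} (hκ : 0 < κ) :
    ∃ e₁ > 0, ∀ e, |e| < e₁ → ∃ sA tA, |sA + 1| < κ ∧ |tA - 4| < κ ∧
      IsFlightFamily.launch φ (e, sA, 0) = 0 ∧ IsFlightFamily.launch φ (e, sA, tA) = 0 := by
  have hM := h.seven_le
  have hopen := isOpen_box e₀ M
  have hcont : ∀ q ∈ box e₀ M, ContinuousAt (IsFlightFamily.launch φ) q := fun q hq =>
    (h.flight.contDiffOn_launch.contDiffAt (hopen.mem_nhds hq)).continuousAt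
  set d := min κ 1 / 2 with hd
  have hd0 : 0 < d := by positivity
  have hdκ : d < κ := by linarith [min_le_left κ 1]
  have hd1 : d ≤ 1 / 2 := by linarith [min_le_right κ 1]
  have hj : ∀ t : ℝ, ContinuousAt (fun w : ℝ × ℝ => (w.1, w.2, t)) (0, -1) := fun t => by fun_prop
  -- At `e = 0` and `s = -1` the launch factor is `t * (t - 4) / 12`, which changes sign at `t = 4`.
  -- The sign change persists for nearby `(e, s)`.
  have s1 : ∀ᶠ w : ℝ × ℝ in 𝓝 (0, -1), 0 < IsFlightFamily.launch φ (w.1, w.2, 4 + d) ∧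
      IsFlightFamily.launch φ (w.1, w.2, 4 - d) < 0 ∧
      ∀ t ∈ Icc (4 - d) (4 + d), (w.1, w.2, t) ∈ box e₀ M := by
    have b1 : |4 + d| < M := abs_lt.2 ⟨by linarith, by linarith⟩
    have b2 : |4 - d| < M := abs_lt.2 ⟨by linarith, by linarith⟩
    have b1' : |(-1 : ℝ)| < M := by rw [abs_neg, abs_one]; linarith
    have c1 := (hcont _ (h.corner_box b1)).eventually_const_lt (u := 0) (by
      rw [h.flight.launch_zero b1' b1]; nlinarith)
    have c2 := (hcont _ (h.corner_box b2)).eventually_lt_const (u := 0) (by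
      rw [h.flight.launch_zero b1' b2]; nlinarith)
    filter_upwards [(hj _).eventually c1, (hj _).eventually c2,
      (hj 0).eventually (hopen.mem_nhds (h.corner_box (by rw [abs_zero]; linarith)))]
      with w w1 w2 w3
    refine ⟨w1, w2, fun t ht => ?_⟩
    obtain ⟨w4, w5, -⟩ := mem_box.1 w3
    exact mem_box.2 ⟨w4, w5, abs_lt.2 ⟨by linarith [ht.1], by linarith [ht.2]⟩⟩
  obtain ⟨ε, hε, hball⟩ := Metric.eventually_nhds_iff_ball.1 s1
  set d' := min d (ε / 2) with hd'
  have hd'0 : 0 < d' := by positivity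
  have hd'd : d' ≤ d := min_le_left _ _
  have hd'ε : d' < ε := by linarith [min_le_right d (ε / 2)]
  have hi : ∀ s : ℝ, ContinuousAt (fun e : ℝ => (e, s, (0 : ℝ))) 0 := fun s => by fun_prop
  have b0 : |(0 : ℝ)| < M := by rw [abs_zero]; linarith
  have b1 : |-1 - d'| < M := abs_lt.2 ⟨by linarith, by linarith⟩
  have b2 : |-1 + d'| < M := abs_lt.2 ⟨by linarith, by linarith⟩
  have m1 : ((0 : ℝ), -1 - d', (0 : ℝ)) ∈ box e₀ M :=
    mem_box.2 ⟨by simpa using h.flight.e₀_pos, b1, b0⟩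
  have m2 : ((0 : ℝ), -1 + d', (0 : ℝ)) ∈ box e₀ M :=
    mem_box.2 ⟨by simpa using h.flight.e₀_pos, b2, b0⟩
  have c1 := (hi _).eventually ((hcont _ m1).eventually_const_lt (u := 0) (by
      rw [h.flight.launch_zero b1 b0]; nlinarith))
  have c2 := (hi _).eventually ((hcont _ m2).eventually_lt_const (u := 0) (by
      rw [h.flight.launch_zero b2 b0]; nlinarith))
  obtain ⟨e₁, he₁, hb⟩ := Metric.eventually_nhds_iff_ball.1
    (c1.and (c2.and ((hi _).eventually (hopen.mem_nhds m1))))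
  refine ⟨min e₁ ε, lt_min he₁ hε, fun e he => ?_⟩
  obtain ⟨p1, p2, p3⟩ := hb e (by simpa using he.trans_le (min_le_left _ _))
  have he0 : |e| < e₀ := (mem_box.1 p3).1
  have hcs : ContinuousOn (fun s => IsFlightFamily.launch φ (e, s, 0)) (Icc (-1 - d') (-1 + d')) := by
    intro s hs
    refine (ContinuousAt.comp (g := IsFlightFamily.launch φ) (f := fun s : ℝ => (e, s, (0 : ℝ)))
      (hcont _ (mem_box.2 ⟨he0, ?_, b0⟩)) (by fun_prop)).continuousWithinAt
    exact abs_lt.2 ⟨by linarith [hs.1], by linarith [hs.2]⟩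
  obtain ⟨sA, hsA, hA⟩ := intermediate_value_Icc' (by linarith) hcs ⟨p2.le, p1.le⟩
  have hsA' : |sA + 1| ≤ d' := abs_le.2 ⟨by linarith [hsA.1], by linarith [hsA.2]⟩
  obtain ⟨q1, q2, q3⟩ := hball (e, sA) (by
    rw [Metric.mem_ball, Prod.dist_eq, max_lt_iff, Real.dist_eq, Real.dist_eq]
    simp only [sub_zero, sub_neg_eq_add]
    exact ⟨he.trans_le (min_le_right _ _), hsA'.trans_lt hd'ε⟩)
  have hct : ContinuousOn (fun t => IsFlightFamily.launch φ (e, sA, t)) (Icc (4 - d) (4 + d)) := by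
    intro t ht
    exact (ContinuousAt.comp (g := IsFlightFamily.launch φ) (f := fun t : ℝ => (e, sA, t))
      (hcont _ (q3 t ht)) (by fun_prop)).continuousWithinAt
  obtain ⟨tA, htA, hA'⟩ := intermediate_value_Icc (by linarith) hct ⟨q2.le, q1.le⟩
  exact ⟨sA, tA, by linarith, (abs_le.2 ⟨by linarith [htA.1], by linarith [htA.2]⟩ :
    |tA - 4| ≤ d).trans_lt hdκ, hA, hA'⟩

/-- Near the tangential flight the launch speed increases with the duration, at a bounded rate. -/
theorem exists_speed_strictMono (h : IsScaledFamily Φ k r M e₀ φ) :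
    ∃ κ > 0, κ < 1 ∧ ∃ L > 0, ∀ e s, |e| < κ → |s + 1| < κ →
      StrictMonoOn (fun t => speed φ (e, s, t)) (Ioo (4 - κ) (4 + κ)) ∧
      (∀ t ∈ Ioo (4 - κ) (4 + κ), (e, s, t) ∈ box e₀ M) ∧
      ∀ t ∈ Ioo (4 - κ) (4 + κ), ∀ t' ∈ Ioo (4 - κ) (4 + κ),
        |speed φ (e, s, t) - speed φ (e, s, t')| ≤ L * |t - t'| := by
  have hM := h.seven_le
  have hb : |(4 : ℝ)| < M := by rw [abs_of_pos (by norm_num)]; linarith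
  have hbox := h.corner_box hb
  obtain ⟨C, hC, ε, hε, hlip⟩ :=
    (FiberC1At.of_contDiffAt (h.flight.contDiffAt_speed hbox)).exists_lipschitz
  have e1 := (h.flight.continuousAt_fderiv_speed hbox (0, 0, 1)).eventually_const_lt (u := 0) (by
    beta_reduce
    rw [h.flight.fderiv_speed_zero (by rw [abs_neg, abs_one]; linarith) hb]; norm_num)
  obtain ⟨ε', hε', hball⟩ := Metric.eventually_nhds_iff_ball.1
    (e1.and ((isOpen_box e₀ M).mem_nhds hbox))
  have hmem : ∀ {e s t : ℝ}, |e| < ε' → |s + 1| < ε' → |t - 4| < ε' →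
      ((e, s, t) : ℝ × ℝ × ℝ) ∈ Metric.ball ((0 : ℝ), (-1 : ℝ), (4 : ℝ)) ε' := by
    intro e s t he hs ht
    simp only [Metric.mem_ball, Prod.dist_eq, Real.dist_eq, max_lt_iff, sub_zero, sub_neg_eq_add]
    exact ⟨he, hs, ht⟩
  set κ := min (min ε ε') (1 / 2) with hκ
  have k1 : κ ≤ ε := (min_le_left _ _).trans (min_le_left _ _)
  have k2 : κ ≤ ε' := (min_le_left _ _).trans (min_le_right _ _)
  refine ⟨κ, by positivity, by linarith [min_le_right (min ε ε') (1 / 2)], C + 1, by linarith, ?_⟩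
  intro e s he hs
  have hin : ∀ t ∈ Ioo (4 - κ) (4 + κ), |t - 4| < κ := fun t ht =>
    abs_lt.2 ⟨by linarith [ht.1], by linarith [ht.2]⟩
  have hz : ∀ t ∈ Ioo (4 - κ) (4 + κ), ((e, s, t) : ℝ × ℝ × ℝ) ∈
      Metric.ball ((0 : ℝ), (-1 : ℝ), (4 : ℝ)) ε' := fun t ht =>
    hmem (he.trans_le k2) (hs.trans_le k2) ((hin t ht).trans_le k2)
  have hder := fun t ht => h.flight.hasDerivAt_speed (hball _ (hz t ht)).2
  refine ⟨?_, fun t ht => (hball _ (hz t ht)).2, fun t ht t' ht' => ?_⟩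
  · refine strictMonoOn_of_deriv_pos (convex_Ioo _ _)
      (fun t ht => (hder t ht).continuousAt.continuousWithinAt) fun t ht => ?_
    rw [interior_Ioo] at ht
    rw [(hder t ht).deriv]
    exact (hball _ (hz t ht)).1
  · have hp : ∀ t ∈ Ioo (4 - κ) (4 + κ), ‖((s, t) : ℝ × ℝ) - (-1, 4)‖ < ε := fun t ht => by
      rw [Prod.mk_sub_mk, Prod.norm_def, max_lt_iff, Real.norm_eq_abs, Real.norm_eq_abs]
      simp only [sub_neg_eq_add]
      exact ⟨hs.trans_le k1, (hin t ht).trans_le k1⟩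
    have := hlip e (s, t) (s, t') (by simpa using he.trans_le k1) (hp t ht) (hp t' ht')
    rw [Prod.mk_sub_mk, sub_self, Prod.norm_def, norm_zero, Real.norm_eq_abs,
      max_eq_right (norm_nonneg _), Real.norm_eq_abs] at this
    refine this.trans ?_
    have := abs_nonneg (t - t')
    linarith

/-- Flights landing simultaneously with the tangential one have nearly the same limit. -/
theorem exists_limit_compare (h : IsScaledFamily Φ k r M e₀ φ) (hM : horizon r ≤ M) :
    ∃ κ > 0, ∃ C > 0, ∀ e sA tA s, |e| < κ → |sA + 1| < κ → |tA - 4| < κ → |s - sA| < κ →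
      IsFlightFamily.launch φ (e, sA, 0) = 0 → IsFlightFamily.launch φ (e, sA, tA) = 0 →
      |speed φ (e, s, sA + tA - s) - (s - sA) ^ 2| ≤ (s - sA) ^ 2 / 10 ∧
      |limitTime φ M k (e, s, sA + tA - s) - limitTime φ M k (e, sA, tA)| ≤ C * |s - sA| ^ 3 := by
  have hMM := h.nine_le_reach
  obtain ⟨κ₁, hκ₁, C, hC, e₁, he₁, hcmp⟩ := h.flight.compare_with_tangential h.seven_le
  have hb1 : |(-1 : ℝ)| < M := by rw [abs_neg, abs_one]; linarith
  have hb4 : |(4 : ℝ)| < M := by rw [abs_of_pos (by norm_num)]; linarith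
  have hconv := h.core_eventually hM h.base_corner_mem
  -- The unperturbed tangential flight lands at time `3` with speed `16/3`, and `(3² - 1) / 2 = 4`,
  -- so the next duration is at most `4/3`.
  obtain ⟨g1, g2, g3, g4⟩ := h.exists_next_base (s := -1) (t := 4) (X := 4 / 3) hb1 hb4
    (by norm_num) (by linarith) (by norm_num) (by norm_num) (by norm_num) (by linarith) (by
      have := h.r_lt_one
      unfold baseLaunch; norm_num; linarith)
  set t₁ := nextDuration φ M k (0, -1, 4) with ht₁
  have hcore : ((3, t₁) : ℝ × ℝ) ∈ coreRegion r :=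
    ⟨by norm_num, g2, by simp only; linarith, by simp only; linarith, by simp only; linarith⟩
  have hΘ := (h.core_eventually hM hcore).self_of_nhds.1.fiberC1At
  have himp0 : impact φ (0, -1, 4) = 16 / 3 := by
    rw [h.impact_base hb1 hb4]; unfold baseLaunch; norm_num
  -- The limit as a function of landing time and landing speed. The two flights share the landing
  -- time, so a Lipschitz bound for `H` turns the cubic difference of landing speeds into a cubic
  -- difference of limits.
  let H : ℝ × ℝ × ℝ → ℝ := fun z =>
    limitTime φ M k (z.1, z.2.1, duration φ M (z.1, z.2.1, z.2.2 * k (z.1, z.2.2)))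
  have hH : FiberC1At H (0, 3, 16 / 3) := by
    have f1 : FiberC1At (fun z : ℝ × ℝ × ℝ => z.2.1) (0, 3, 16 / 3) :=
      FiberC1At.of_contDiffAt (by fun_prop)
    have f2 : FiberC1At (fun z : ℝ × ℝ × ℝ => z.2.2) (0, 3, 16 / 3) :=
      FiberC1At.of_contDiffAt (by fun_prop)
    have f3 : FiberC1At (fun z : ℝ × ℝ × ℝ => z.2.2 * k (z.1, z.2.2)) (0, 3, 16 / 3) :=
      FiberC1At.comp (F := fun z : ℝ × ℝ => z.2 * k z) (h.fiberC1 _) f2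
    have hsp := g1.speed_next
    have htm := g1.time_mem
    simp only [himp0, show (-1 : ℝ) + 4 = 3 by norm_num] at hsp htm
    have hdur := (h.contDiffAt_duration (e := 0) (by simpa using h.flight.e₀_pos) htm g1.next_mem
      hsp).1
    have hdeq : duration φ M (0, 3, 16 / 3 * k (0, 16 / 3)) = t₁ :=
      h.duration_eq (by simpa using h.flight.e₀_pos) (Ioo_subset_Icc_self htm) g1.next_mem hsp
    have f4 : FiberC1At (fun z : ℝ × ℝ × ℝ =>
        duration φ M (z.1, z.2.1, z.2.2 * k (z.1, z.2.2))) (0, 3, 16 / 3) :=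
      FiberC1At.comp (F := duration φ M) (FiberC1At.of_contDiffAt hdur) (f1.prodMk f3)
    refine FiberC1At.comp (F := limitTime φ M k) ?_ (f1.prodMk f4)
    simp only [hdeq]
    exact hΘ
  obtain ⟨C', hC', ε, hε, hlip⟩ := hH.exists_lipschitz
  have hcont : ContinuousAt (fun z : ℝ × ℝ × ℝ => (z.2.1 + z.2.2, impact φ z)) (0, -1, 4) :=
    ContinuousAt.prodMk (by fun_prop)
      (h.flight.contDiffAt_impact (h.corner_box hb4)).continuousAt
  have hnear : ∀ᶠ z in 𝓝 ((0 : ℝ), (-1 : ℝ), (4 : ℝ)),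
      ‖((z.2.1 + z.2.2, impact φ z) : ℝ × ℝ) - (3, 16 / 3)‖ < ε := by
    have := hcont.eventually (Metric.ball_mem_nhds _ hε)
    filter_upwards [this] with z hz
    rwa [dist_eq_norm, himp0, show (-1 : ℝ) + 4 = 3 by norm_num] at hz
  obtain ⟨ε', hε', hball⟩ := Metric.eventually_nhds_iff_ball.1 (hconv.and hnear)
  have hmem : ∀ {e s t : ℝ}, |e| < ε' → |s + 1| < ε' → |t - 4| < ε' →
      ((e, s, t) : ℝ × ℝ × ℝ) ∈ Metric.ball ((0 : ℝ), (-1 : ℝ), (4 : ℝ)) ε' := by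
    intro e s t he hs ht
    simp only [Metric.mem_ball, Prod.dist_eq, Real.dist_eq, max_lt_iff, sub_zero, sub_neg_eq_add]
    exact ⟨he, hs, ht⟩
  have hlimit : ∀ {e s t : ℝ}, Convergent φ k M e₀ (e, s, t) →
      limitTime φ M k (e, s, t) = H (e, s + t, impact φ (e, s, t)) := fun hz =>
    (limitPoint_shift hz.summable).symm
  set κ := min (min κ₁ e₁) (min (ε' / 3) ε) with hκ
  have k1 : κ ≤ κ₁ := (min_le_left _ _).trans (min_le_left _ _)
  have k2 : κ ≤ e₁ := (min_le_left _ _).trans (min_le_right _ _)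
  have k3 : κ ≤ ε' / 3 := (min_le_right _ _).trans (min_le_left _ _)
  have k4 : κ ≤ ε := (min_le_right _ _).trans (min_le_right _ _)
  refine ⟨κ, by positivity, C' * C + 1, by positivity, ?_⟩
  intro e sA tA s he hsA htA hs hl1 hl2
  obtain ⟨j1, j2⟩ := hcmp e (by linarith) sA tA s (by linarith) (by linarith) (by linarith) hl1 hl2
  refine ⟨j1, ?_⟩
  have hm1 := hball _ (hmem (e := e) (s := sA) (t := tA) (by linarith) (by linarith) (by linarith))
  have hm2 := hball _ (hmem (e := e) (s := s) (t := sA + tA - s) (by linarith)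
    (by rw [abs_lt] at *; constructor <;> linarith) (by rw [abs_lt] at *; constructor <;> linarith))
  rw [hlimit hm1.1.1, hlimit hm2.1.1]
  have hadd : s + (sA + tA - s) = sA + tA := by ring
  have h3 := hlip e _ _ (by simpa using he.trans_le k4) hm2.2 hm1.2
  simp only [hadd] at h3 ⊢
  rw [Prod.mk_sub_mk, sub_self, Prod.norm_def, norm_zero, max_eq_right (norm_nonneg _),
    Real.norm_eq_abs, Real.norm_eq_abs] at h3
  refine h3.trans ?_
  have h4 : |impact φ (e, s, sA + tA - s) - impact φ (e, sA, tA)| ≤ C * |s - sA| ^ 3 := j2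
  have h5 := mul_le_mul_of_nonneg_left h4 hC'
  have h6 : 0 ≤ |s - sA| ^ 3 := by positivity
  linarith

end IsScaledFamily

/-! ### The leaf of orbits with a given limit -/

/-- Lower end of the band of durations considered at the starting time `s`. -/
noncomputable def bandBottom (μ s : ℝ) : ℝ := max (3 - s) 0 - μ

theorem continuous_bandBottom (μ : ℝ) : Continuous (bandBottom μ) := by
  unfold bandBottom; fun_prop

theorem bandBottom_ge (μ s : ℝ) : -μ ≤ bandBottom μ s ∧ 3 - s - μ ≤ bandBottom μ s := by
  unfold bandBottom
  constructor <;> linarith [le_max_left (3 - s) 0, le_max_right (3 - s) 0]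

theorem bandBottom_le {μ s x : ℝ} (h1 : 3 - s - μ ≤ x) (h2 : -μ ≤ x) : bandBottom μ s ≤ x := by
  unfold bandBottom
  have : max (3 - s) 0 ≤ x + μ := max_le (by linarith) (by linarith)
  linarith

namespace IsScaledFamily

variable {Φ : ℝ × ℝ × ℝ × ℝ → ℝ} {k : ℝ × ℝ → ℝ} {r M e₀ : ℝ} {φ : ℝ × ℝ × ℝ → Path01}

/-- After landing at time `3` with speed `16/3` the remaining steps add at most `(16/3) / (4 * (1 -
r))`. The constants in `reach` leave room above this limit for durations slightly over `4`. -/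
theorem base_limit_bounds (h : IsScaledFamily Φ k r M e₀ φ) (hM : horizon r ≤ M) :
    3 ≤ limitTime φ M k (0, -1, 4) ∧ limitTime φ M k (0, -1, 4) + 4 + 8 / 3 + 2 ≤ reach r := by
  obtain ⟨-, -, -, -, h1, h2, -⟩ := h.base_orbit hM (core_subset _ h.base_corner_mem)
  have hr := h.r_lt_one
  have hr0 := h.r_pos
  refine ⟨h1, ?_⟩
  have h4 : (4 : ℝ) * baseLaunch (-1 + 4) (-4) = 16 / 3 := by unfold baseLaunch; norm_num
  rw [h4] at h2
  have h5 : (16 / 3) / (4 * (1 - r)) = 4 / (1 - r) - (8 / 3) / (1 - r) := by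
    have : 1 - r ≠ 0 := by linarith
    field_simp; norm_num
  have h6 : 8 / 3 < (8 / 3) / (1 - r) := by
    rw [lt_div_iff₀ (by linarith)]; linarith
  have : limitTime φ M k (0, -1, 4) ≤ -1 + 4 + (4 / (1 - r) - (8 / 3) / (1 - r)) := by
    rw [← h5]; exact h2
  unfold reach
  linarith

/-- At `e = 0` monotonicity from the corner flight puts the limit at least at its reference value
for `t = 4`, and at most there on the lower edge of the core. The slope `1/2` pushes it past this
value by `μ / 2` once the band is widened by `μ` at both edges. Compactness in `s` and openness
extend half of that margin to small `e`. -/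
theorem exists_leaf_band (h : IsScaledFamily Φ k r M e₀ φ) (hM : horizon r ≤ M) {μ₁ : ℝ}
    (hμ₁ : 0 < μ₁) :
    ∃ μ > 0, μ ≤ μ₁ ∧ μ < 1 / 8 ∧ ∃ ν > 0, ν < μ ∧ ∀ e s, |e| < ν → -1 - ν < s →
      s < limitTime φ M k (0, -1, 4) + ν →
      (∀ t ∈ Icc (bandBottom μ s) (4 + μ), Convergent φ k M e₀ (e, s, t) ∧
        1 / 2 < fderiv ℝ (fun p => limitTime φ M k (e, p)) (s, t) (0, 1) ∧
        0 < IsFlightFamily.landing φ (e, s, t) ∧ (e, s, t) ∈ box e₀ M) ∧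
      limitTime φ M k (e, s, bandBottom μ s) < limitTime φ M k (0, -1, 4) - μ / 4 ∧
      limitTime φ M k (0, -1, 4) + μ / 4 < limitTime φ M k (e, s, 4 + μ) := by
  obtain ⟨μ₀, hμ₀, hμ₀1, hband⟩ := h.exists_band hM
  obtain ⟨hσ3, hσr⟩ := h.base_limit_bounds hM
  have hMM := h.nine_le_reach
  set σ := limitTime φ M k (0, -1, 4) with hσ
  set μ := min (μ₀ / 2) μ₁ with hμ
  have hμ0 : 0 < μ := by positivity
  have hμμ : μ ≤ μ₀ / 2 := min_le_left _ _
  have hz : ∀ e s t, |e| < μ₀ → -1 - μ₀ ≤ s → s ≤ σ + 1 → t ∈ Icc (bandBottom μ s) (4 + μ) →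
      Convergent φ k M e₀ (e, s, t) ∧
        1 / 2 < fderiv ℝ (fun p => limitTime φ M k (e, p)) (s, t) (0, 1) ∧
        0 < IsFlightFamily.landing φ (e, s, t) ∧ (e, s, t) ∈ box e₀ M := by
    intro e s t he hs hs' ht
    obtain ⟨b1, b2⟩ := bandBottom_ge μ s
    exact hband e s t he hs (by linarith [ht.1]) (by linarith [ht.2]) (by linarith [ht.1])
      (by linarith [ht.2])
  have hbt : ∀ s, -1 - μ ≤ s → bandBottom μ s ≤ 4 + μ := fun s hs =>
    bandBottom_le (by linarith) (by linarith)
  have h00 : |(0 : ℝ)| < μ₀ := by simpa using hμ₀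
  -- growth in the duration at the unperturbed parameter
  have hgrow : ∀ s ∈ Icc (-1) σ, ∀ t ∈ Icc (bandBottom μ s) (4 + μ),
      ∀ t' ∈ Icc (bandBottom μ s) (4 + μ), t ≤ t' →
      1 / 2 * (t' - t) ≤ limitTime φ M k (0, s, t') - limitTime φ M k (0, s, t) := by
    intro s hs t ht t' ht' htt
    have hd := fun x hx => hasDerivAt_limitTime
      (hz 0 s x h00 (by linarith [hs.1]) (by linarith [hs.2]) hx).1
    refine (convex_Icc _ _).mul_sub_le_image_sub_of_le_deriv
      (f := fun t => limitTime φ M k (0, s, t))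
      (fun x hx => (hd x hx).continuousAt.continuousWithinAt)
      (fun x hx => (hd x (interior_subset hx)).differentiableAt.differentiableWithinAt)
      (fun x hx => ?_) t ht t' ht' htt
    rw [(hd x (interior_subset hx)).deriv]
    exact (hz 0 s x h00 (by linarith [hs.1]) (by linarith [hs.2]) (interior_subset hx)).2.1.le
  set S : Set (ℝ × ℝ) := {w | ∀ᶠ y in 𝓝 w,
    limitTime φ M k (y.1, y.2, bandBottom μ y.2) < σ - μ / 4 ∧
    σ + μ / 4 < limitTime φ M k (y.1, y.2, 4 + μ)}
  have hS : IsOpen S := isOpen_setOfPred_eventually_nhds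
  have hKS : ({(0 : ℝ)} ×ˢ Icc (-1) σ) ⊆ S := by
    rintro ⟨e, s⟩ ⟨he, hs⟩
    rw [mem_singleton_iff] at he
    simp only at he hs
    subst he
    have hb := hbt s (by linarith [hs.1])
    have hbot := (hz 0 s _ h00 (by linarith [hs.1]) (by linarith [hs.2]) ⟨le_rfl, hb⟩).1.fiberC1At
    have htop := (hz 0 s _ h00 (by linarith [hs.1]) (by linarith [hs.2]) ⟨hb, le_rfl⟩).1.fiberC1At
    have hin4 : (4 : ℝ) ∈ Icc (bandBottom μ s) (4 + μ) :=
      ⟨bandBottom_le (by linarith [hs.1]) (by linarith), by linarith⟩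
    have hinb : max (3 - s) 0 ∈ Icc (bandBottom μ s) (4 + μ) := by
      unfold bandBottom
      exact ⟨by linarith, max_le (by linarith [hs.1]) (by linarith)⟩
    have g1 := hgrow s hs 4 hin4 (4 + μ) ⟨hb, le_rfl⟩ (by linarith)
    have g2 := hgrow s hs _ ⟨le_rfl, hb⟩ _ hinb (by unfold bandBottom; linarith)
    have hcorner := core_subset _ h.base_corner_mem
    have g3 : σ ≤ limitTime φ M k (0, s, 4) := by
      have := h.base_limitPoint_mono hM hcorner (s' := s) (t' := 4)
        ⟨hs.1, by norm_num, by norm_num, by simp only; linarith [hs.1],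
          by simp only; linarith [hs.2]⟩
        (by linarith [hs.1]) le_rfl
      simp only [limitTime] at hσ ⊢
      linarith [hs.1]
    -- For `s ≥ 3` the edge point is at rest and its limit is `s`. For `s ≤ 3` it lands at time `3`,
    -- like the corner flight, after a duration of at most `4`.
    have g4 : limitTime φ M k (0, s, max (3 - s) 0) ≤ σ := by
      rcases le_total 3 s with h3 | h3
      · rw [max_eq_right (by linarith)]
        simp only [limitTime]
        rw [h.limitPoint_time_zero (by simpa using h.flight.e₀_pos)
          ⟨by linarith, by linarith [hs.2]⟩]
        exact hs.2
      · rw [max_eq_left (by linarith)]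
        have := h.base_limitPoint_mono hM (s := s) (t := 3 - s)
          ⟨hs.1, by simp only; linarith, by simp only; linarith [hs.1], by simp only; linarith,
            by simp only; linarith⟩ hcorner (by linarith) (by linarith [hs.1])
        simp only [limitTime] at hσ ⊢
        linarith
    have c1 : ContinuousAt (fun y : ℝ × ℝ => (y.1, y.2, bandBottom μ y.2)) (0, s) :=
      continuousAt_fst.prodMk (continuousAt_snd.prodMk
        ((continuous_bandBottom μ).continuousAt.comp continuousAt_snd))
    have c2 : ContinuousAt (fun y : ℝ × ℝ => (y.1, y.2, 4 + μ)) (0, s) := by fun_prop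
    have hbb : max (3 - s) 0 - bandBottom μ s = μ := by unfold bandBottom; ring
    rw [hbb] at g2
    have e1 := (ContinuousAt.comp (g := limitTime φ M k)
      (f := fun y : ℝ × ℝ => (y.1, y.2, bandBottom μ y.2)) (x := (0, s)) hbot.continuousAt
      c1).eventually_lt_const (u := σ - μ / 4) (by simp only [Function.comp]; linarith)
    have e2 := (ContinuousAt.comp (g := limitTime φ M k)
      (f := fun y : ℝ × ℝ => (y.1, y.2, 4 + μ)) (x := (0, s)) htop.continuousAt
      c2).eventually_const_lt (u := σ + μ / 4) (by simp only [Function.comp]; linarith)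
    exact e1.and e2
  obtain ⟨δ, hδ, hsub⟩ := (isCompact_singleton.prod isCompact_Icc).exists_thickening_subset_open
    hS hKS
  refine ⟨μ, hμ0, min_le_right _ _, by linarith, min (δ / 2) (μ / 2), by positivity, by
    linarith [min_le_right (δ / 2) (μ / 2)], ?_⟩
  intro e s he hs hs'
  have n1 := min_le_left (δ / 2) (μ / 2)
  have n2 := min_le_right (δ / 2) (μ / 2)
  set ν := min (δ / 2) (μ / 2)
  refine ⟨fun t ht => hz e s t (by linarith) (by linarith) (by linarith) ht, ?_⟩
  refine (hsub ?_ : (e, s) ∈ S).self_of_nhds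
  rw [Metric.mem_thickening_iff]
  refine ⟨(0, max (-1) (min s σ)), ⟨rfl, le_max_left _ _, max_le (by linarith) (min_le_right _ _)⟩,
    ?_⟩
  rw [Prod.dist_eq, max_lt_iff, Real.dist_eq, Real.dist_eq]
  simp only [sub_zero]
  have l1 : s - ν ≤ min s σ := le_min (by linarith [abs_nonneg e]) (by linarith)
  have l2 : max (-1) (min s σ) ≤ s + ν :=
    max_le (by linarith) ((min_le_left _ _).trans (by linarith [abs_nonneg e]))
  have l3 : s - ν ≤ max (-1) (min s σ) := l1.trans (le_max_right _ _)
  exact ⟨by linarith, abs_lt.2 ⟨by linarith, by linarith⟩⟩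

/-- The graph `t = ψ s` on which the limit of landing times is `σ`. -/
theorem exists_leaf_function {μ ν σ₀ e σ : ℝ} (hν : ν < μ) (hμ : 0 < μ)
    (hband : ∀ s, -1 - ν < s → s < σ₀ + ν →
      (∀ t ∈ Icc (bandBottom μ s) (4 + μ), Convergent φ k M e₀ (e, s, t) ∧
        1 / 2 < fderiv ℝ (fun p => limitTime φ M k (e, p)) (s, t) (0, 1) ∧
        0 < IsFlightFamily.landing φ (e, s, t) ∧ (e, s, t) ∈ box e₀ M) ∧
      limitTime φ M k (e, s, bandBottom μ s) < σ₀ - μ / 4 ∧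
      σ₀ + μ / 4 < limitTime φ M k (e, s, 4 + μ)) (hσ : |σ - σ₀| < μ / 4) :
    ∃ ψ : ℝ → ℝ, ∀ s, -1 - ν < s → s < σ₀ + ν →
      ψ s ∈ Ioo (bandBottom μ s) (4 + μ) ∧ limitTime φ M k (e, s, ψ s) = σ ∧
      ContDiffAt ℝ 1 ψ s ∧
      (∀ t ∈ Icc (bandBottom μ s) (4 + μ), ∀ t' ∈ Icc (bandBottom μ s) (4 + μ), t ≤ t' →
        1 / 2 * (t' - t) ≤ limitTime φ M k (e, s, t') - limitTime φ M k (e, s, t)) := by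
  rw [abs_lt] at hσ
  have hgrow : ∀ s, -1 - ν < s → s < σ₀ + ν → ∀ t ∈ Icc (bandBottom μ s) (4 + μ),
      ∀ t' ∈ Icc (bandBottom μ s) (4 + μ), t ≤ t' →
      1 / 2 * (t' - t) ≤ limitTime φ M k (e, s, t') - limitTime φ M k (e, s, t) := by
    intro s hs hs' t ht t' ht' htt
    have hd := fun x hx => hasDerivAt_limitTime ((hband s hs hs').1 x hx).1
    refine (convex_Icc _ _).mul_sub_le_image_sub_of_le_deriv
      (f := fun t => limitTime φ M k (e, s, t))
      (fun x hx => (hd x hx).continuousAt.continuousWithinAt)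
      (fun x hx => (hd x (interior_subset hx)).differentiableAt.differentiableWithinAt)
      (fun x hx => ?_) t ht t' ht' htt
    rw [(hd x (interior_subset hx)).deriv]
    exact ((hband s hs hs').1 x (interior_subset hx)).2.1.le
  have hex : ∀ s, ∃ t, -1 - ν < s → s < σ₀ + ν →
      t ∈ Ioo (bandBottom μ s) (4 + μ) ∧ limitTime φ M k (e, s, t) = σ := by
    intro s
    by_cases hs : -1 - ν < s ∧ s < σ₀ + ν
    · obtain ⟨b1, b2, b3⟩ := hband s hs.1 hs.2
      have hle : bandBottom μ s ≤ 4 + μ := bandBottom_le (by linarith [hs.1]) (by linarith)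
      have hc : ContinuousOn (fun t => limitTime φ M k (e, s, t))
          (Icc (bandBottom μ s) (4 + μ)) := fun t ht =>
        (hasDerivAt_limitTime (b1 t ht).1).continuousAt.continuousWithinAt
      obtain ⟨t, ht, hte⟩ := intermediate_value_Ioo hle hc
        (show σ ∈ Ioo _ _ from ⟨by linarith, by linarith⟩)
      exact ⟨t, fun _ _ => ⟨ht, hte⟩⟩
    · exact ⟨0, fun h1 h2 => absurd ⟨h1, h2⟩ hs⟩
  choose ψ hψ using hex
  refine ⟨ψ, fun s hs hs' => ⟨(hψ s hs hs').1, (hψ s hs hs').2, ?_, hgrow s hs hs'⟩⟩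
  set U : Set (ℝ × ℝ) := {y | -1 - ν < y.1 ∧ y.1 < σ₀ + ν ∧ bandBottom μ y.1 < y.2 ∧ y.2 < 4 + μ}
  have hU : IsOpen U := by
    have c := continuous_bandBottom μ
    have u1 : IsOpen {y : ℝ × ℝ | -1 - ν < y.1} := isOpen_lt (by fun_prop) (by fun_prop)
    have u2 : IsOpen {y : ℝ × ℝ | y.1 < σ₀ + ν} := isOpen_lt (by fun_prop) (by fun_prop)
    have u3 : IsOpen {y : ℝ × ℝ | bandBottom μ y.1 < y.2} :=
      isOpen_lt (c.comp continuous_fst) (by fun_prop)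
    have u4 : IsOpen {y : ℝ × ℝ | y.2 < 4 + μ} := isOpen_lt (by fun_prop) (by fun_prop)
    exact u1.inter (u2.inter (u3.inter u4))
  obtain ⟨b1, b2⟩ := hψ s hs hs'
  have hz := (hband s hs hs').1 (ψ s) (Ioo_subset_Icc_self b1)
  have hF : ContDiffAt ℝ 1 (fun p => limitTime φ M k (e, p)) (s, ψ s) := hz.1.fiberC1At.contDiffAt
  have hinv : (fderiv ℝ (fun p => limitTime φ M k (e, p)) (s, ψ s) ∘L .inr ℝ ℝ ℝ).IsInvertible := by
    have hpos := hz.2.1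
    refine ⟨ContinuousLinearEquiv.unitsEquivAut ℝ (Units.mk0
      (fderiv ℝ (fun p => limitTime φ M k (e, p)) (s, ψ s) (0, 1)) (by linarith)), ?_⟩
    ext; simp
  refine (contDiffAt_of_locally_unique_solution (F := fun p => limitTime φ M k (e, p)) hU (b := ψ)
    (p := s) ⟨hs, hs', b1.1, b1.2⟩ hF hinv (Eventually.of_forall fun q y hy hFy => ?_)).1
  rw [b2] at hFy
  obtain ⟨y1, y2, y3, y4⟩ := hy
  obtain ⟨d1, d2⟩ := hψ q y1 y2
  have g := hgrow q y1 y2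
  rcases le_total (ψ q) y with hle | hle
  · have := g _ (Ioo_subset_Icc_self d1) y ⟨y3.le, y4.le⟩ hle
    rw [hFy, d2] at this; linarith
  · have := g y ⟨y3.le, y4.le⟩ _ (Ioo_subset_Icc_self d1) hle
    rw [hFy, d2] at this; linarith

end IsScaledFamily

theorem hasDerivAt_zero_of_abs_le_sq {f : ℝ → ℝ} {a C : ℝ} (h : ∀ᶠ x in 𝓝 a, |f x| ≤ C * (x - a) ^ 2) :
    HasDerivAt f 0 a := by
  have ha : f a = 0 := by
    have := h.self_of_nhds
    simpa using this
  rw [hasDerivAt_iff_isLittleO]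
  have h1 : (fun x => f x - f a - (x - a) • (0 : ℝ)) =O[𝓝 a] fun x => (x - a) ^ 2 := by
    refine Asymptotics.IsBigO.of_bound C ?_
    filter_upwards [h] with x hx
    simpa [ha, abs_of_nonneg (sq_nonneg (x - a))] using hx
  refine h1.trans_isLittleO ?_
  have h2 : (fun x : ℝ => (x - a) * (x - a)) =o[𝓝 a] fun x => 1 * (x - a) := by
    refine Asymptotics.IsLittleO.mul_isBigO ?_ (Asymptotics.isBigO_refl _ _)
    rw [Asymptotics.isLittleO_one_iff]
    have : ContinuousAt (fun x : ℝ => x - a) a := by fun_prop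
    simpa [ContinuousAt] using this
  simpa [sq] using h2

namespace IsScaledFamily

variable {Φ : ℝ × ℝ × ℝ × ℝ → ℝ} {k : ℝ × ℝ → ℝ} {r M e₀ : ℝ} {φ : ℝ × ℝ × ℝ → Path01}

/-- Flights with nearly the limit of the tangential flight have nearly quadratic launch speed. -/
theorem exists_speed_estimate (h : IsScaledFamily Φ k r M e₀ φ) (hM : horizon r ≤ M) {κ₀ : ℝ}
    (hκ₀ : 0 < κ₀) :
    ∃ κ > 0, κ < κ₀ ∧ ∀ e sA tA s t, |e| < κ → |sA + 1| < κ → |tA - 4| < κ → |s - sA| < κ →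
      IsFlightFamily.launch φ (e, sA, 0) = 0 → IsFlightFamily.launch φ (e, sA, tA) = 0 →
      |t - (sA + tA - s)| ≤
        2 * |limitTime φ M k (e, s, sA + tA - s) - limitTime φ M k (e, sA, tA)| →
      4 / 5 * (s - sA) ^ 2 ≤ speed φ (e, s, t) ∧ speed φ (e, s, t) ≤ 6 / 5 * (s - sA) ^ 2 := by
  obtain ⟨κ₁, hκ₁, C, hC, hcmp⟩ := h.exists_limit_compare hM
  obtain ⟨κ₃, hκ₃, hκ₃1, L, hL, hmono⟩ := h.exists_speed_strictMono
  obtain ⟨κ, hκ0, q1, q2, q3, q6, q7⟩ : ∃ κ > 0, κ < κ₁ / 4 ∧ κ < κ₀ ∧ κ < κ₃ / 8 ∧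
      κ < 1 / (40 * L * C) ∧ κ < κ₃ / (16 * C) := by
    have : ∀ᶠ κ in 𝓝[>] (0 : ℝ), 0 < κ ∧ κ < κ₁ / 4 ∧ κ < κ₀ ∧ κ < κ₃ / 8 ∧
      κ < 1 / (40 * L * C) ∧ κ < κ₃ / (16 * C) := by
      filter_upwards [Ioo_mem_nhdsGT (show 0 < κ₁ / 4 by positivity),
        Ioo_mem_nhdsGT hκ₀,
        Ioo_mem_nhdsGT (show 0 < κ₃ / 8 by positivity),
        Ioo_mem_nhdsGT (show 0 < 1 / (40 * L * C) by positivity),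
        Ioo_mem_nhdsGT (show 0 < κ₃ / (16 * C) by positivity)] with x a b c f g
      exact ⟨a.1, a.2, b.2, c.2, f.2, g.2⟩
    obtain ⟨κ, hκ⟩ := this.exists
    exact ⟨κ, hκ⟩
  rw [lt_div_iff₀ (by positivity)] at q6 q7
  refine ⟨κ, hκ0, q2, fun e sA tA s t he hsA htA hs hl1 hl2 hclose => ?_⟩
  have hsA' := abs_lt.1 hsA
  have htA' := abs_lt.1 htA
  have hs' := abs_lt.1 hs
  obtain ⟨c1, c2⟩ := hcmp e sA tA s (by linarith) (by linarith) (by linarith)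
    (by linarith) hl1 hl2
  set δ := |s - sA| with hδ
  have hδ0 : 0 ≤ δ := abs_nonneg _
  have hsq : (s - sA) ^ 2 = δ ^ 2 := (sq_abs _).symm
  replace hclose : |t - (sA + tA - s)| ≤ 2 * C * δ ^ 3 := by linarith
  have hδ1 : δ ≤ 1 := by linarith
  have hδ2 : δ ^ 2 ≤ 1 := pow_le_one₀ hδ0 hδ1
  have hδ3 : C * δ ^ 3 ≤ C * κ := by
    have : δ ^ 3 ≤ κ := by
      calc δ ^ 3 = δ ^ 2 * δ := by ring
        _ ≤ 1 * κ := by gcongr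
        _ = κ := one_mul _
    gcongr
  have hclose' := abs_le.1 hclose
  have hL1 := (hmono e s (by linarith) (abs_lt.2 ⟨by linarith, by linarith⟩)).2.2 t
    ⟨by linarith, by linarith⟩ (sA + tA - s) ⟨by linarith, by linarith⟩
  -- The cubic discrepancy of durations changes the launch speed by at most `δ² / 20`. Together with
  -- the error `δ² / 10` for simultaneous landing this stays within a fifth of `δ²`.
  have hL2 : L * |t - (sA + tA - s)| ≤ δ ^ 2 / 20 := by
    calc L * |t - (sA + tA - s)| ≤ L * (2 * C * δ ^ 3) := by gcongr
      _ = (2 * L * C * δ) * δ ^ 2 := by ring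
      _ ≤ (1 / 20) * δ ^ 2 := by
          gcongr
          have : L * C * δ ≤ L * C * κ := by gcongr
          linarith only [this, q6]
      _ = δ ^ 2 / 20 := by ring
  rw [hsq] at c1 ⊢
  have h1 := abs_le.1 (hL1.trans hL2)
  have h2 := abs_le.1 c1
  have h3 := sq_nonneg δ
  exact ⟨by linarith only [h1.1, h2.1, h3], by linarith only [h1.2, h2.2, h3]⟩

set_option maxHeartbeats 1000000 in
/-- For small `e > 0` the orbits coming to rest at a certain time `σ` fill a curve `v = v(s)` tangent
to the axis at the zero `sA` of the initial acceleration; orbits leaving from points above a small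
cone at `sA` come to rest at other times. -/
theorem exists_leaf (h : IsScaledFamily Φ k r M e₀ φ) (hM : horizon r ≤ M) :
    ∃ e₁ > 0, ∀ e ∈ Ioo 0 e₁, ∃ (sA σ κ : ℝ) (v : ℝ → ℝ),
      |sA + 1| < 1 / 2 ∧ 5 / 2 < σ ∧ σ < M ∧ 0 < κ ∧ Φ (e, sA, 0, 0) = 0 ∧
      (∀ s ∈ Icc (sA - κ) σ, ContDiffAt ℝ 1 v s) ∧ v σ = 0 ∧ v sA = 0 ∧ HasDerivAt v 0 sA ∧
      (∀ s ∈ Ico (sA - κ) σ, ∃ t z, speed φ (e, s, t) = v s ∧ z 0 = (s, t) ∧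
        IsImpactOrbit φ k M e₀ e σ z) ∧
      ∀ κ' > 0, ∀ᶠ w : ℝ × ℝ in 𝓝 (sA, 0), κ' * |w.1 - sA| < w.2 → ∃ t z σ',
        speed φ (e, w.1, t) = w.2 ∧ z 0 = (w.1, t) ∧ IsImpactOrbit φ k M e₀ e σ' z ∧ σ' ≠ σ := by
  have hMM := h.nine_le_reach
  obtain ⟨hσ3, hσr⟩ := h.base_limit_bounds hM
  obtain ⟨κ₂, hκ₂, hκ₂1, hshort⟩ := h.exists_speed_lt
  obtain ⟨κ₃, hκ₃, hκ₃1, L, hL, hmono⟩ := h.exists_speed_strictMono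
  obtain ⟨κ, hκ, hκ₀, hest⟩ := h.exists_speed_estimate hM (κ₀ := min κ₂ κ₃ / 4) (by positivity)
  have hκκ₂ : κ < κ₂ / 4 := by linarith [min_le_left κ₂ κ₃]
  have hκκ₃ : κ < κ₃ / 4 := by linarith [min_le_right κ₂ κ₃]
  obtain ⟨μ₁, hμ₁, hearly⟩ := h.exists_no_early hM (half_pos hκ)
  obtain ⟨μ, hμ, hμμ₁, hμ8, ν, hν, hνμ, hband⟩ := h.exists_leaf_band hM hμ₁
  have hΘc := (h.core_eventually hM h.base_corner_mem).self_of_nhds.1.fiberC1At.continuousAt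
  obtain ⟨κ₄, hκ₄, hΘ⟩ := Metric.continuousAt_iff.1 hΘc (min (μ / 4) ν) (by positivity)
  set σ₀ := limitTime φ M k (0, -1, 4) with hσ₀
  obtain ⟨κ₅, hκ₅, q1, q2, q3, q4⟩ : ∃ κ₅ > 0, κ₅ < κ / 4 ∧ κ₅ < κ₄ ∧ κ₅ < ν / 4 ∧
      κ₅ < (μ - ν) / 4 := by
    have : ∀ᶠ x in 𝓝[>] (0 : ℝ), 0 < x ∧ x < κ / 4 ∧ x < κ₄ ∧ x < ν / 4 ∧
        x < (μ - ν) / 4 := by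
      filter_upwards [Ioo_mem_nhdsGT (show 0 < κ / 4 by positivity), Ioo_mem_nhdsGT hκ₄,
        Ioo_mem_nhdsGT (show 0 < ν / 4 by positivity),
        Ioo_mem_nhdsGT (show 0 < (μ - ν) / 4 by linarith)] with x a b c d
      exact ⟨a.1, a.2, b.2, c.2, d.2⟩
    obtain ⟨κ, hκ⟩ := this.exists
    exact ⟨κ, hκ⟩
  obtain ⟨e₁, he₁, htan⟩ := h.exists_tangential hκ₅
  refine ⟨min e₁ (min κ₅ (min μ₁ e₀)), ?_, ?_⟩
  · have := h.flight.e₀_pos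
    positivity
  rintro e ⟨he0, he⟩
  have hee : |e| = e := abs_of_pos he0
  obtain ⟨p1, p2⟩ := lt_min_iff.1 he
  obtain ⟨p2, p3⟩ := lt_min_iff.1 p2
  obtain ⟨p3, p4⟩ := lt_min_iff.1 p3
  obtain ⟨sA, tA, hsA, htA, hl1, hl2⟩ := htan e (by rwa [hee])
  have hΘA := hΘ (x := (e, sA, tA)) (by
    simp only [Prod.dist_eq, Real.dist_eq, max_lt_iff, sub_zero, sub_neg_eq_add, hee]
    exact ⟨by linarith, by linarith, by linarith⟩)
  set σ := limitTime φ M k (e, sA, tA) with hσ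
  rw [Real.dist_eq, lt_min_iff] at hΘA
  obtain ⟨hσμ, hσν⟩ : |σ - σ₀| < μ / 4 ∧ |σ - σ₀| < ν := hΘA
  have hbe := fun s => hband e s (by rw [hee]; linarith)
  obtain ⟨ψ, hψ⟩ := exists_leaf_function hνμ hμ hbe hσμ
  have hsA' := abs_lt.1 hsA
  have htA' := abs_lt.1 htA
  have hσν' := abs_lt.1 hσν
  have hrange : ∀ s, s ∈ Icc (sA - ν / 2) σ → -1 - ν < s ∧ s < σ₀ + ν := fun s hs =>
    ⟨by linarith [hs.1], by linarith [hs.2]⟩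
  have huniq : ∀ s, -1 - ν < s → s < σ₀ + ν → ∀ t ∈ Icc (bandBottom μ s) (4 + μ),
      limitTime φ M k (e, s, t) = σ → t = ψ s := by
    intro s hs hs' t ht hte
    obtain ⟨d1, d2, -, d4⟩ := hψ s hs hs'
    rcases le_total t (ψ s) with hle | hle
    · have := d4 t ht _ (Ioo_subset_Icc_self d1) hle
      rw [hte, d2] at this; linarith
    · have := d4 _ (Ioo_subset_Icc_self d1) t ht hle
      rw [hte, d2] at this; linarith
  -- starting points close to the tangential one
  have hnear : ∀ s, -1 - ν < s → |s - sA| < κ → 4 / 5 * (s - sA) ^ 2 ≤ speed φ (e, s, ψ s) ∧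
      speed φ (e, s, ψ s) ≤ 6 / 5 * (s - sA) ^ 2 := by
    intro s hs hs1
    have hs' := abs_lt.1 hs1
    obtain ⟨d1, d2, -, d4⟩ := hψ s hs (by linarith)
    have hin : sA + tA - s ∈ Icc (bandBottom μ s) (4 + μ) :=
      ⟨bandBottom_le (by linarith) (by linarith), by linarith⟩
    refine hest e sA tA s (ψ s) (by rw [hee]; linarith) (by linarith) (by linarith)
      hs1 hl1 hl2 ?_
    rw [← hσ]
    -- Growth of the limit at rate at least `1/2` converts a difference of limits into at most twice
    -- that difference of durations, in either order.
    rcases le_total (ψ s) (sA + tA - s) with hle | hle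
    · have := d4 _ (Ioo_subset_Icc_self d1) _ hin hle
      rw [d2] at this
      rw [abs_of_nonpos (by linarith)]
      linarith [le_abs_self (limitTime φ M k (e, s, sA + tA - s) - σ)]
    · have := d4 _ hin _ (Ioo_subset_Icc_self d1) hle
      rw [d2] at this
      rw [abs_of_nonneg (by linarith)]
      linarith [neg_abs_le (limitTime φ M k (e, s, sA + tA - s) - σ)]
  have hψA : ψ sA = tA := by
    refine (huniq sA (by linarith) (by linarith) tA
      ⟨bandBottom_le (by linarith) (by linarith), by linarith⟩ rfl).symm
  have hσge : 3 - ν < σ := by linarith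
  have hσM : σ < M - 1 := by linarith
  have hψσ : ψ σ = 0 := by
    refine (huniq σ (by linarith) (by linarith) 0
      ⟨bandBottom_le (by linarith) (by linarith), by linarith⟩ ?_).symm
    exact h.limitPoint_time_zero (by rwa [hee]) ⟨by linarith, hσM⟩
  have hzero : speed φ (e, sA, tA) = 0 := by rw [speed, hl2, mul_zero]
  -- absence of early impacts
  have hnoearly : ∀ s t, -1 - ν < s → s < σ₀ + ν → t ∈ Icc (bandBottom μ s) (4 + μ) →
      (|s - sA| < κ → 4 / 5 * (s - sA) ^ 2 ≤ speed φ (e, s, t)) →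
      ∀ t' ∈ Ioo 0 t, speed φ (e, s, t') ≠ speed φ (e, s, t) := by
    intro s t hs hs' ht hsp t' ht'
    obtain ⟨b1, b2⟩ := bandBottom_ge μ s
    refine ne_of_lt ?_
    -- Short hops near the tangency stay below `4/5 * (s - sA)²`, which the speed of the present
    -- flight attains. All other candidates are covered by `hearly`.
    by_cases hc : |s + 1| < κ / 2 ∧ |t - 4| < κ / 2 ∧ t' < κ / 2
    · obtain ⟨a1, a2, a3⟩ := hc
      refine (hshort e s sA t' (by rw [hee]; linarith) (by linarith) (by linarith) ht'.1
        (by linarith) hl1).trans_le (hsp ?_)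
      rw [abs_lt] at a1 ⊢
      exact ⟨by linarith, by linarith⟩
    · exact hearly e s t t' (by rwa [hee]) (by linarith) (by linarith [ht.2]) (by linarith [ht.1])
        (by linarith [ht.2]) ht'.1.le ht'.2 hc
  refine ⟨sA, σ, ν / 2, fun s => speed φ (e, s, ψ s), by linarith, by linarith, by linarith,
    by linarith, ?_, ?_, ?_, ?_, ?_, ?_, ?_⟩
  · have := h.flight.launch_time_zero (e := e) (s := sA) (by rwa [hee])
      (abs_lt.2 ⟨by linarith, by linarith⟩)
    rw [hl1] at this; linarith
  · intro s hs
    obtain ⟨r1, r2⟩ := hrange s hs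
    obtain ⟨d1, -, d3, -⟩ := hψ s r1 r2
    have hb := ((hbe s r1 r2).1 _ (Ioo_subset_Icc_self d1)).2.2.2
    exact ContDiffAt.comp (g := speed φ) (f := fun s => (e, s, ψ s)) s
      (h.flight.contDiffAt_speed hb) (contDiffAt_const.prodMk (contDiffAt_id.prodMk d3))
  · simp only [hψσ, speed, zero_mul]
  · simp only [hψA, hzero]
  · refine hasDerivAt_zero_of_abs_le_sq (C := 6 / 5) ?_
    filter_upwards [Metric.ball_mem_nhds sA hκ, Ioi_mem_nhds (show -1 - ν < sA by linarith)]
      with s hs hs'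
    rw [Metric.mem_ball, Real.dist_eq] at hs
    obtain ⟨n1, n2⟩ := hnear s hs' hs
    rw [abs_of_nonneg ((mul_nonneg (by norm_num) (sq_nonneg _)).trans n1)]
    exact n2
  · intro s hs
    obtain ⟨r1, r2⟩ := hrange s ⟨hs.1, hs.2.le⟩
    obtain ⟨d1, d2, -, d4⟩ := hψ s r1 r2
    have hd1 := Ioo_subset_Icc_self d1
    obtain ⟨g1, -, g3, -⟩ := (hbe s r1 r2).1 _ hd1
    -- Otherwise duration `0` lies in the band above `ψ s`, and growth would give `σ ≤ s`, since the
    -- limit at duration `0` is `s` itself.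
    have hpos : 0 < ψ s := by
      rcases lt_or_ge 0 (bandBottom μ s) with hb | hb
      · exact hb.trans d1.1
      · by_contra hcon
        push Not at hcon
        have h3 := (bandBottom_ge μ s).2
        have h4 := d4 _ hd1 0 ⟨hb, by linarith⟩ hcon
        have h5 : limitTime φ M k (e, s, 0) = s :=
          h.limitPoint_time_zero (by rwa [hee]) ⟨by linarith, by linarith [hs.2]⟩
        rw [h5, d2] at h4
        linarith [hs.2]
    obtain ⟨z, hz0, hz⟩ := g1.exists_orbit h he0 hpos g3
      (hnoearly s _ r1 r2 hd1 fun a1 => (hnear s r1 a1).1)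
    exact ⟨ψ s, z, rfl, hz0, d2 ▸ hz⟩
  · intro κ' hκ'
    set x := min (ν / 4) ((μ - ν) / 4) with hx
    have hx0 : 0 < x := by rw [hx]; apply lt_min <;> linarith
    have hxν : x ≤ ν / 4 := min_le_left _ _
    have hxμ : x ≤ (μ - ν) / 4 := min_le_right _ _
    set y := min x (κ₃ / 4) with hy
    have hy0 : 0 < y := by positivity
    have hyx : y ≤ x := min_le_left _ _
    have hyκ : y ≤ κ₃ / 4 := min_le_right _ _
    obtain ⟨m1, m2, -⟩ := hmono e sA (by rw [hee]; linarith) (by linarith)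
    have hIoo : ∀ t, |t - tA| ≤ y → t ∈ Ioo (4 - κ₃) (4 + κ₃) := fun t ht => by
      rw [abs_le] at ht
      exact ⟨by linarith, by linarith⟩
    have t0 := hIoo tA (by simpa using hy0.le)
    have t1 := hIoo (tA - y) (by
      rw [show tA - y - tA = -y by ring, abs_neg, abs_of_pos hy0])
    have t2 := hIoo (tA + y) (by rw [add_sub_cancel_left, abs_of_pos hy0])
    have lo : speed φ (e, sA, tA - y) < 0 := by
      rw [← hzero]; exact m1 t1 t0 (by linarith)
    have up : 0 < speed φ (e, sA, tA + y) := by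
      rw [← hzero]; exact m1 t0 t2 (by linarith)
    have hcs : ∀ t, t ∈ Ioo (4 - κ₃) (4 + κ₃) →
        ContinuousAt (fun w : ℝ × ℝ => speed φ (e, w.1, t) - w.2) (sA, 0) := fun t ht =>
      (ContinuousAt.comp (g := speed φ) (f := fun w : ℝ × ℝ => (e, w.1, t))
        (h.flight.contDiffAt_speed (m2 t ht)).continuousAt (by fun_prop)).sub continuousAt_snd
    have ev1 := (hcs _ t1).eventually_lt_const (u := 0) (by simpa using lo)
    have ev2 := (hcs _ t2).eventually_const_lt (u := 0) (by simpa using up)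
    have hfst : ContinuousAt (fun w : ℝ × ℝ => w.1) (sA, 0) := by fun_prop
    have ev3 := hfst.eventually (Metric.ball_mem_nhds sA
      (show 0 < min y (min κ (κ' / 2)) by positivity))
    filter_upwards [ev1, ev2, ev3] with w w1 w2 w3 hw
    obtain ⟨s, v⟩ := w
    rw [Real.dist_eq] at w3
    simp only at w1 w2 w3 hw
    obtain ⟨w3, w45⟩ := lt_min_iff.1 w3
    obtain ⟨w4, w5⟩ := lt_min_iff.1 w45
    have w3' := abs_lt.1 w3
    obtain ⟨-, m2', -⟩ := hmono e s (by rw [hee]; linarith)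
      (abs_lt.2 ⟨by linarith, by linarith⟩)
    have hc : ContinuousOn (fun t => speed φ (e, s, t)) (Icc (tA - y) (tA + y)) := by
      intro t ht
      have hb := m2' t (hIoo t (abs_le.2 ⟨by linarith [ht.1], by linarith [ht.2]⟩))
      exact (h.flight.hasDerivAt_speed hb).continuousAt.continuousWithinAt
    -- The launch speed is negative at `tA - y` and positive at `tA + y` for the tangential start.
    -- Every `(s, v)` near `(sA, 0)` is therefore realized by a duration near `tA`.
    obtain ⟨t, ht, hte⟩ := intermediate_value_Icc (by linarith) hc
      (show v ∈ Icc _ _ from ⟨by linarith, by linarith⟩)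
    simp only at hte
    have r1 : -1 - ν < s := by linarith
    have r2 : s < σ₀ + ν := by linarith
    have hin : t ∈ Icc (bandBottom μ s) (4 + μ) :=
      ⟨bandBottom_le (by linarith [ht.1]) (by linarith [ht.1]), by linarith [ht.2]⟩
    have hquad : 6 / 5 * (s - sA) ^ 2 ≤ κ' * |s - sA| := by
      have hsq : (s - sA) ^ 2 = |s - sA| * |s - sA| := by rw [← sq, sq_abs]
      have : |s - sA| * |s - sA| ≤ (κ' / 2) * |s - sA| := by gcongr
      have : 0 ≤ κ' * |s - sA| := by positivity
      linarith
    obtain ⟨g1, -, g3, -⟩ := (hbe s r1 r2).1 t hin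
    have hsqn := sq_nonneg (s - sA)
    obtain ⟨z, hz0, hz⟩ := g1.exists_orbit h he0 (by linarith [ht.1]) g3
      (hnoearly s t r1 r2 hin fun _ => by rw [hte]; linarith)
    -- A limit equal to `σ` would force `t = ψ s` and hence `v ≤ 6/5 * (s - sA)²`, which lies inside
    -- the cone by `hquad`.
    refine ⟨t, z, _, hte, hz0, hz, fun hcon => ?_⟩
    have h1 := huniq s r1 r2 t hin hcon
    have h2 := (hnear s r1 w4).2
    rw [← h1, hte] at h2
    linarith

end IsScaledFamily

/-! ### Single-valuedness of the impact map and points of rest -/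

variable {f : ℝ → ℝ → ℝ} {g : ℝ → ℝ} {ρ : ℝ → ℝ → ℝ} {c : ℝ}

theorem IsFlight.mono {τ v T T' : ℝ} {x y : ℝ → ℝ} (h : IsFlight f g c τ v T x y) (hT : T' ≤ T) :
    IsFlight f g c τ v T' x y :=
  have hsub : Icc 0 T' ⊆ Icc 0 T := Icc_subset_Icc_right hT
  ⟨h.position_zero, h.velocity_zero, fun t ht => (h.hasDeriv_position t (hsub ht)).mono hsub,
    fun t ht => (h.hasDeriv_velocity t (hsub ht)).mono hsub⟩

theorem IsFlight.continuousOn_position {τ v T : ℝ} {x y : ℝ → ℝ} (h : IsFlight f g c τ v T x y) :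
    ContinuousOn x (Icc 0 T) := fun t ht => (h.hasDeriv_position t ht).continuousWithinAt

theorem IsFlight.continuousOn_velocity {τ v T : ℝ} {x y : ℝ → ℝ} (h : IsFlight f g c τ v T x y) :
    ContinuousOn y (Icc 0 T) := fun t ht => (h.hasDeriv_velocity t ht).continuousWithinAt

/-- Uniqueness of solutions of the differential equation. -/
theorem IsFlight.unique (hf : ContDiff ℝ 1 fun q : ℝ × ℝ => f q.1 q.2) {τ v T : ℝ}
    {x₁ y₁ x₂ y₂ : ℝ → ℝ} (h₁ : IsFlight f g c τ v T x₁ y₁) (h₂ : IsFlight f g c τ v T x₂ y₂) :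
    ∀ t ∈ Icc 0 T, x₁ t = x₂ t ∧ y₁ t = y₂ t := by
  have c1 : ContinuousOn (fun t => (x₁ t, y₁ t)) (Icc 0 T) :=
    h₁.continuousOn_position.prodMk h₁.continuousOn_velocity
  have c2 : ContinuousOn (fun t => (x₂ t, y₂ t)) (Icc 0 T) :=
    h₂.continuousOn_position.prodMk h₂.continuousOn_velocity
  have hcpt : IsCompact ((fun t => (x₁ t, y₁ t)) '' Icc 0 T ∪ (fun t => (x₂ t, y₂ t)) '' Icc 0 T) :=
    (isCompact_Icc.image_of_continuousOn c1).union (isCompact_Icc.image_of_continuousOn c2)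
  set S := (fun t => (x₁ t, y₁ t)) '' Icc 0 T ∪ (fun t => (x₂ t, y₂ t)) '' Icc 0 T
  obtain ⟨K, hK⟩ := (hf.locallyLipschitz.locallyLipschitzOn
    (s := S)).exists_lipschitzOnWith_of_compact hcpt
  have hv : ∀ t ∈ Ico 0 T, LipschitzOnWith (max 1 K)
      (fun p : ℝ × ℝ => (p.2, g (τ + t) - f p.1 p.2)) S := by
    intro t _
    refine LipschitzOnWith.prodMk LipschitzWith.prod_snd.lipschitzOnWith ?_
    have := (LipschitzWith.const (g (τ + t))).lipschitzOnWith (s := S) |>.sub hK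
    simpa using this
  have hder : ∀ {x y : ℝ → ℝ}, IsFlight f g c τ v T x y → ∀ t ∈ Ico 0 T,
      HasDerivWithinAt (fun t => (x t, y t)) ((y t, g (τ + t) - f (x t) (y t)) : ℝ × ℝ) (Ici t) t := by
    intro x y h t ht
    have h1 := (h.hasDeriv_position t (Ico_subset_Icc_self ht)).prodMk
      (h.hasDeriv_velocity t (Ico_subset_Icc_self ht))
    refine h1.mono_of_mem_nhdsWithin ?_
    exact mem_of_superset (Icc_mem_nhdsGE ht.2) (Icc_subset_Icc_left ht.1)
  have := ODE_solution_unique_of_mem_Icc_right (s := fun _ => S) hv c1 (hder h₁)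
    (fun t ht => Or.inl ⟨t, Ico_subset_Icc_self ht, rfl⟩) c2 (hder h₂)
    (fun t ht => Or.inr ⟨t, Ico_subset_Icc_self ht, rfl⟩) (by
      simp only [h₁.position_zero, h₁.velocity_zero, h₂.position_zero, h₂.velocity_zero])
  intro t ht
  exact Prod.ext_iff.1 (this ht)

/-- Were one hitting time smaller, uniqueness for the differential equation would put the other
solution on the obstacle too early. Rest and flight exclude each other because an actual flight
leaves the obstacle. -/
theorem FirstHit.unique (hf : ContDiff ℝ 1 fun q : ℝ × ℝ => f q.1 q.2) {w : ℝ × ℝ}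
    {z z' : ℝ × ℝ × ℝ} (h : FirstHit f g c w z) (h' : FirstHit f g c w z') : z = z' := by
  have key : ∀ {z z' : ℝ × ℝ × ℝ}, FirstHit f g c w z → FirstHit f g c w z' →
      ¬ z.2.2 < z'.2.2 := by
    rintro z z' ⟨-, -, h⟩ ⟨-, -, h'⟩ hlt
    rcases h' with ⟨hp', x', y', hfl', hx', -⟩ | ⟨hw', -, hz'⟩
    · rcases h with ⟨hp, x, y, hfl, hx, hxe⟩ | ⟨hw, hn, hz⟩
      · have := (hfl.unique hf (hfl'.mono hlt.le) z.2.2 ⟨hp.le, le_rfl⟩).1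
        have h2 := hx' z.2.2 ⟨hp, hlt⟩
        rw [← this, hxe] at h2
        exact lt_irrefl _ h2
      · exact hn ⟨z'.2.2 / 2, by positivity, x', y', hfl'.mono (by linarith), fun t ht =>
          hx' t ⟨ht.1, by linarith [ht.2]⟩⟩
    · rcases h with ⟨hp, -⟩ | ⟨-, -, hz⟩ <;> linarith
  have h3 := le_antisymm (not_lt.1 (key h' h)) (not_lt.1 (key h h'))
  exact Prod.ext (h.1.trans h'.1.symm) (Prod.ext (h.2.1.trans h'.2.1.symm) h3)

theorem Reset.unique (hf : ContDiff ℝ 1 fun q : ℝ × ℝ => f q.1 q.2) {z : ℝ × ℝ × ℝ} {u u' : ℝ × ℝ}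
    (hz : 0 ≤ z.2.2) (h : Reset f g c z u) (h' : Reset f g c z u') : u = u' := by
  obtain ⟨h1, x, y, hfl, hy⟩ := h
  obtain ⟨h1', x', y', hfl', hy'⟩ := h'
  refine Prod.ext (h1.trans h1'.symm) ?_
  rw [hy, hy']
  exact (hfl.unique hf hfl' _ ⟨hz, le_rfl⟩).2

theorem FirstHit.nonneg {w : ℝ × ℝ} {z : ℝ × ℝ × ℝ} (h : FirstHit f g c w z) : 0 ≤ z.2.2 := by
  rcases h.2.2 with h | h
  · exact h.1.le
  · exact h.2.2.ge

/-- The impact map is single-valued. -/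
theorem ImpactStep.unique (hf : ContDiff ℝ 1 fun q : ℝ × ℝ => f q.1 q.2) {w w₁ w₂ : ℝ × ℝ}
    (h₁ : ImpactStep f g ρ c w w₁) (h₂ : ImpactStep f g ρ c w w₂) : w₁ = w₂ := by
  obtain ⟨z, u, hz, hu, rfl⟩ := h₁
  obtain ⟨z', u', hz', hu', rfl⟩ := h₂
  obtain rfl := hz.unique hf hz'
  rw [hu.unique hf hz.nonneg hu']

/-- All orbits from `w` coincide, so exhibiting one with another limit excludes `w` from the stable
manifold. -/
theorem limit_unique_of_mem_stableManifold (hf : ContDiff ℝ 1 fun q : ℝ × ℝ => f q.1 q.2)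
    {X X' w : ℝ × ℝ} (h : w ∈ stableManifold f g ρ c X) {orbit : ℕ → ℝ × ℝ} (h0 : orbit 0 = w)
    (hstep : ∀ n, ImpactStep f g ρ c (orbit n) (orbit (n + 1)))
    (hlim : Tendsto orbit atTop (𝓝 X')) : X = X' := by
  obtain ⟨-, orbit', h0', hstep', hlim'⟩ := h
  have : orbit = orbit' := by
    funext n
    induction n with
    | zero => rw [h0, h0']
    | succ n ih => exact (ih ▸ hstep n).unique hf (hstep' n)
  subst this
  exact tendsto_nhds_unique hlim' hlim

/-- With negative initial acceleration the solution does not leave the obstacle. -/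
theorem not_leavesObstacle (hf : Continuous fun q : ℝ × ℝ => f q.1 q.2) (hg : Continuous g) {τ : ℝ}
    (ha : acc f g c τ < 0) : ¬ LeavesObstacle f g c τ 0 := by
  rintro ⟨T, hT, x, y, hfl, hx⟩
  have h0 : (0 : ℝ) ∈ Icc 0 T := ⟨le_rfl, hT.le⟩
  have hc : ContinuousWithinAt (fun t => g (τ + t) - f (x t) (y t)) (Icc 0 T) 0 := by
    have h1 : ContinuousWithinAt (fun t => f (x t) (y t)) (Icc 0 T) 0 :=
      hf.continuousAt.comp_continuousWithinAt (f := fun t => (x t, y t))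
        ((hfl.continuousOn_position 0 h0).prodMk (hfl.continuousOn_velocity 0 h0))
    exact (by fun_prop : Continuous fun t => g (τ + t)).continuousWithinAt.sub h1
  have hev := hc.eventually_lt_const (u := 0) (by
    simpa [acc, hfl.position_zero, hfl.velocity_zero] using ha)
  obtain ⟨ε, hε, hball⟩ := Metric.mem_nhdsWithin_iff.1 hev
  set T' := min T (ε / 2) with hT'
  have hT'0 : 0 < T' := by positivity
  have hT'T : T' ≤ T := min_le_left _ _
  have hT'ε : T' ≤ ε / 2 := min_le_right _ _
  have hneg : ∀ t ∈ Icc 0 T', g (τ + t) - f (x t) (y t) < 0 := fun t ht =>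
    hball ⟨by
      rw [Metric.mem_ball, Real.dist_eq, sub_zero, abs_of_nonneg ht.1]; linarith [ht.2],
      ht.1, ht.2.trans hT'T⟩
  have hfl' := hfl.mono hT'T
  have anti : ∀ {u u' : ℝ → ℝ}, (∀ t ∈ Icc 0 T', HasDerivWithinAt u (u' t) (Icc 0 T') t) →
      (∀ t ∈ Icc 0 T', u' t ≤ 0) → AntitoneOn u (Icc 0 T') := by
    intro u u' hu hu'
    refine antitoneOn_of_deriv_nonpos (convex_Icc _ _)
      (fun t ht => (hu t ht).continuousWithinAt) (fun t ht => ?_) (fun t ht => ?_)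
    all_goals
      rw [interior_Icc] at ht
      have hd := (hu t (Ioo_subset_Icc_self ht)).hasDerivAt (Icc_mem_nhds ht.1 ht.2)
    · exact hd.differentiableAt.differentiableWithinAt
    · rw [hd.deriv]; exact hu' t (Ioo_subset_Icc_self ht)
  have hl : (0 : ℝ) ∈ Icc 0 T' := ⟨le_rfl, hT'0.le⟩
  have hy : ∀ t ∈ Icc 0 T', y t ≤ 0 := fun t ht => by
    have := anti hfl'.hasDeriv_velocity (fun t ht => (hneg t ht).le) hl ht ht.1
    rwa [hfl.velocity_zero] at this
  have hx' := anti hfl'.hasDeriv_position hy hl ⟨hT'0.le, le_rfl⟩ hT'0.le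
  rw [hfl.position_zero] at hx'
  exact absurd (hx T' ⟨hT'0, hT'T⟩) (not_lt.2 hx')

theorem impactStep_rest (hf : Continuous fun q : ℝ × ℝ => f q.1 q.2) (hg : Continuous g)
    (hρ : ρ c 0 = 0) {τ : ℝ} (ha : acc f g c τ < 0) :
    ImpactStep f g ρ c (τ, 0) (τ, 0) := by
  refine ⟨(τ, 0, 0), (τ, 0), ⟨rfl, rfl, Or.inr ⟨rfl, not_leavesObstacle hf hg ha, rfl⟩⟩,
    ⟨by simp, fun _ => c, fun _ => 0, ⟨rfl, rfl, fun t _ => ?_, fun t _ => ?_⟩, rfl⟩, ?_⟩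
  · exact hasDerivWithinAt_const _ _ _
  -- The reset takes place at elapsed time `0`, so the equation is imposed on a one-point interval,
  -- where any value is a derivative.
  · simp only [Icc_self]
    have : ({0} : Set ℝ).Subsingleton := subsingleton_singleton
    exact HasFDerivWithinAt.of_subsingleton this
  · simp [restitution, hρ]

/-! ### Hadamard quotients and the rescaled problem -/

section Hadamard

variable {P : Type*} [NormedAddCommGroup P] [NormedSpace ℝ P]

/-- The integral is a continuous linear functional of the path `θ ↦ H (p, θ)`, and that path is `C¹`
in `p` by `contDiff_one_postcomp`. -/
theorem contDiff_integral_unitInterval {H : P × ℝ → ℝ} (hH : ContDiff ℝ 1 H) :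
    ContDiff ℝ 1 fun p => ∫ θ in (0 : ℝ)..1, H (p, θ) := by
  let ι : P →L[ℝ] C(unitInterval, P × ℝ) :=
    (ContinuousLinearMap.inl ℝ P ℝ).compLeftContinuous ℝ unitInterval ∘L
      ContinuousLinearMap.const ℝ unitInterval
  let idp : C(unitInterval, P × ℝ) := ⟨fun u => (0, (u : ℝ)), by fun_prop⟩
  have h1 : ContDiff ℝ 1 fun p => ι p + idp := by fun_prop
  have h2 := (contDiff_one_postcomp hH).comp h1
  have h3 : ContDiff ℝ 1 fun φ : Path01 => primitive φ 1 :=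
    (ContinuousMap.evalCLM ℝ (1 : unitInterval) ∘L primitive).contDiff
  refine (show (fun p => ∫ θ in (0 : ℝ)..1, H (p, θ)) = _ from ?_) ▸ h3.comp h2
  funext p
  simp only [Function.comp_apply, primitive_apply, Icc.coe_one]
  refine intervalIntegral.integral_congr fun θ hθ => ?_
  rw [uIcc_of_le zero_le_one] at hθ
  rw [Path01.ext_of_mem _ hθ]
  simp [ι, idp]

/-- Hadamard's formula. -/
theorem sub_eq_integral_fderiv {F : P → ℝ} (hF : ContDiff ℝ 1 F) (z w : P) :
    F (z + w) - F z = ∫ θ in (0 : ℝ)..1, fderiv ℝ F (z + θ • w) w := by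
  have hd : ∀ θ : ℝ, HasDerivAt (fun θ : ℝ => F (z + θ • w)) (fderiv ℝ F (z + θ • w) w) θ := by
    intro θ
    have h1 : HasDerivAt (fun θ : ℝ => z + θ • w) w θ := by
      simpa using ((hasDerivAt_id θ).smul_const w).const_add z
    exact (hF.differentiable one_ne_zero _).hasFDerivAt.comp_hasDerivAt θ h1
  have hc : Continuous fun θ : ℝ => fderiv ℝ F (z + θ • w) w := by
    have := hF.continuous_fderiv one_ne_zero
    fun_prop
  rw [intervalIntegral.integral_eq_sub_of_hasDerivAt (fun θ _ => hd θ) (hc.intervalIntegrable _ _)]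
  simp

theorem sub_eq_mul_integral_deriv {g : ℝ → ℝ} (hg : ContDiff ℝ 1 g) (a x : ℝ) :
    g (a + x) - g a = x * ∫ θ in (0 : ℝ)..1, deriv g (a + θ * x) := by
  rw [sub_eq_integral_fderiv hg, ← intervalIntegral.integral_const_mul]
  refine intervalIntegral.integral_congr fun θ _ => ?_
  simp only [smul_eq_mul]
  rw [← fderiv_apply_one_eq_deriv, ← smul_eq_mul x, ← map_smul]
  simp

/-- Hadamard's formula is applied to `g` and to its derivative. Each use costs one derivative, so
three leave a `C¹` quotient. -/
theorem exists_second_order_quotient {g : ℝ → ℝ} (hg : ContDiff ℝ 3 g) {a : ℝ}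
    (ha : deriv g a = 0) : ∃ G : ℝ → ℝ, ContDiff ℝ 1 G ∧ G 0 = deriv (deriv g) a / 2 ∧
      ∀ x, g (a + x) = g a + x ^ 2 * G x := by
  have hg1 : ContDiff ℝ 2 (deriv g) := hg.deriv' 
  have hg2 : ContDiff ℝ 1 (deriv (deriv g)) := hg1.deriv'
  let G₁ : ℝ → ℝ := fun x => ∫ θ in (0 : ℝ)..1, deriv (deriv g) (a + θ * x)
  have hG₁ : ContDiff ℝ 1 G₁ :=
    contDiff_integral_unitInterval (H := fun p : ℝ × ℝ => deriv (deriv g) (a + p.2 * p.1))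
      (hg2.comp (by fun_prop))
  refine ⟨fun x => ∫ θ in (0 : ℝ)..1, θ * G₁ (θ * x), ?_, ?_, fun x => ?_⟩
  · exact contDiff_integral_unitInterval (H := fun p : ℝ × ℝ => p.2 * G₁ (p.2 * p.1))
      (contDiff_snd.mul (hG₁.comp (by fun_prop)))
  · simp [G₁, integral_id]; ring
  · have h1 := sub_eq_mul_integral_deriv (hg.of_le (by norm_num)) a x
    have h2 : ∀ y, deriv g (a + y) = y * G₁ y := fun y => by
      have := sub_eq_mul_integral_deriv (hg1.of_le (by norm_num)) a y
      rw [ha, sub_zero] at this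
      exact this
    have h3 : ∫ θ in (0 : ℝ)..1, deriv g (a + θ * x) =
        x * ∫ θ in (0 : ℝ)..1, θ * G₁ (θ * x) := by
      rw [← intervalIntegral.integral_const_mul]
      refine intervalIntegral.integral_congr fun θ _ => ?_
      simp only [h2]; ring
    rw [h3] at h1
    linarith

theorem exists_first_order_quotients {F : ℝ × ℝ → ℝ} (hF : ContDiff ℝ 2 F) (z : ℝ × ℝ) :
    ∃ A B : ℝ × ℝ → ℝ, ContDiff ℝ 1 A ∧ ContDiff ℝ 1 B ∧ A 0 = fderiv ℝ F z (1, 0) ∧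
      ∀ w, F (z + w) = F z + w.1 * A w + w.2 * B w := by
  have hF' : ContDiff ℝ 1 (fderiv ℝ F) := hF.fderiv_right (by norm_num)
  have key : ∀ v : ℝ × ℝ, ContDiff ℝ 1 fun w : ℝ × ℝ =>
      ∫ θ in (0 : ℝ)..1, fderiv ℝ F (z + θ • w) v := fun v =>
    contDiff_integral_unitInterval
      (H := fun p : (ℝ × ℝ) × ℝ => fderiv ℝ F (z + p.2 • p.1) v)
      ((hF'.comp (by fun_prop)).clm_apply contDiff_const)
  refine ⟨_, _, key (1, 0), key (0, 1), by simp, fun w => ?_⟩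
  have h1 := sub_eq_integral_fderiv (hF.of_le (by norm_num)) z w
  have hi : ∀ v : ℝ × ℝ, IntervalIntegrable (fun θ : ℝ => fderiv ℝ F (z + θ • w) v)
      MeasureTheory.volume 0 1 := fun v => by
    have := hF'.continuous
    exact (by fun_prop : Continuous fun θ : ℝ => fderiv ℝ F (z + θ • w) v).intervalIntegrable _ _
  have h2 : ∫ θ in (0 : ℝ)..1, fderiv ℝ F (z + θ • w) w =
      w.1 * (∫ θ in (0 : ℝ)..1, fderiv ℝ F (z + θ • w) (1, 0)) +
        w.2 * ∫ θ in (0 : ℝ)..1, fderiv ℝ F (z + θ • w) (0, 1) := by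
    rw [← intervalIntegral.integral_const_mul, ← intervalIntegral.integral_const_mul,
      ← intervalIntegral.integral_add ((hi _).const_mul _) ((hi _).const_mul _)]
    refine intervalIntegral.integral_congr fun θ _ => ?_
    rw [← smul_eq_mul, ← smul_eq_mul, ← map_smul, ← map_smul, ← map_add]
    simp
  linarith

/-- The rescaled field of force. -/
theorem exists_scaled_field {f : ℝ → ℝ → ℝ} (hf : ContDiff ℝ ∞ fun q : ℝ × ℝ => f q.1 q.2)
    {g : ℝ → ℝ} (hg : ContDiff ℝ ∞ g) {c τ K m : ℝ} (hK : 0 < K) (hm : 0 < m)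
    (h0 : g τ = f c 0) (h1 : deriv g τ = 0) (h2 : deriv (deriv g) τ = -(2 * K))
    (h3 : deriv (fun c' => f c' 0) c = -m) :
    ∃ Φ : ℝ × ℝ × ℝ × ℝ → ℝ, ContDiff ℝ 1 Φ ∧ (∀ s X Y, Φ (0, s, X, Y) = 1 - s ^ 2) ∧
      ∀ e s X Y, K * e ^ 2 * Φ (e, s, X, Y) =
        g (τ + e * s) - f (c + K / m * e ^ 2 + K * e ^ 4 * X) (K * e ^ 3 * Y) := by
  obtain ⟨G, hG, hG0, hGx⟩ := exists_second_order_quotient (contDiff_infty.1 hg 3) h1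
  obtain ⟨A, B, hA, hB, hA0, hAB⟩ := exists_first_order_quotients
    (contDiff_infty.1 hf 2) (c, 0)
  have hA1 : A 0 = -m := by
    rw [hA0, ← h3]
    have hd := (hf.differentiable (by simp) (c, 0)).hasFDerivAt
    have hl : HasDerivAt (fun c' : ℝ => (c', (0 : ℝ))) (1, 0) c :=
      (hasDerivAt_id c).prodMk (hasDerivAt_const _ _)
    exact (hd.comp_hasDerivAt (l := fun q : ℝ × ℝ => f q.1 q.2) (f := fun c' : ℝ => (c', (0 : ℝ)))
      c hl).deriv.symm
  let w : ℝ × ℝ × ℝ × ℝ → ℝ × ℝ := fun z =>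
    (K / m * z.1 ^ 2 + K * z.1 ^ 4 * z.2.2.1, K * z.1 ^ 3 * z.2.2.2)
  have hw : ContDiff ℝ 1 w := by fun_prop
  -- At order `e²` the forcing gives `-K * s²` and the shift of `c` gives `+K`, since `A 0 = -m`.
  -- Position and velocity enter only at orders `e⁴` and `e³`. Dividing by `K * e²` leaves `1 - s²`
  -- at `e = 0`.
  refine ⟨fun z => 1 / K * (z.2.1 ^ 2 * G (z.1 * z.2.1) -
    ((K / m + K * z.1 ^ 2 * z.2.2.1) * A (w z) + K * z.1 * z.2.2.2 * B (w z))), ?_, ?_, ?_⟩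
  · have := hG.comp (by fun_prop : ContDiff ℝ 1 fun z : ℝ × ℝ × ℝ × ℝ => z.1 * z.2.1)
    have hAw := hA.comp hw
    have hBw := hB.comp hw
    simp only [Function.comp_def] at this hAw hBw
    fun_prop
  · intro s X Y
    have : w (0, s, X, Y) = 0 := by simp [w]
    simp only [this, hA1, zero_mul, hG0, h2]
    field_simp
    ring
  · intro e s X Y
    have e1 := hGx (e * s)
    have e2 := hAB (w (e, s, X, Y))
    simp only [w, Prod.mk_add_mk, zero_add] at e2 ⊢
    rw [e1, add_assoc c, e2, h0]
    field_simp
    ring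

/-- The rescaled restitution factor. -/
theorem exists_scaled_factor {ρ : ℝ → ℝ → ℝ} (hρ : ContDiff ℝ 1 fun q : ℝ × ℝ => ρ q.1 q.2)
    (hρ0 : ∀ c, ρ c 0 = 0) (hρpos : ∀ c v, v < 0 → 0 < ρ c v) (c : ℝ) {a b : ℝ} (hb : 0 < b) :
    ∃ k : ℝ × ℝ → ℝ, Continuous k ∧ (∀ w, k (0, w) = -deriv (ρ c) 0) ∧
      (∀ e > 0, ∀ w > 0, 0 < k (e, w)) ∧ (∀ w, FiberC1At (fun z : ℝ × ℝ => z.2 * k z) (0, w)) ∧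
      ∀ e w, b * e ^ 3 * (w * k (e, w)) = ρ (c + a * e ^ 2) (-(b * e ^ 3 * w)) := by
  have hpd : ∀ c v, HasDerivAt (ρ c) (fderiv ℝ (fun q : ℝ × ℝ => ρ q.1 q.2) (c, v) (0, 1)) v := by
    intro c v
    have hd := (hρ.differentiable one_ne_zero (c, v)).hasFDerivAt
    have hl : HasDerivAt (fun v' : ℝ => (c, v')) (0, 1) v :=
      (hasDerivAt_const _ _).prodMk (hasDerivAt_id v)
    exact hd.comp_hasDerivAt (l := fun q : ℝ × ℝ => ρ q.1 q.2) (f := fun v' : ℝ => (c, v')) v hl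
  have hDc : Continuous fun q : ℝ × ℝ => deriv (ρ q.1) q.2 := by
    have : (fun q : ℝ × ℝ => deriv (ρ q.1) q.2) =
        fun q => fderiv ℝ (fun q : ℝ × ℝ => ρ q.1 q.2) q (0, 1) := funext fun q => (hpd q.1 q.2).deriv
    rw [this]
    have := hρ.continuous_fderiv one_ne_zero
    fun_prop
  have hρ1 : ∀ c, ContDiff ℝ 1 (ρ c) := fun c =>
    hρ.comp (by fun_prop : ContDiff ℝ 1 fun v : ℝ => (c, v))
  -- Hadamard quotient of `ρ` at zero velocity, which is continuous across `e = 0`. The sign makes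
  -- it positive for incoming negative velocities.
  let k : ℝ × ℝ → ℝ := fun z =>
    -∫ θ in (0 : ℝ)..1, deriv (ρ (c + a * z.1 ^ 2)) (θ * -(b * z.1 ^ 3 * z.2))
  have hk : Continuous k := by
    refine Continuous.neg (intervalIntegral.continuous_parametric_intervalIntegral_of_continuous'
      (f := fun (z : ℝ × ℝ) θ => deriv (ρ (c + a * z.1 ^ 2)) (θ * -(b * z.1 ^ 3 * z.2))) ?_ 0 1)
    exact hDc.comp (f := fun p : (ℝ × ℝ) × ℝ =>
      (c + a * p.1.1 ^ 2, p.2 * -(b * p.1.1 ^ 3 * p.1.2))) (by fun_prop)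
  have hk0 : ∀ w, k (0, w) = -deriv (ρ c) 0 := fun w => by simp [k]
  have hmul : ∀ e w, b * e ^ 3 * (w * k (e, w)) = ρ (c + a * e ^ 2) (-(b * e ^ 3 * w)) := by
    intro e w
    have := sub_eq_mul_integral_deriv (hρ1 (c + a * e ^ 2)) 0 (-(b * e ^ 3 * w))
    rw [hρ0, sub_zero, zero_add] at this
    rw [this]
    simp only [k, zero_add]
    ring
  refine ⟨k, hk, hk0, fun e he w hw => ?_, fun w => ?_, hmul⟩
  · have h1 := hρpos (c + a * e ^ 2) (-(b * e ^ 3 * w)) (neg_neg_of_pos (by positivity))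
    rw [← hmul, ← mul_assoc] at h1
    exact (pos_iff_pos_of_mul_pos h1).1 (by positivity)
  -- For `e ≠ 0` the product is a rescaled copy of `ρ`, and for `e = 0` it is linear. One formula
  -- gives the derivative in `w` in both cases and is continuous in `(e, w)`, so no derivative in
  -- `e` is needed.
  · refine ⟨fun z => ContinuousLinearMap.toSpanSingleton ℝ
      (-deriv (ρ (c + a * z.1 ^ 2)) (-(b * z.1 ^ 3 * z.2))), Eventually.of_forall fun z => ⟨?_, ?_, ?_⟩⟩
    · rw [← hasDerivAt_iff_hasFDerivAt]
      by_cases he : z.1 = 0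
      · rw [he]
        simp only [hk0]
        have := (hasDerivAt_id z.2).mul_const (-deriv (ρ c) 0)
        simpa using this
      · have hb3 : b * z.1 ^ 3 ≠ 0 := by positivity
        have h1 : (fun p => p * k (z.1, p)) =
            fun p => (b * z.1 ^ 3)⁻¹ * ρ (c + a * z.1 ^ 2) (-(b * z.1 ^ 3 * p)) := by
          funext p
          rw [← hmul, inv_mul_cancel_left₀ hb3]
        rw [h1]
        have h2 : HasDerivAt (fun p => -(b * z.1 ^ 3 * p)) (-(b * z.1 ^ 3)) z.2 := by
          have := (hasDerivAt_id z.2).const_mul (-(b * z.1 ^ 3))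
          simpa using this
        have h3 := ((hρ1 (c + a * z.1 ^ 2)).differentiable one_ne_zero
          (-(b * z.1 ^ 3 * z.2))).hasDerivAt.comp z.2 h2
        have h4 := h3.const_mul (b * z.1 ^ 3)⁻¹
        rw [mul_comm (deriv _ _), ← mul_assoc, mul_neg, inv_mul_cancel₀ hb3, neg_one_mul] at h4
        exact h4
    · have h1 : Continuous fun z : ℝ × ℝ => -deriv (ρ (c + a * z.1 ^ 2)) (-(b * z.1 ^ 3 * z.2)) :=
        (hDc.comp (f := fun z : ℝ × ℝ => (c + a * z.1 ^ 2, -(b * z.1 ^ 3 * z.2)))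
          (by fun_prop)).neg
      have h2 : Continuous fun v : ℝ => ContinuousLinearMap.toSpanSingleton ℝ v :=
        (ContinuousLinearMap.toSpanSingletonCLE (𝕜 := ℝ) (E := ℝ)).continuous
      exact (h2.comp h1).continuousAt
    · exact (continuous_snd.mul hk).continuousAt

end Hadamard

/-! ### From rescaled orbits to the stable manifold -/

/-- A function which is negative to the left of one of its zeros has nonnegative derivative there. -/
theorem HasDerivWithinAt.nonneg_of_neg_left {u : ℝ → ℝ} {u' a b : ℝ} (hab : a < b)
    (h : HasDerivWithinAt u u' (Icc a b) b) (hb : u b = 0) (hneg : ∀ x ∈ Ioo a b, u x < 0) :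
    0 ≤ u' := by
  have h1 := (hasDerivWithinAt_iff_tendsto_slope' (s := Ioo a b) (x := b) (by simp)).1
    (h.mono Ioo_subset_Icc_self)
  rw [nhdsWithin_Ioo_eq_nhdsLT hab] at h1
  refine ge_of_tendsto h1 ?_
  filter_upwards [Ioo_mem_nhdsLT hab] with x hx
  rw [slope_comm, slope_def_field, hb, zero_sub]
  exact div_nonneg (neg_nonneg.2 (hneg x hx).le) (sub_pos.2 hx.2).le

theorem HasDerivWithinAt.nonneg_of_pos_right {u : ℝ → ℝ} {u' a b : ℝ} (hab : a < b)
    (h : HasDerivWithinAt u u' (Icc a b) a) (ha : u a = 0) (hpos : ∀ x ∈ Ioo a b, 0 < u x) :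
    0 ≤ u' := by
  have h1 := (hasDerivWithinAt_iff_tendsto_slope' (s := Ioo a b) (x := a) (by simp)).1
    (h.mono Ioo_subset_Icc_self)
  rw [nhdsWithin_Ioo_eq_nhdsGT hab] at h1
  refine ge_of_tendsto h1 ?_
  filter_upwards [Ioo_mem_nhdsGT hab] with x hx
  rw [slope_def_field, ha, sub_zero]
  exact div_nonneg (hpos x hx).le (sub_pos.2 hx.1).le

namespace IsFlightFamily

variable {Φ : ℝ × ℝ × ℝ × ℝ → ℝ} {M e₀ e s t : ℝ} {φ : ℝ × ℝ × ℝ → Path01}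

/-- A zero of the position before landing would give a shorter flight with the same launch speed. So
the sign is constant, and a negative one is incompatible with a downward velocity at landing. -/
theorem position_pos (h : IsFlightFamily Φ M e₀ φ) (hq : (e, s, t) ∈ box e₀ M) (ht : 0 < t)
    (hl : 0 < landing φ (e, s, t))
    (hne : ∀ t' ∈ Ioo 0 t, speed φ (e, s, t') ≠ speed φ (e, s, t)) :
    ∀ ς ∈ Ioo 0 t, 0 < position φ (e, s, t) ς := by
  have hcont : ContinuousOn (position φ (e, s, t)) (Icc 0 t) := fun ς hς =>
    (hasDerivWithinAt_position φ ht hς).continuousWithinAt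
  have hne0 : ∀ ς ∈ Ioo 0 t, position φ (e, s, t) ς ≠ 0 := fun ς hς h0 =>
    hne ς hς (h.launch_of_position_eq_zero hq hς.1 hς.2 h0)
  intro ς hς
  by_contra hcon
  have hneg : ∀ x ∈ Ioo ς t, position φ (e, s, t) x < 0 := by
    intro x hx
    by_contra hx0
    obtain ⟨y, hy, hy0⟩ := intermediate_value_Icc hx.1.le
      (hcont.mono (Icc_subset_Icc hς.1.le hx.2.le)) ⟨not_lt.1 hcon, not_lt.1 hx0⟩
    exact hne0 y ⟨hς.1.trans_le hy.1, hy.2.trans_lt hx.2⟩ hy0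
  have hd := (hasDerivWithinAt_position (e := e) (s := s) φ ht ⟨ht.le, le_rfl⟩).mono
    (Icc_subset_Icc_left hς.1.le : Icc ς t ⊆ Icc 0 t)
  have := HasDerivWithinAt.nonneg_of_neg_left hς.2 hd (position_end ht) hneg
  rw [velocity_end ht] at this
  nlinarith [mul_pos ht hl]

theorem speed_nonneg (h : IsFlightFamily Φ M e₀ φ) (hq : (e, s, t) ∈ box e₀ M) (ht : 0 < t)
    (hl : 0 < landing φ (e, s, t))
    (hne : ∀ t' ∈ Ioo 0 t, speed φ (e, s, t') ≠ speed φ (e, s, t)) : 0 ≤ speed φ (e, s, t) := by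
  have := HasDerivWithinAt.nonneg_of_pos_right ht
    (hasDerivWithinAt_position (e := e) (s := s) φ ht ⟨le_rfl, ht.le⟩) position_zero
    (h.position_pos hq ht hl hne)
  rwa [velocity_zero] at this

/-- Flights in rescaled variables are flights of the oscillator. -/
theorem isFlight (h : IsFlightFamily Φ M e₀ φ) {f : ℝ → ℝ → ℝ} {g : ℝ → ℝ} {c τ K : ℝ}
    (he : 0 < e) (hK : 0 < K)
    (hΦ : ∀ s X Y, K * e ^ 2 * Φ (e, s, X, Y) =
      g (τ + e * s) - f (c + K * e ^ 4 * X) (K * e ^ 3 * Y))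
    (hq : (e, s, t) ∈ box e₀ M) (ht : 0 < t) :
    IsFlight f g c (τ + e * s) (K * e ^ 3 * speed φ (e, s, t)) (e * t)
      (fun u => c + K * e ^ 4 * position φ (e, s, t) (u / e))
      (fun u => K * e ^ 3 * velocity φ (e, s, t) (u / e)) := by
  have hmaps : MapsTo (fun u : ℝ => u / e) (Icc 0 (e * t)) (Icc 0 t) := fun u hu =>
    ⟨div_nonneg hu.1 he.le, by rw [div_le_iff₀ he, mul_comm]; exact hu.2⟩
  have hdiv : ∀ u, HasDerivWithinAt (fun u : ℝ => u / e) (1 / e) (Icc 0 (e * t)) u := fun u =>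
    (hasDerivWithinAt_id u _).div_const e
  refine ⟨?_, ?_, fun u hu => ?_, fun u hu => ?_⟩
  · simp [position_zero]
  · simp [velocity_zero, speed]
  · have h1 := ((hasDerivWithinAt_position (e := e) (s := s) φ ht (hmaps hu)).comp u (hdiv u)
      hmaps).const_mul (K * e ^ 4) |>.const_add c
    refine h1.congr_deriv ?_
    field_simp
  · have h1 := ((h.hasDerivWithinAt_velocity hq ht (hmaps hu)).comp u (hdiv u) hmaps).const_mul
      (K * e ^ 3)
    refine h1.congr_deriv ?_
    have h2 := hΦ (s + u / e) (position φ (e, s, t) (u / e)) (velocity φ (e, s, t) (u / e))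
    rw [mul_add, mul_div_cancel₀ _ he.ne', ← add_assoc] at h2
    rw [← h2]
    field_simp

end IsFlightFamily

namespace IsImpactOrbit

variable {Φ : ℝ × ℝ × ℝ × ℝ → ℝ} {k : ℝ × ℝ → ℝ} {M e₀ e σ : ℝ} {φ : ℝ × ℝ × ℝ → Path01}
  {z : ℕ → ℝ × ℝ} {f : ℝ → ℝ → ℝ} {g : ℝ → ℝ} {ρ : ℝ → ℝ → ℝ} {c τ K : ℝ}

theorem impactStep (hz : IsImpactOrbit φ k M e₀ e σ z) (h : IsFlightFamily Φ M e₀ φ)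
    (he : 0 < e) (hK : 0 < K)
    (hΦ : ∀ s X Y, K * e ^ 2 * Φ (e, s, X, Y) =
      g (τ + e * s) - f (c + K * e ^ 4 * X) (K * e ^ 3 * Y))
    (hk : ∀ w, K * e ^ 3 * (w * k (e, w)) = ρ c (-(K * e ^ 3 * w))) (n : ℕ) :
    ImpactStep f g ρ c (τ + e * (z n).1, K * e ^ 3 * speed φ (e, z n))
      (τ + e * (z (n + 1)).1, K * e ^ 3 * speed φ (e, z (n + 1))) := by
  have ht := hz.pos n
  have hfl := h.isFlight (s := (z n).1) (t := (z n).2) he hK hΦ (hz.mem n) ht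
  have hdiv : e * (z n).2 / e = (z n).2 := mul_div_cancel_left₀ _ he.ne'
  refine ⟨(τ + e * (z n).1, K * e ^ 3 * speed φ (e, z n), e * (z n).2),
    (τ + e * (z (n + 1)).1, K * e ^ 3 * IsFlightFamily.velocity φ (e, z n) (e * (z n).2 / e)),
    ⟨rfl, rfl, Or.inl ⟨mul_pos he ht, _, _, hfl, fun u hu => ?_, ?_⟩⟩, ⟨?_, _, _, hfl, rfl⟩, ?_⟩
  · have := h.position_pos (hz.mem n) ht (hz.landing_pos n) (hz.not_early n) (u / e)
      ⟨div_pos hu.1 he, by rw [div_lt_iff₀ he, mul_comm]; exact hu.2⟩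
    exact lt_add_of_pos_right _ (by positivity)
  · rw [hdiv, IsFlightFamily.position_end ht, mul_zero, add_zero]
  · simp only [hz.time]; ring
  · simp only [ImpactOscillator.restitution]
    rw [hdiv, hz.restitution, hk, show ((e, z n) : ℝ × ℝ × ℝ) = (e, (z n).1, (z n).2) from rfl,
      IsFlightFamily.velocity_end ht, mul_neg]
    rfl

/-- Launch speed is duration times a bounded factor, so it tends to zero with the durations. -/
theorem tendsto_scaled (hz : IsImpactOrbit φ k M e₀ e σ z) (h : IsFlightFamily Φ M e₀ φ)
    (τ K : ℝ) :
    Tendsto (fun n => (τ + e * (z n).1, K * e ^ 3 * speed φ (e, z n))) atTop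
      (𝓝 (τ + e * σ, 0)) := by
  have h1 := hz.tendsto.fst_nhds
  have h2 := hz.tendsto.snd_nhds
  have h3 : Tendsto (fun n => speed φ (e, z n)) atTop (𝓝 0) := by
    refine squeeze_zero_norm (a := fun n => (z n).2 * (2 * accBound M)) (fun n => ?_) ?_
    · have h4 : ‖bvpVelocity (φ (e, z n)) 0‖ ≤ 2 * ‖φ (e, z n)‖ :=
        (ContinuousMap.norm_coe_le_norm _ _).trans (norm_bvpVelocity_le _)
      have h5 := h.norm_le _ (hz.mem n)
      rw [speed, norm_mul, Real.norm_of_nonneg (hz.pos n).le]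
      exact mul_le_mul_of_nonneg_left (h4.trans (by linarith)) (hz.pos n).le
    · simpa using h2.mul_const (2 * accBound M)
  refine ((h1.const_mul e).const_add τ).prodMk_nhds ?_
  simpa using h3.const_mul (K * e ^ 3)

theorem mem_stableManifold (hz : IsImpactOrbit φ k M e₀ e σ z) (h : IsFlightFamily Φ M e₀ φ)
    (he : 0 < e) (hK : 0 < K)
    (hΦ : ∀ s X Y, K * e ^ 2 * Φ (e, s, X, Y) =
      g (τ + e * s) - f (c + K * e ^ 4 * X) (K * e ^ 3 * Y))
    (hk : ∀ w, K * e ^ 3 * (w * k (e, w)) = ρ c (-(K * e ^ 3 * w))) :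
    (τ + e * (z 0).1, K * e ^ 3 * speed φ (e, z 0)) ∈ stableManifold f g ρ c (τ + e * σ, 0) := by
  refine ⟨?_, fun n => (τ + e * (z n).1, K * e ^ 3 * speed φ (e, z n)), rfl,
    fun n => hz.impactStep h he hK hΦ hk n, hz.tendsto_scaled h τ K⟩
  have := h.speed_nonneg (hz.mem 0) (hz.pos 0) (hz.landing_pos 0) (hz.not_early 0)
  positivity

end IsImpactOrbit

/-! ### Zeros of the acceleration and conclusion -/

theorem exists_monotonicity_of_max {g : ℝ → ℝ} (hg : ContDiff ℝ 2 g) {τ : ℝ} (h1 : deriv g τ = 0)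
    (h2 : deriv (deriv g) τ < 0) : ∃ η₀ > 0, (∀ x ∈ Ioo (τ - η₀) τ, 0 < deriv g x) ∧
      (∀ x ∈ Ioo τ (τ + η₀), deriv g x < 0) ∧ StrictMonoOn g (Ioc (τ - η₀) τ) ∧
      StrictAntiOn g (Ico τ (τ + η₀)) := by
  have hg1 : ContDiff ℝ 1 (deriv g) := hg.deriv'
  have hc : ContinuousAt (deriv (deriv g)) τ := (hg1.continuous_deriv le_rfl).continuousAt
  obtain ⟨η₀, hη₀, hball⟩ := Metric.eventually_nhds_iff_ball.1 (hc.eventually_lt_const h2)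
  have hanti : StrictAntiOn (deriv g) (Ioo (τ - η₀) (τ + η₀)) := by
    refine strictAntiOn_of_deriv_neg (convex_Ioo _ _) hg1.continuous.continuousOn fun x hx => ?_
    rw [interior_Ioo] at hx
    exact hball x (by rwa [Real.ball_eq_Ioo])
  have hmem : τ ∈ Ioo (τ - η₀) (τ + η₀) := ⟨by linarith, by linarith⟩
  have hl : ∀ x ∈ Ioo (τ - η₀) τ, 0 < deriv g x := fun x hx => by
    have := hanti ⟨hx.1, by linarith [hx.2]⟩ hmem hx.2
    rwa [h1] at this
  have hr : ∀ x ∈ Ioo τ (τ + η₀), deriv g x < 0 := fun x hx => by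
    have := hanti hmem ⟨by linarith [hx.1], hx.2⟩ hx.1
    rwa [h1] at this
  refine ⟨η₀, hη₀, hl, hr, ?_, ?_⟩
  · exact strictMonoOn_of_deriv_pos (convex_Ioc _ _) hg.continuous.continuousOn
      (by rw [interior_Ioc]; exact hl)
  · exact strictAntiOn_of_deriv_neg (convex_Ico _ _) hg.continuous.continuousOn
      (by rw [interior_Ico]; exact hr)

theorem deriv_acc (f : ℝ → ℝ → ℝ) (g : ℝ → ℝ) (c : ℝ) : deriv (acc f g c) = deriv g := by
  funext x
  exact deriv_sub_const _

/-- The graph of a `C¹` function over `[a, b]`, parametrized from right to left. -/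
theorem isC1Arc_graph {u : ℝ → ℝ} {a b : ℝ} (hab : a < b)
    (hu : ∀ s ∈ Icc a b, ContDiffAt ℝ 1 u s) {e : ℝ} (he : 0 < e) (τ : ℝ) :
    IsC1Arc (fun x => (τ + e * (b - x * (b - a)), u (b - x * (b - a)))) ∧
    ∀ s ∈ Ioo a b, ∃ x ∈ Ioo (0 : ℝ) 1, b - x * (b - a) = s ∧
      (deriv (fun x => (τ + e * (b - x * (b - a)), u (b - x * (b - a)))) x).2 =
        -(b - a) * deriv u s := by
  have hba : 0 < b - a := sub_pos.2 hab
  have hmem : ∀ x ∈ Icc (0 : ℝ) 1, b - x * (b - a) ∈ Icc a b := fun x hx =>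
    ⟨by nlinarith [hx.2], by nlinarith [hx.1]⟩
  have hin : ∀ x : ℝ, HasDerivAt (fun x : ℝ => b - x * (b - a)) (-(b - a)) x := fun x => by
    simpa using ((hasDerivAt_id x).mul_const (b - a)).const_sub b
  have hd : ∀ x ∈ Icc (0 : ℝ) 1,
      HasDerivAt (fun x => (τ + e * (b - x * (b - a)), u (b - x * (b - a))))
        (e * -(b - a), deriv u (b - x * (b - a)) * -(b - a)) x := fun x hx =>
    (((hin x).const_mul e).const_add τ).prodMk
      (((hu _ (hmem x hx)).differentiableAt one_ne_zero).hasDerivAt.comp x (hin x))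
  refine ⟨⟨fun x hx => ?_, fun x hx => ?_, fun x _ y _ hxy => ?_⟩, fun s hs => ?_⟩
  · have h1 : ContDiffAt ℝ 1 (fun x : ℝ => u (b - x * (b - a))) x :=
      ContDiffAt.comp (g := u) (f := fun x : ℝ => b - x * (b - a)) x (hu _ (hmem x hx))
        (by fun_prop)
    have h2 : ContDiffAt ℝ 1 (fun x : ℝ => τ + e * (b - x * (b - a))) x := by fun_prop
    exact (h2.prodMk h1).contDiffWithinAt
  · rw [(hd x hx).hasDerivWithinAt.derivWithin (uniqueDiffOn_Icc zero_lt_one x hx)]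
    intro h0
    have : e * -(b - a) = 0 := congrArg Prod.fst h0
    nlinarith [mul_pos he hba]
  · have h1 := congrArg Prod.fst hxy
    simp only [add_right_inj] at h1
    have h2 := sub_right_injective (mul_left_cancel₀ he.ne' h1)
    exact mul_right_cancel₀ hba.ne' h2
  · have hx : (b - s) / (b - a) * (b - a) = b - s := div_mul_cancel₀ _ hba.ne'
    have hx' : (b - s) / (b - a) ∈ Ioo (0 : ℝ) 1 :=
      ⟨div_pos (sub_pos.2 hs.2) hba, by rw [div_lt_one hba]; linarith [hs.1]⟩
    have hs' : b - (b - s) / (b - a) * (b - a) = s := by rw [hx]; ring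
    refine ⟨_, hx', hs', ?_⟩
    rw [(hd _ (Ioo_subset_Icc_self hx')).deriv]
    simp only
    rw [hs', mul_comm]

/-- A curve of impact orbits in rescaled variables, tangent to the axis at `sA`, yields a stable
manifold tangent to the axis. -/
theorem stableManifoldTangentAt_of_leaf {Φ : ℝ × ℝ × ℝ × ℝ → ℝ} {k : ℝ × ℝ → ℝ} {M e₀ e : ℝ}
    {φ : ℝ × ℝ × ℝ → Path01} (h : IsFlightFamily Φ M e₀ φ) {f : ℝ → ℝ → ℝ} {g : ℝ → ℝ}
    {ρ : ℝ → ℝ → ℝ} {c τs K : ℝ} (he : 0 < e) (hK : 0 < K)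
    (hΦc : ∀ s X Y, K * e ^ 2 * Φ (e, s, X, Y) =
      g (τs + e * s) - f (c + K * e ^ 4 * X) (K * e ^ 3 * Y))
    (hkc : ∀ w, K * e ^ 3 * (w * k (e, w)) = ρ c (-(K * e ^ 3 * w)))
    (hf1 : ContDiff ℝ 1 fun q : ℝ × ℝ => f q.1 q.2) (hg : Continuous g) (hρ : ρ c 0 = 0)
    {sA σ κ : ℝ} {v : ℝ → ℝ} (ha3 : acc f g c (τs + e * σ) < 0) (hσ : sA < σ) (hκ : 0 < κ)
    (hv : ∀ s ∈ Icc (sA - κ) σ, ContDiffAt ℝ 1 v s) (hvσ : v σ = 0) (hvA : v sA = 0)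
    (hvA' : HasDerivAt v 0 sA)
    (horb : ∀ s ∈ Ico (sA - κ) σ, ∃ t z, speed φ (e, s, t) = v s ∧ z 0 = (s, t) ∧
      IsImpactOrbit φ k M e₀ e σ z)
    (hcone : ∀ κ' > 0, ∀ᶠ w : ℝ × ℝ in 𝓝 (sA, 0), κ' * |w.1 - sA| < w.2 → ∃ t z σ',
      speed φ (e, w.1, t) = w.2 ∧ z 0 = (w.1, t) ∧ IsImpactOrbit φ k M e₀ e σ' z ∧ σ' ≠ σ) :
    StableManifoldTangentAt f g ρ c (τs + e * σ, 0) (τs + e * sA) := by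
  have hKe3 : 0 < K * e ^ 3 := by positivity
  refine ⟨?_, ?_⟩
  · obtain ⟨harc, htan⟩ := isC1Arc_graph (u := fun s => K * e ^ 3 * v s) (a := sA - κ) (b := σ)
      (by linarith) (fun s hs => contDiffAt_const.mul (hv s hs)) he τs
    refine ⟨_, harc, fun x hx => ?_, ?_, ?_⟩
    · have hL : 0 < σ - (sA - κ) := by linarith
      have hs1 : sA - κ ≤ σ - x * (σ - (sA - κ)) := by nlinarith [hx.2]
      -- The parameter `0` is the end-point `X` itself. It lies on no flight and belongs to its
      -- stable manifold as a point of rest.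
      rcases hx.1.eq_or_lt with rfl | hx0
      · simp only [zero_mul, sub_zero, hvσ, mul_zero]
        exact ⟨le_rfl, fun _ => (τs + e * σ, 0), rfl,
          fun _ => impactStep_rest hf1.continuous hg hρ ha3,
          tendsto_const_nhds⟩
      · obtain ⟨t, z, hsp, hz0, hz⟩ := horb _ ⟨hs1, by nlinarith⟩
        have := hz.mem_stableManifold h he hK hΦc hkc
        rw [hz0, hsp] at this
        exact this
    · simp [hvσ]
    · obtain ⟨x, hx, hxs, hdx⟩ := htan sA ⟨by linarith, by linarith⟩
      refine ⟨x, hx, ?_, ?_⟩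
      · simp [hxs, hvA]
      · rw [hdx, (hvA'.const_mul (K * e ^ 3)).deriv]
        simp
  · intro κ' hκ'
    have hscale : Tendsto (fun w : ℝ × ℝ => ((w.1 - τs) / e, w.2 / (K * e ^ 3)))
        (𝓝 (τs + e * sA, 0)) (𝓝 (sA, 0)) := by
      have : Continuous fun w : ℝ × ℝ => ((w.1 - τs) / e, w.2 / (K * e ^ 3)) := by fun_prop
      convert this.tendsto _ using 2
      simp [he.ne']
    -- Velocities scale by `K * e ^ 3` and times by `e`, so slopes scale by `K * e ^ 2`.
    filter_upwards [hscale.eventually (hcone (κ' / (K * e ^ 2)) (by positivity))] with w hw hmem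
    by_contra! hlt
    rw [abs_of_nonneg hmem.1] at hlt
    obtain ⟨t, z, σ', hsp, hz0, hz, hne⟩ := hw (by
      have h1 : (w.1 - τs) / e - sA = (w.1 - (τs + e * sA)) / e := by field_simp; ring
      rw [h1, abs_div, abs_of_pos he, lt_div_iff₀ hKe3]
      refine lt_of_eq_of_lt ?_ hlt
      field_simp)
    have hw0 : (τs + e * (z 0).1, K * e ^ 3 * speed φ (e, z 0)) = w := by
      rw [hz0, hsp]
      simp only
      rw [mul_div_cancel₀ _ he.ne', mul_div_cancel₀ _ hKe3.ne']
      ext <;> simp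
    have hlim := limit_unique_of_mem_stableManifold hf1 hmem hw0
      (fun n => hz.impactStep h he hK hΦc hkc n) (hz.tendsto_scaled h τs K)
    have := congrArg Prod.fst hlim
    simp only [add_right_inj] at this
    exact hne (mul_left_cancel₀ he.ne' this).symm

/-- Tangency of the stable manifold of a point of rest after the creation of a pair of zeros of
the initial acceleration. -/
theorem exists_stableManifoldTangentAt
    (f : ℝ → ℝ → ℝ) (hf : ContDiff ℝ ∞ (fun q : ℝ × ℝ => f q.1 q.2))
    (g : ℝ → ℝ) (hg : ContDiff ℝ ∞ g)
    (ρ : ℝ → ℝ → ℝ) (hρ : ContDiff ℝ 1 (fun q : ℝ × ℝ => ρ q.1 q.2))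
    (hρ_zero : ∀ c, ρ c 0 = 0) (hρ_pos : ∀ c v, v < 0 → 0 < ρ c v)
    (c₀ τs : ℝ) (hr_pos : deriv (ρ c₀) 0 < 0) (hr_lt_one : -1 < deriv (ρ c₀) 0)
    (hswan : IsNegativeSwanPoint f g c₀ τs)
    (hd : unfoldingSign f g c₀ τs < 0) :
    ∃ η₀ > 0, ∀ η ∈ Ioo (0 : ℝ) η₀, ∃ δ > 0, ∀ c ∈ Ioo c₀ (c₀ + δ),
      ∃ τ₁ τ₂ τ₃ : ℝ, τs - η < τ₁ ∧ τ₁ < τ₂ ∧ τ₂ < τ₃ ∧ τ₃ < τs + η ∧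
        (∀ τ ∈ Ioo (τs - η) (τs + η), acc f g c τ = 0 ↔ τ = τ₁ ∨ τ = τ₂) ∧
        0 < deriv (acc f g c) τ₁ ∧
        deriv (acc f g c) τ₂ < 0 ∧
        acc f g c τ₃ < 0 ∧
        StableManifoldTangentAt f g ρ c (τ₃, 0) τ₁ := by
  have hf1 : ContDiff ℝ 1 fun q : ℝ × ℝ => f q.1 q.2 := contDiff_infty.1 hf 1
  have hg2 : ContDiff ℝ 2 g := contDiff_infty.1 hg 2
  have a0 : g τs = f c₀ 0 := sub_eq_zero.1 hswan.acc_eq_zero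
  have a1 : deriv g τs = 0 := by rw [← deriv_acc f g c₀]; exact hswan.deriv_acc_eq_zero
  have a2' : iteratedDeriv 2 (acc f g c₀) τs = deriv (deriv g) τs := by
    rw [iteratedDeriv_succ, iteratedDeriv_one, deriv_acc]
  have a2 : deriv (deriv g) τs < 0 := a2' ▸ hswan.iteratedDeriv_acc_neg
  -- The unfolding sign and the negative second derivative give `∂a/∂c > 0`, that is, `f (·, 0)`
  -- decreases at `c₀`.
  obtain ⟨m, hm, hfm⟩ : ∃ m > 0, deriv (fun c' => f c' 0) c₀ = -m := by
    refine ⟨-deriv (fun c' => f c' 0) c₀, ?_, by ring⟩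
    have h1 : deriv (fun c' => acc f g c' τs) c₀ = -deriv (fun c' => f c' 0) c₀ := by
      simp only [acc]
      rw [deriv_const_sub]
    rw [unfoldingSign, a2', h1] at hd
    nlinarith
  obtain ⟨K, hK, hgK⟩ : ∃ K > 0, deriv (deriv g) τs = -(2 * K) :=
    ⟨-deriv (deriv g) τs / 2, by linarith, by ring⟩
  obtain ⟨Φ, hΦ, hΦ0, hΦe⟩ := exists_scaled_field hf hg hK hm a0 a1 hgK hfm
  obtain ⟨k, hk, hk0, hkpos, hkC, hke⟩ :=
    exists_scaled_factor hρ hρ_zero hρ_pos c₀ (a := K / m) hK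
  set r := -deriv (ρ c₀) 0 with hr
  have hM : 7 ≤ horizon r := by
    have h1 : 0 < 1 - r := by linarith
    unfold horizon reach
    have : 0 < 4 / (1 - r) := by positivity
    have : 0 < (5 * (9 + 4 / (1 - r)) ^ 2 / 2 + 8) / (4 * (1 - r)) := by positivity
    linarith
  obtain ⟨e₀, he₀, φ, h⟩ := exists_isScaledFamily (r := r) hΦ hΦ0 hM (by linarith) (by linarith)
    hk hk0 hkpos hkC
  obtain ⟨e₁, he₁, hleaf⟩ := h.exists_leaf le_rfl
  obtain ⟨η₀, hη₀, gl, gr, gmono, ganti⟩ := exists_monotonicity_of_max hg2 a1 a2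
  set M := horizon r
  refine ⟨η₀, hη₀, fun η hη => ?_⟩
  -- The signs at `s = 0` and `s = 2` place the second zero between them, before `σ > 5/2`. The
  -- bound on `e * M` keeps the point of rest within `η`.
  obtain ⟨ε, hε, hsmall⟩ : ∃ ε > 0, ∀ e ∈ Ioo (0 : ℝ) ε,
      0 < Φ (e, 0, 0, 0) ∧ Φ (e, 2, 0, 0) < 0 ∧ e < e₁ ∧ e * M < η := by
    have hc : ∀ s : ℝ, Continuous fun e : ℝ => Φ (e, s, 0, 0) := fun s =>
      hΦ.continuous.comp (by fun_prop)
    have c0 := (hc 0).continuousAt (x := 0) |>.eventually_const_lt (u := 0) (by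
      beta_reduce; rw [hΦ0]; norm_num)
    have c2 := (hc 2).continuousAt (x := 0) |>.eventually_lt_const (u := 0) (by
      beta_reduce; rw [hΦ0]; norm_num)
    have c3 := (by fun_prop : Continuous fun e : ℝ => e * M).continuousAt (x := 0)
      |>.eventually_lt_const (u := η) (by simpa using hη.1)
    obtain ⟨ε, hε, hb⟩ := Metric.eventually_nhds_iff_ball.1
      (c0.and (c2.and ((eventually_lt_nhds he₁).and c3)))
    refine ⟨ε, hε, fun e he => hb e ?_⟩
    rw [Real.ball_eq_Ioo]
    exact ⟨by linarith [he.1], by linarith [he.2]⟩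
  have hβ : 0 < K / m := div_pos hK hm
  refine ⟨K / m * ε ^ 2, by positivity, fun c hc => ?_⟩
  -- Only parameters above `c₀` have a real scale `e`. This is where the direction of unfolding
  -- enters.
  obtain ⟨e, he, hec⟩ : ∃ e ∈ Ioo 0 ε, c = c₀ + K / m * e ^ 2 := by
    have hpos : 0 < (c - c₀) / (K / m) := div_pos (sub_pos.2 hc.1) hβ
    refine ⟨√((c - c₀) / (K / m)), ⟨Real.sqrt_pos.2 hpos, ?_⟩, ?_⟩
    · rw [Real.sqrt_lt' hε, div_lt_iff₀ hβ]
      linarith [hc.2]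
    · rw [Real.sq_sqrt hpos.le, mul_div_cancel₀ _ hβ.ne']
      ring
  obtain ⟨he, heε⟩ := he
  obtain ⟨d0, d2, d1, d3⟩ := hsmall e ⟨he, heε⟩
  obtain ⟨sA, σ, κ, v, hsA, hσ, hσM, hκ, hΦA, hv, hvσ, hvA, hvA', horb, hcone⟩ :=
    hleaf e ⟨he, d1⟩
  obtain ⟨hsA1, hsA2⟩ := abs_lt.1 hsA
  have hacc : ∀ s, acc f g c (τs + e * s) = K * e ^ 2 * Φ (e, s, 0, 0) := fun s => by
    rw [hΦe, acc, hec]; simp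
  have hKe : 0 < K * e ^ 2 := by positivity
  have hKe3 : 0 < K * e ^ 3 := by positivity
  have hΦc : ∀ s X Y, K * e ^ 2 * Φ (e, s, X, Y) =
      g (τs + e * s) - f (c + K * e ^ 4 * X) (K * e ^ 3 * Y) := fun s X Y => by rw [hΦe, hec]
  have hkc : ∀ w, K * e ^ 3 * (w * k (e, w)) = ρ c (-(K * e ^ 3 * w)) := fun w => by
    rw [hke, hec]
  obtain ⟨hη0, hηη⟩ := hη
  have m1 : e * σ < η := (mul_lt_mul_of_pos_left hσM he).trans d3
  have m2 : e * 2 < e * σ := mul_lt_mul_of_pos_left (by linarith) he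
  have m3 : -η < e * sA := by
    have := mul_lt_mul_of_pos_left (by linarith : -2 < sA) he
    linarith
  have m4 : e * sA < 0 := mul_neg_of_pos_of_neg he (by linarith)
  have zA : g (τs + e * sA) = f c 0 := sub_eq_zero.1 ((hacc sA).trans (by rw [hΦA, mul_zero]))
  have p0 : f c 0 < g τs := by
    have := hacc 0
    rw [mul_zero, add_zero, acc] at this
    nlinarith [mul_pos hKe d0]
  have p2 : g (τs + e * 2) < f c 0 := by
    have := hacc 2
    rw [acc] at this
    nlinarith [mul_pos_of_neg_of_neg (neg_neg_of_pos hKe) d2]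
  obtain ⟨τ₂, hτ₂, zB⟩ := intermediate_value_Icc' (by linarith : τs ≤ τs + e * 2)
    hg2.continuous.continuousOn ⟨p2.le, p0.le⟩
  have hτ₂s : τs < τ₂ := hτ₂.1.lt_of_ne fun h0 => by rw [← h0] at zB; linarith
  have ha3 : acc f g c (τs + e * σ) < 0 := by
    have := ganti ⟨hτ₂.1, by linarith [hτ₂.2]⟩ ⟨by linarith, by linarith⟩
      (by linarith [hτ₂.2] : τ₂ < τs + e * σ)
    rw [acc]
    linarith
  refine ⟨τs + e * sA, τ₂, τs + e * σ, by linarith, by linarith, by linarith [hτ₂.2], by linarith,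
    fun τ hτ => ⟨fun h0 => ?_, ?_⟩, ?_, ?_, ha3, stableManifoldTangentAt_of_leaf h.flight he hK
      hΦc hkc hf1 hg2.continuous (hρ_zero c) ha3 (by linarith) hκ hv hvσ hvA hvA' horb hcone⟩
  · have h0 : g τ = f c 0 := sub_eq_zero.1 h0
    rcases le_or_gt τ τs with hle | hlt
    · exact Or.inl (gmono.injOn ⟨by linarith [hτ.1], hle⟩ ⟨by linarith, by linarith⟩
        (h0.trans zA.symm))
    · exact Or.inr (ganti.injOn ⟨hlt.le, by linarith [hτ.2]⟩ ⟨hτ₂.1, by linarith [hτ₂.2]⟩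
        (h0.trans zB.symm))
  · rintro (rfl | rfl)
    · exact sub_eq_zero.2 zA
    · exact sub_eq_zero.2 zB
  · rw [deriv_acc]
    exact gl _ ⟨by linarith, by linarith⟩
  · rw [deriv_acc]
    exact gr _ ⟨hτ₂s, by linarith [hτ₂.2]⟩

end ImpactOscillator

theorem proposition6p1
    (f : ℝ → ℝ → ℝ) (hf : ContDiff ℝ ∞ (fun q : ℝ × ℝ => f q.1 q.2))
    (g : ℝ → ℝ) (hg : ContDiff ℝ ∞ g) (T : ℝ) (hT : 0 < T) (hgT : Function.Periodic g T)
    (ρ : ℝ → ℝ → ℝ) (hρ : ContDiff ℝ 1 (fun q : ℝ × ℝ => ρ q.1 q.2))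
    (hρ_zero : ∀ c, ρ c 0 = 0) (hρ_pos : ∀ c v, v < 0 → 0 < ρ c v)
    (c₀ τs : ℝ) (hr_pos : deriv (ρ c₀) 0 < 0) (hr_lt_one : -1 < deriv (ρ c₀) 0)
    (hswan : ImpactOscillator.IsNegativeSwanPoint f g c₀ τs)
    (hd : ImpactOscillator.unfoldingSign f g c₀ τs < 0) :
    ∃ η₀ > 0, ∀ η ∈ Ioo (0 : ℝ) η₀, ∃ δ > 0, ∀ c ∈ Ioo c₀ (c₀ + δ),
      ∃ τ₁ τ₂ τ₃ : ℝ, τs - η < τ₁ ∧ τ₁ < τ₂ ∧ τ₂ < τ₃ ∧ τ₃ < τs + η ∧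
        (∀ τ ∈ Ioo (τs - η) (τs + η), ImpactOscillator.acc f g c τ = 0 ↔ τ = τ₁ ∨ τ = τ₂) ∧
        0 < deriv (ImpactOscillator.acc f g c) τ₁ ∧
        deriv (ImpactOscillator.acc f g c) τ₂ < 0 ∧
        ImpactOscillator.acc f g c τ₃ < 0 ∧
        ImpactOscillator.StableManifoldTangentAt f g ρ c (τ₃, 0) τ₁ :=
  ImpactOscillator.exists_stableManifoldTangentAt f hf g hg ρ hρ hρ_zero hρ_pos c₀ τs hr_pos
    hr_lt_one hswan hd
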